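/- Fix a dimension $d$, two different probability distributions $F_1\neq F_2$ on $\mathbb R^d$ with $\int\|x\|\,dF_k(x)<\infty$ ($k=1,2$), a number $\theta\in(0,1)$, and real numbers $\delta_n$ with $\delta_n\to0$ and $n\delta_n\to\infty$. Put $\tau_n=\lfloor n\theta\rfloor$. For every $n$ let $\mathbf Z_1,\dots,\mathbf Z_n$ (more precisely $\mathbf Z_{n,1},\dots,\mathbf Z_{n,n}$, all defined on one probability space) be independent, with $\mathbf Z_1,\dots,\mathbf Z_{\tau_n}\sim F_1$ and $\mathbf Z_{\tau_n+1},\dots,\mathbf Z_n\sim F_2$. With the Euclidean norm let $$T_{11}(t)=\binom t2^{-1}\sum_{1\le i<j\le t}\|\mathbf Z_i-\mathbf Z_j\|,\quad T_{22}(t)=\binom{n-t}2^{-1}\sum_{t<i<j\le n}\|\mathbf Z_i-\mathbf Z_j\|,\quad T_{12}(t)=\frac1{t(n-t)}\sum_{i\le t<j}\|\mathbf Z_i-\mathbf Z_j\|,$$ $$S_n(t)=\frac{t(n-t)}{n^2}\Big[\{T_{12}(t)-T_{11}(t)\}^2+\{T_{12}(t)-T_{22}(t)\}^2\Big],\qquad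 \mathcal A_n=\{\lfloor n\delta_n\rfloor,\dots,\lceil n(1-\delta_n)\rceil\}.$$ Let $\widehat T_n$ be any maximiser of $S_n(t)$ over $t\in\mathcal A_n$, let $\widehat S_n=\max_{t\in\mathcal A_n}S_n(t)$, and for a permutation $\pi$ of $\{1,\dots,n\}$ let $\widehat S_n^{(\pi)}$ be $\widehat S_n$ computed from $\mathbf Z_{\pi(1)},\dots,\mathbf Z_{\pi(n)}$. For $0<\alpha<1$ let $c_{1-\alpha}(n)=\inf\{x\ge0:\ \frac1{n!}\sum_\pi\mathbf 1[\widehat S_n^{(\pi)}\le x]\ge1-\alpha\}$; $\widehat T_n$ is detected as the change-point at level $\alpha$ if $\widehat S_n>c_{1-\alpha}(n)$. Then: (a) $\widehat\theta_n=\widehat T_n/n$ converges to $\theta$ almost surely, in each of the following two cases: (i) the samples of different sizes are nested, that is, they are drawn from one sequence of $F_1$-observations and one sequence of $F_2$-observations, each enumerated from the outer end of the sample towards the change: for all $m,n$, $\mathbf Z_{m,i}=\mathbf Z_{n,i}$ whenever $i\le\min(\tau_m,\tau_n)$, and $\mathbf Z_{m,m+1-j}=\mathbf Z_{n,n+1-j}$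 whenever $1\le j\le\min(m-\tau_m,\,n-\tau_n)$; (ii) the joint law of the samples of different sizes is arbitrary, and $\int\|x\|^4\,dF_k(x)<\infty$ for $k=1,2$. (b) If $F_1$ and $F_2$ are sub-exponential, i.e. for some $K>0$ and every unit vector $v$, $\int\exp(|\langle v,x\rangle|/K)\,dF_k(x)\le2$ ($k=1,2$), then for every $\alpha\in(0,1)$ and whatever the joint law of the samples of different sizes, $\widehat T_n$ is detected as the change-point at level $\alpha$ with probability tending to one as $n\to\infty$. -/

import Mathlib

open MeasureTheory ProbabilityTheory Filter Topology
open scoped ENNReal Nat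

namespace ChangePoint

/-- `d`-dimensional observations; the norm is the Euclidean (`ℓ₂`) one. -/
abbrev Vec (d : ℕ) : Type := EuclideanSpace ℝ (Fin d)

variable {d n : ℕ}

/-! The sample `z 0, …, z (n - 1)` is split at `t` into the first `t` observations (those with
index `< t`) and the last `n - t` observations (those with index `≥ t`). -/

/-- Average pairwise distance within the first `t` observations. -/
noncomputable def T11 (z : Fin n → Vec d) (t : ℕ) : ℝ :=
  (t.choose 2 : ℝ)⁻¹ *
    ∑ p : Fin n × Fin n with p.1 < p.2 ∧ (p.2 : ℕ) < t, ‖z p.1 - z p.2‖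

/-- Average pairwise distance within the last `n - t` observations. -/
noncomputable def T22 (z : Fin n → Vec d) (t : ℕ) : ℝ :=
  ((n - t).choose 2 : ℝ)⁻¹ *
    ∑ p : Fin n × Fin n with p.1 < p.2 ∧ t ≤ (p.1 : ℕ), ‖z p.1 - z p.2‖

/-- Average distance between the first `t` and the last `n - t` observations. -/
noncomputable def T12 (z : Fin n → Vec d) (t : ℕ) : ℝ :=
  ((t : ℝ) * ((n : ℝ) - t))⁻¹ *
    ∑ p : Fin n × Fin n with (p.1 : ℕ) < t ∧ t ≤ (p.2 : ℕ), ‖z p.1 - z p.2‖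

/-- The empirical divergence between the two parts of the sample. -/
noncomputable def divergence (z : Fin n → Vec d) (t : ℕ) : ℝ :=
  (T12 z t - T11 z t) ^ 2 + (T12 z t - T22 z t) ^ 2

/-- The weighted criterion `t (n - t) / n² * D_n(t)`. -/
noncomputable def criterion (z : Fin n → Vec d) (t : ℕ) : ℝ :=
  (t : ℝ) * ((n : ℝ) - t) / (n : ℝ) ^ 2 * divergence z t

/-- The search range `{⌊n δ⌋, …, ⌈n (1 - δ)⌉}`. -/
noncomputable def searchRange (n : ℕ) (δ : ℝ) : Finset ℕ :=
  Finset.Icc ⌊(n : ℝ) * δ⌋₊ ⌈(n : ℝ) * (1 - δ)⌉₊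

/-- `t` is a potential change-point: a maximiser of the criterion over the search range. -/
def IsPotentialChangePoint (δ : ℝ) (z : Fin n → Vec d) (t : ℕ) : Prop :=
  t ∈ searchRange n δ ∧ ∀ s ∈ searchRange n δ, criterion z s ≤ criterion z t

/-- The test statistic: the maximum of the criterion over the search range. -/
noncomputable def testStatistic (δ : ℝ) (z : Fin n → Vec d) : ℝ :=
  ⨆ t : {t : ℕ // t ∈ searchRange n δ}, criterion z t

/-- The permutation cut-off: the `1 - α` quantile of the test statistic computed on all the
`n !` rearrangements of the sample. -/
noncomputable def permutationCutoff (δ α : ℝ) (z : Fin n → Vec d) : ℝ :=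
  sInf {x : ℝ | 0 ≤ x ∧
    1 - α ≤ ((Finset.univ.filter fun π : Equiv.Perm (Fin n) =>
      testStatistic δ (fun i => z (π i)) ≤ x).card : ℝ) / (n ! : ℝ)}

/-- `t` is detected as the change-point at level `α`: it is the potential change-point, and the
test statistic exceeds the permutation cut-off. -/
def IsDetectedChangePoint (δ α : ℝ) (z : Fin n → Vec d) (t : ℕ) : Prop :=
  IsPotentialChangePoint δ z t ∧ permutationCutoff δ α z < testStatistic δ z

/-- `F` is sub-exponential: the `ψ₁`-norms of its one-dimensional projections,
`inf {c > 0 | E exp (|⟨v, X⟩| / c) ≤ 2}`, are bounded uniformly over the unit vectors `v`. -/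
def IsSubExponential (F : Measure (Vec d)) : Prop :=
  ∃ K : ℝ, 0 < K ∧ ∀ v : Vec d, ‖v‖ = 1 →
    ∫⁻ x, ENNReal.ofReal (Real.exp (|inner ℝ v x| / K)) ∂F ≤ 2

variable {Ω : Type*} [MeasurableSpace Ω]

/-- For every `n`, the row `Z n 0, …, Z n (n - 1)` consists of independent observations, the
first `τ n` of which have law `F₁` and the others law `F₂`. Nothing is said about the joint law
of different rows. -/
structure IsSingleChangeModel (P : Measure Ω) (Z : (n : ℕ) → Fin n → Ω → Vec d)
    (τ : ℕ → ℕ) (F₁ F₂ : Measure (Vec d)) : Prop where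
  indep : ∀ n, iIndepFun (Z n) P
  law_before : ∀ (n : ℕ) (i : Fin n), (i : ℕ) < τ n → HasLaw (Z n i) F₁ P
  law_after : ∀ (n : ℕ) (i : Fin n), τ n ≤ (i : ℕ) → HasLaw (Z n i) F₂ P

/-- The samples of different sizes are drawn from one sequence of `F₁`-observations and one
sequence of `F₂`-observations, each enumerated from the outer end of the sample towards the
change: a pre-change observation depends only on its position counted from the beginning, a
post-change observation only on its position counted from the end (`Fin.rev`). -/
def IsNested (Z : (n : ℕ) → Fin n → Ω → Vec d) (τ : ℕ → ℕ) : Prop :=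
  (∀ (m n : ℕ) (i : Fin m) (j : Fin n), (i : ℕ) < τ m → (j : ℕ) < τ n →
    (i : ℕ) = (j : ℕ) → Z m i = Z n j) ∧
  (∀ (m n : ℕ) (i : Fin m) (j : Fin n), τ m ≤ (i : ℕ) → τ n ≤ (j : ℕ) →
    (i.rev : ℕ) = (j.rev : ℕ) → Z m i = Z n j)

end ChangePoint

/-!
Uniformly over the splits, the criterion is a continuous function of the empirical laws of the two
parts, so along splits with `t / n → γ` it converges to the criterion `profile F₁ F₂ θ γ` of the two
limiting mixtures of `F₁` and `F₂`. For `γ ≤ θ` an explicit formula gives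
`profile F₁ F₂ θ γ ≤ γ (1 - θ) D`, where `D` is the divergence between `F₁` and `F₂`, with equality
at `γ = θ`, and reading the sample backwards gives the mirror image for `γ ≥ θ`. Moreover `D > 0`,
because the energy distance of different laws is positive: averaging over directions reduces this
to the line, where the energy distance is twice the integral of the squared difference of the
distribution functions. So `θ` is the only maximiser of the profile.

Only the splits near the ends of the sample are not covered by the law of large numbers: there the
criterion is at most of the order of `(∑_{i < t} ‖Z i‖)² / (n t)` plus its mirror image, which is
small uniformly in `t`. In the nested case this is the strong law; under fourth moments it
follows from a union bound over the squares `t = j²`.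

A random permutation of the sample behaves like a sample without a change, with the mixture
`θ F₁ + (1 - θ) F₂` on both sides, so the permutation cut-off tends to `0` while the test statistic
tends to a positive limit. Almost sure convergence, convergence in probability, and convergence in
probability for most permutations are all convergence along filters, so that one argument, along
ultrafilters, serves all of them.
-/

namespace ChangePoint

section MeanDist

variable {E : Type*} [NormedAddCommGroup E] [MeasurableSpace E]

/-- The mean distance `E ‖X - Y‖` between independent points `X` and `Y` with laws `μ` and `ν`. -/
noncomputable def meanDist (μ ν : Measure E) : ℝ :=
  ∫ p : E × E, ‖p.1 - p.2‖ ∂(μ.prod ν)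

/-- The energy distance `2 E ‖X - Y‖ - E ‖X - X'‖ - E ‖Y - Y'‖` of the laws `μ` of `X`, `X'` and
`ν` of `Y`, `Y'`, all independent. -/
noncomputable def energyDist (μ ν : Measure E) : ℝ :=
  2 * meanDist μ ν - meanDist μ μ - meanDist ν ν

lemma meanDist_comm (μ ν : Measure E) [SFinite μ] [SFinite ν] : meanDist μ ν = meanDist ν μ := by
  rw [meanDist, meanDist, ← integral_prod_swap]
  simp only [Prod.fst_swap, Prod.snd_swap, norm_sub_rev]

lemma integrable_norm_sub_prod {μ ν : Measure E} [IsFiniteMeasure μ] [IsFiniteMeasure ν]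
    (hμ : Integrable (fun x => x) μ) (hν : Integrable (fun x => x) ν) :
    Integrable (fun p : E × E => ‖p.1 - p.2‖) (μ.prod ν) :=
  ((hμ.comp_fst ν).sub (hν.comp_snd μ)).norm

end MeanDist

lemma integral_two_mul_sub_sub {α : Type*} [MeasurableSpace α] {ρ : Measure α} {f g h : α → ℝ}
    (hf : Integrable f ρ) (hg : Integrable g ρ) (hh : Integrable h ρ) :
    ∫ x, (2 * f x - g x - h x) ∂ρ = 2 * ∫ x, f x ∂ρ - ∫ x, g x ∂ρ - ∫ x, h x ∂ρ := by
  rw [integral_sub (f := fun x => 2 * f x - g x) ((hf.const_mul 2).sub hg) hh,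
    integral_sub (hf.const_mul 2) hg, integral_const_mul]

/-! ### The energy distance on the line -/

section Line

/-- The probability that `s` separates independent points with laws `μ` and `ν`. -/
noncomputable def separationProb (μ ν : Measure ℝ) (s : ℝ) : ℝ :=
  cdf μ s * (1 - cdf ν s) + cdf ν s * (1 - cdf μ s)

/-- The pairs `(p, s)` for which `s` separates the coordinates of `p`. Its sections are measured in
both directions to express `meanDist` through distribution functions. -/
def separatingSet : Set ((ℝ × ℝ) × ℝ) :=
  {q | (q.1.1 ≤ q.2 ∧ q.2 < q.1.2) ∨ (q.1.2 ≤ q.2 ∧ q.2 < q.1.1)}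

lemma measurableSet_separatingSet : MeasurableSet separatingSet := by
  unfold separatingSet
  measurability

lemma volume_separatingSet_section (p : ℝ × ℝ) :
    volume (Prod.mk p ⁻¹' separatingSet) = ENNReal.ofReal ‖p.1 - p.2‖ := by
  have hsection : Prod.mk p ⁻¹' separatingSet = Set.Ico (min p.1 p.2) (max p.1 p.2) := by
    ext s
    simp only [separatingSet, Set.mem_preimage, Set.mem_ofPred_eq, Set.mem_Ico]
    grind
  rw [hsection, Real.volume_Ico, Real.norm_eq_abs, max_sub_min_eq_abs']

lemma one_sub_cdf_nonneg (μ : Measure ℝ) (s : ℝ) : 0 ≤ 1 - cdf μ s :=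
  sub_nonneg.2 (cdf_le_one μ s)

lemma separationProb_nonneg (μ ν : Measure ℝ) (s : ℝ) : 0 ≤ separationProb μ ν s :=
  add_nonneg (mul_nonneg (cdf_nonneg μ s) (one_sub_cdf_nonneg ν s))
    (mul_nonneg (cdf_nonneg ν s) (one_sub_cdf_nonneg μ s))

lemma measurable_separationProb (μ ν : Measure ℝ) : Measurable (separationProb μ ν) := by
  have hμ : Measurable (cdf μ) := (monotone_cdf μ).measurable
  have hν : Measurable (cdf ν) := (monotone_cdf ν).measurable
  unfold separationProb
  fun_prop

lemma two_mul_sq_cdf_sub (μ ν : Measure ℝ) (s : ℝ) : 2 * (cdf μ s - cdf ν s) ^ 2 =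
    2 * separationProb μ ν s - separationProb μ μ s - separationProb ν ν s := by
  simp only [separationProb]
  ring

lemma cdf_eq_of_ae_eq {μ ν : Measure ℝ} (h : ∀ᵐ s, cdf μ s = cdf ν s) (s : ℝ) :
    cdf μ s = cdf ν s := by
  have hright (ρ : Measure ℝ) : Tendsto (cdf ρ) (𝓝[>] s) (𝓝 (cdf ρ s)) :=
    ((cdf ρ).right_continuous s).mono Set.Ioi_subset_Ici_self
  have hfreq : ∃ᶠ y in 𝓝[>] s, cdf μ y = cdf ν y :=
    (nhdsGT_basis s).frequently_iff.2 fun _ hu =>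
      (Measure.dense_of_ae h).exists_between hu |>.imp fun _ hy => ⟨hy.2, hy.1⟩
  by_contra hne
  exact hfreq ((((hright μ).sub (hright ν)).eventually_ne (sub_ne_zero.2 hne)).mono
    fun _ => sub_ne_zero.1)

lemma measure_Ioi_eq_one_sub_cdf (μ : Measure ℝ) [IsProbabilityMeasure μ] (s : ℝ) :
    μ (Set.Ioi s) = ENNReal.ofReal (1 - cdf μ s) := by
  rw [← Set.compl_Iic, prob_compl_eq_one_sub measurableSet_Iic, ← ofReal_cdf μ s,
    ENNReal.ofReal_sub _ (cdf_nonneg μ s), ENNReal.ofReal_one]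

variable (μ ν : Measure ℝ) [IsProbabilityMeasure μ] [IsProbabilityMeasure ν]

lemma prod_separatingSet_section (s : ℝ) :
    (μ.prod ν) ((fun p => (p, s)) ⁻¹' separatingSet) =
      ENNReal.ofReal (separationProb μ ν s) := by
  have hsection : (fun p => (p, s)) ⁻¹' separatingSet =
      Set.Iic s ×ˢ Set.Ioi s ∪ Set.Ioi s ×ˢ Set.Iic s := by
    ext p
    simp only [separatingSet, Set.mem_preimage, Set.mem_ofPred_eq, Set.mem_union, Set.mem_prod,
      Set.mem_Iic, Set.mem_Ioi]
    grind
  have hdisj : Disjoint (Set.Iic s ×ˢ Set.Ioi s : Set (ℝ × ℝ)) (Set.Ioi s ×ˢ Set.Iic s) :=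
    Set.disjoint_prod.2 (.inl (Set.Iic_disjoint_Ioi le_rfl))
  have hμ := cdf_nonneg μ s
  have hν := cdf_nonneg ν s
  have hμ' := one_sub_cdf_nonneg μ s
  have hν' := one_sub_cdf_nonneg ν s
  rw [hsection, measure_union hdisj (measurableSet_Ioi.prod measurableSet_Iic), Measure.prod_prod,
    Measure.prod_prod, measure_Ioi_eq_one_sub_cdf, measure_Ioi_eq_one_sub_cdf, ← ofReal_cdf μ,
    ← ofReal_cdf ν, ← ENNReal.ofReal_mul hμ, ← ENNReal.ofReal_mul hμ',
    ← ENNReal.ofReal_add (by positivity) (by positivity), separationProb, mul_comm (1 - cdf μ s)]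

lemma lintegral_norm_sub_eq_lintegral_separationProb :
    ∫⁻ p, ENNReal.ofReal ‖p.1 - p.2‖ ∂(μ.prod ν) =
      ∫⁻ s, ENNReal.ofReal (separationProb μ ν s) := by
  simp_rw [← volume_separatingSet_section, ← prod_separatingSet_section μ ν]
  rw [← Measure.prod_apply measurableSet_separatingSet,
    ← Measure.prod_apply_symm measurableSet_separatingSet]

variable {μ ν}

lemma integrable_separationProb (hμ : Integrable (fun x => x) μ) (hν : Integrable (fun x => x) ν) :
    Integrable (separationProb μ ν) := by
  refine ⟨(measurable_separationProb μ ν).aestronglyMeasurable, ?_⟩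
  rw [hasFiniteIntegral_iff_ofReal (ae_of_all _ (separationProb_nonneg μ ν)),
    ← lintegral_norm_sub_eq_lintegral_separationProb]
  exact (hasFiniteIntegral_iff_ofReal (ae_of_all _ fun _ => norm_nonneg _)).1
    (integrable_norm_sub_prod hμ hν).2

variable (μ ν) in
lemma meanDist_eq_integral_separationProb : meanDist μ ν = ∫ s, separationProb μ ν s := by
  rw [meanDist, integral_eq_lintegral_of_nonneg_ae (ae_of_all _ fun p => norm_nonneg _)
      (by fun_prop),
    integral_eq_lintegral_of_nonneg_ae (ae_of_all _ (separationProb_nonneg μ ν))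
      (measurable_separationProb μ ν).aestronglyMeasurable,
    lintegral_norm_sub_eq_lintegral_separationProb]

lemma integrable_sq_cdf_sub (hμ : Integrable (fun x => x) μ) (hν : Integrable (fun x => x) ν) :
    Integrable fun s => 2 * (cdf μ s - cdf ν s) ^ 2 := by
  simp_rw [two_mul_sq_cdf_sub]
  exact (((integrable_separationProb hμ hν).const_mul 2).sub (integrable_separationProb hμ hμ)).sub
    (integrable_separationProb hν hν)

lemma energyDist_eq_integral_sq_cdf_sub (hμ : Integrable (fun x => x) μ)
    (hν : Integrable (fun x => x) ν) :
    energyDist μ ν = ∫ s, 2 * (cdf μ s - cdf ν s) ^ 2 := by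
  simp_rw [two_mul_sq_cdf_sub]
  rw [integral_two_mul_sub_sub (integrable_separationProb hμ hν) (integrable_separationProb hμ hμ)
    (integrable_separationProb hν hν), energyDist]
  simp_rw [meanDist_eq_integral_separationProb]

lemma energyDist_nonneg_real (hμ : Integrable (fun x => x) μ) (hν : Integrable (fun x => x) ν) :
    0 ≤ energyDist μ ν := by
  rw [energyDist_eq_integral_sq_cdf_sub hμ hν]
  exact integral_nonneg fun s => by positivity

lemma eq_of_energyDist_eq_zero_real (hμ : Integrable (fun x => x) μ)
    (hν : Integrable (fun x => x) ν) (h : energyDist μ ν = 0) : μ = ν := by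
  rw [energyDist_eq_integral_sq_cdf_sub hμ hν, integral_eq_zero_iff_of_nonneg
    (fun s => by positivity) (integrable_sq_cdf_sub hμ hν)] at h
  refine Measure.eq_of_cdf μ ν (StieltjesFunction.ext (cdf_eq_of_ae_eq ?_))
  filter_upwards [h] with s hs
  simpa [sub_eq_zero] using hs

end Line

/-! ### The energy distance on Euclidean spaces -/

section Euclidean

variable {E : Type*} [NormedAddCommGroup E] [InnerProductSpace ℝ E] [FiniteDimensional ℝ E]
  [MeasurableSpace E] [BorelSpace E]

/-- Only the length of `x` matters because a reflection takes `x` to any vector of equal length. -/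
lemma integral_abs_inner_eq_mul_norm {e : E} (he : ‖e‖ = 1) (x : E) :
    ∫ g in Metric.ball (0 : E) 1, |inner ℝ g x| =
      (∫ g in Metric.ball (0 : E) 1, |inner ℝ g e|) * ‖x‖ := by
  set R := (ℝ ∙ (x - ‖x‖ • e))ᗮ.reflection
  have hRx : R x = ‖x‖ • e := Submodule.reflection_sub (by simp [norm_smul, he])
  have hball : R ⁻¹' Metric.ball 0 1 = Metric.ball 0 1 := by
    ext g
    simp
  have hinner (g : E) : |inner ℝ g x| = |inner ℝ (R g) e| * ‖x‖ := by
    rw [← R.inner_map_map, hRx, inner_smul_right, abs_mul, abs_norm, mul_comm]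
  have hchange := R.measurePreserving.setIntegral_preimage_emb
    R.toHomeomorph.measurableEmbedding (fun g => |inner ℝ g e|) (Metric.ball 0 1)
  rw [hball] at hchange
  simp_rw [hinner]
  rw [integral_mul_const, hchange]

variable (E) in
lemma exists_integral_abs_inner :
    ∃ κ : ℝ, 0 ≤ κ ∧ ∀ x : E, ∫ g in Metric.ball (0 : E) 1, |inner ℝ g x| = κ * ‖x‖ := by
  rcases subsingleton_or_nontrivial E with _ | _
  · exact ⟨0, le_rfl, fun x => by simp [Subsingleton.elim x 0]⟩
  · obtain ⟨e, he⟩ := exists_norm_eq E zero_le_one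
    exact ⟨_, integral_nonneg fun _ => abs_nonneg _, integral_abs_inner_eq_mul_norm he⟩

/-- The Cramér–Wold theorem for almost all directions. -/
lemma measure_ext_of_ae_map_inner {F G : Measure E} [IsFiniteMeasure F] [IsFiniteMeasure G]
    (h : ∀ᵐ g ∂(volume.restrict (Metric.ball (0 : E) 1)),
      F.map (inner ℝ g) = G.map (inner ℝ g)) : F = G := by
  have hchar (H : Measure E) [IsFiniteMeasure H] (r : ℝ) (g : E) :
      charFun H (r • g) = charFun (H.map (inner ℝ g)) r := by
    rw [charFun_apply, charFun_apply_real, integral_map (by fun_prop) (by fun_prop)]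
    simp [inner_smul_right, real_inner_comm]
  have hball (r : ℝ) : Set.EqOn (fun g => charFun F (r • g)) (fun g => charFun G (r • g))
      (Metric.ball (0 : E) 1) := by
    refine Measure.eqOn_open_of_ae_eq (μ := volume) ?_ Metric.isOpen_ball (by fun_prop)
      (by fun_prop)
    filter_upwards [h] with g hg
    rw [hchar F, hchar G, hg]
  refine Measure.ext_of_charFun (funext fun t => ?_)
  have hpos : 0 < ‖t‖ + 1 := by positivity
  have hmem : (‖t‖ + 1)⁻¹ • t ∈ Metric.ball (0 : E) 1 := by
    rw [mem_ball_zero_iff, norm_smul, norm_inv, Real.norm_of_nonneg hpos.le, inv_mul_lt_one₀ hpos]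
    exact lt_add_one _
  simpa [smul_smul, hpos.ne'] using hball (‖t‖ + 1) hmem

variable {F G : Measure E}

lemma meanDist_map_inner [SFinite F] [SFinite G] (g : E) :
    meanDist (F.map (inner ℝ g)) (G.map (inner ℝ g)) =
      ∫ p : E × E, |inner ℝ g (p.1 - p.2)| ∂(F.prod G) := by
  rw [meanDist, Measure.map_prod_map F G (by fun_prop) (by fun_prop),
    integral_map (by fun_prop) (by fun_prop)]
  simp [inner_sub_right]

variable [IsFiniteMeasure F] [IsFiniteMeasure G]

lemma integrable_abs_inner_prod (hF : Integrable (fun x => x) F) (hG : Integrable (fun x => x) G) :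
    Integrable (fun q : E × (E × E) => |inner ℝ q.1 (q.2.1 - q.2.2)|)
      ((volume.restrict (Metric.ball (0 : E) 1)).prod (F.prod G)) := by
  have : IsFiniteMeasure (volume.restrict (Metric.ball (0 : E) 1)) :=
    isFiniteMeasure_restrict.2 measure_ball_lt_top.ne
  refine ((integrable_norm_sub_prod hF hG).comp_snd _).mono' (by fun_prop) ?_
  filter_upwards [Measure.quasiMeasurePreserving_fst.ae (ae_restrict_mem measurableSet_ball)]
    with q hq
  rw [Real.norm_eq_abs, abs_abs]
  exact (abs_real_inner_le_norm _ _).trans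
    (mul_le_of_le_one_left (norm_nonneg _) (mem_ball_zero_iff.1 hq).le)

lemma integrableOn_meanDist_map_inner (hF : Integrable (fun x => x) F)
    (hG : Integrable (fun x => x) G) :
    IntegrableOn (fun g : E => meanDist (F.map (inner ℝ g)) (G.map (inner ℝ g)))
      (Metric.ball 0 1) := by
  simp_rw [meanDist_map_inner]
  exact (integrable_abs_inner_prod hF hG).integral_prod_left

lemma integral_meanDist_map_inner {κ : ℝ}
    (hκ : ∀ x : E, ∫ g in Metric.ball (0 : E) 1, |inner ℝ g x| = κ * ‖x‖)
    (hF : Integrable (fun x => x) F) (hG : Integrable (fun x => x) G) :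
    ∫ g in Metric.ball (0 : E) 1, meanDist (F.map (inner ℝ g)) (G.map (inner ℝ g)) =
      κ * meanDist F G := by
  have : IsFiniteMeasure (volume.restrict (Metric.ball (0 : E) 1)) :=
    isFiniteMeasure_restrict.2 measure_ball_lt_top.ne
  simp_rw [meanDist_map_inner]
  rw [integral_integral_swap (integrable_abs_inner_prod hF hG)]
  simp_rw [hκ]
  rw [integral_const_mul, meanDist]

end Euclidean

section EnergyPos

variable {E : Type*} [NormedAddCommGroup E] [InnerProductSpace ℝ E] [FiniteDimensional ℝ E]
  [MeasurableSpace E] [BorelSpace E] {F G : Measure E}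
  [IsProbabilityMeasure F] [IsProbabilityMeasure G]

lemma integrable_id_map_inner {F : Measure E} (hF : Integrable (fun x => x) F) (g : E) :
    Integrable (fun y => y) (F.map (inner ℝ g)) := by
  rw [integrable_map_measure (by fun_prop) (by fun_prop)]
  exact hF.const_inner g

/-- Averaging the one-dimensional energy distances over all directions gives a multiple of the
energy distance, so if that is not positive, almost all projections of `F` and `G` agree. -/
theorem energyDist_pos (hF : Integrable (fun x => x) F) (hG : Integrable (fun x => x) G)
    (hne : F ≠ G) : 0 < energyDist F G := by
  obtain ⟨κ, hκ0, hκ⟩ := exists_integral_abs_inner E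
  have hprob (H : Measure E) [IsProbabilityMeasure H] (g : E) :
      IsProbabilityMeasure (H.map (inner ℝ g)) :=
    Measure.isProbabilityMeasure_map (by fun_prop)
  set e : E → ℝ := fun g => energyDist (F.map (inner ℝ g)) (G.map (inner ℝ g))
  have he0 (g : E) : 0 ≤ e g :=
    energyDist_nonneg_real (integrable_id_map_inner hF g) (integrable_id_map_inner hG g)
  have hei : IntegrableOn e (Metric.ball 0 1) :=
    (((integrableOn_meanDist_map_inner hF hG).const_mul 2).sub
      (integrableOn_meanDist_map_inner hF hF)).sub (integrableOn_meanDist_map_inner hG hG)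
  have hint : ∫ g in Metric.ball (0 : E) 1, e g = κ * energyDist F G := by
    simp only [e, energyDist]
    rw [integral_two_mul_sub_sub (integrableOn_meanDist_map_inner hF hG)
        (integrableOn_meanDist_map_inner hF hF) (integrableOn_meanDist_map_inner hG hG),
      integral_meanDist_map_inner hκ hF hG, integral_meanDist_map_inner hκ hF hF,
      integral_meanDist_map_inner hκ hG hG]
    ring
  by_contra! hle
  have hzero : ∫ g in Metric.ball (0 : E) 1, e g = 0 :=
    le_antisymm (hint.trans_le (mul_nonpos_of_nonneg_of_nonpos hκ0 hle)) (integral_nonneg he0)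
  rw [integral_eq_zero_iff_of_nonneg he0 hei] at hzero
  refine hne (measure_ext_of_ae_map_inner ?_)
  filter_upwards [hzero] with g hg
  exact eq_of_energyDist_eq_zero_real (integrable_id_map_inner hF g)
    (integrable_id_map_inner hG g) hg

end EnergyPos

/-! ### Continuity of the mean distance -/

section LinearGrowth

variable {E : Type*} [NormedAddCommGroup E] [MeasurableSpace E]

/-- Nonnegative measurable functions of at most linear growth, the test functions for the laws of
large numbers below. -/
structure LinearGrowth (f : E → ℝ) : Prop where
  measurable : Measurable f
  nonneg : ∀ x, 0 ≤ f x
  exists_le : ∃ C : ℝ, ∀ x, f x ≤ C * (1 + ‖x‖)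

lemma linearGrowth_one : LinearGrowth (fun _ : E => (1 : ℝ)) where
  measurable := measurable_const
  nonneg _ := zero_le_one
  exists_le := ⟨1, fun x => by linarith [norm_nonneg x]⟩

lemma LinearGrowth.memLp {f : E → ℝ} (hf : LinearGrowth f) {μ : Measure E} [IsFiniteMeasure μ]
    {p : ℝ≥0∞} (h : MemLp (fun x => x) p μ) : MemLp f p μ := by
  obtain ⟨C, hC⟩ := hf.exists_le
  have h1 : MemLp (fun x : E => 1 + ‖x‖) p μ := (memLp_const (1 : ℝ)).add h.norm
  refine (h1.const_mul C).mono hf.measurable.aestronglyMeasurable (ae_of_all _ fun x => ?_)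
  rw [Real.norm_of_nonneg (hf.nonneg x), Real.norm_eq_abs]
  exact (hC x).trans (le_abs_self _)

lemma LinearGrowth.integrable {f : E → ℝ} (hf : LinearGrowth f) {μ : Measure E}
    [IsFiniteMeasure μ] (h : Integrable (fun x => x) μ) : Integrable f μ :=
  memLp_one_iff_integrable.1 (hf.memLp (memLp_one_iff_integrable.2 h))

/-- Convergence of the integrals of all functions of linear growth. The measures need not have
the same mass. -/
def TendstoLinearGrowth {ι : Type*} (μs : ι → Measure E) (l : Filter ι) (μ : Measure E) : Prop :=
  ∀ f : E → ℝ, LinearGrowth f → Tendsto (fun k => ∫ x, f x ∂(μs k)) l (𝓝 (∫ x, f x ∂μ))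

lemma TendstoLinearGrowth.tendsto_measureReal_univ {ι : Type*} {μs : ι → Measure E} {l : Filter ι}
    {μ : Measure E} (h : TendstoLinearGrowth μs l μ) :
    Tendsto (fun k => (μs k).real Set.univ) l (𝓝 (μ.real Set.univ)) := by
  simpa using h _ linearGrowth_one

/-- The indicator function of the fibre of a simple function over `a`. -/
noncomputable def fiberIndicator (ψ : SimpleFunc E E) (a x : E) : ℝ :=
  (ψ ⁻¹' {a}).indicator (fun _ => 1) x

lemma linearGrowth_fiberIndicator (ψ : SimpleFunc E E) (a : E) :
    LinearGrowth (fiberIndicator ψ a) where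
  measurable := measurable_const.indicator (ψ.measurableSet_fiber a)
  nonneg := Set.indicator_nonneg fun _ _ => zero_le_one
  exists_le := ⟨1, fun x => by
    have : fiberIndicator ψ a x ≤ 1 := Set.indicator_le_self' (fun _ _ => zero_le_one) x
    linarith [norm_nonneg x]⟩

lemma norm_simpleFunc_sub (ψ : SimpleFunc E E) (x y : E) :
    ‖ψ x - ψ y‖ = ∑ a ∈ ψ.range, ∑ b ∈ ψ.range,
      ‖a - b‖ * (fiberIndicator ψ a x * fiberIndicator ψ b y) := by
  rw [Finset.sum_eq_single (ψ x), Finset.sum_eq_single (ψ y)]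
  · simp [fiberIndicator]
  · intro b _ hb
    simp [fiberIndicator, hb.symm]
  · exact fun h => absurd (ψ.mem_range_self y) h
  · intro a _ ha
    simp [fiberIndicator, ha.symm]
  · exact fun h => absurd (ψ.mem_range_self x) h

variable [BorelSpace E]

lemma linearGrowth_norm : LinearGrowth (fun x : E => ‖x‖) where
  measurable := measurable_norm
  nonneg := norm_nonneg
  exists_le := ⟨1, fun x => by linarith⟩

variable [SecondCountableTopology E]

lemma linearGrowth_norm_sub_simpleFunc (ψ : SimpleFunc E E) :
    LinearGrowth fun x => ‖x - ψ x‖ where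
  measurable := (measurable_id.sub ψ.measurable).norm
  nonneg _ := norm_nonneg _
  exists_le := by
    obtain ⟨C, hC⟩ : ∃ C, ∀ x, ‖ψ x‖ ≤ C := ψ.exists_forall_norm_le
    refine ⟨1 + C, fun x => ?_⟩
    have hC0 : 0 ≤ C := (norm_nonneg _).trans (hC x)
    nlinarith [norm_sub_le x (ψ x), hC x, mul_nonneg hC0 (norm_nonneg x)]

end LinearGrowth

section MeanDist

variable {E : Type*} [NormedAddCommGroup E] [MeasurableSpace E]

lemma abs_norm_sub_sub_le (ψ : SimpleFunc E E) (x y : E) :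
    |‖x - y‖ - ‖ψ x - ψ y‖| ≤ ‖x - ψ x‖ + ‖y - ψ y‖ :=
  calc |‖x - y‖ - ‖ψ x - ψ y‖| ≤ ‖(x - ψ x) - (y - ψ y)‖ := by
        rw [sub_sub_sub_comm]
        exact abs_norm_sub_norm_le _ _
    _ ≤ ‖x - ψ x‖ + ‖y - ψ y‖ := norm_sub_le _ _

variable {μ ν : Measure E} [IsFiniteMeasure μ] [IsFiniteMeasure ν]

lemma integrable_fiberIndicator_mul_prod (ψ : SimpleFunc E E) (a b : E) :
    Integrable (fun p : E × E => ‖a - b‖ * (fiberIndicator ψ a p.1 * fiberIndicator ψ b p.2))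
      (μ.prod ν) :=
  (Integrable.mul_prod ((integrable_const 1).indicator (ψ.measurableSet_fiber a))
    ((integrable_const 1).indicator (ψ.measurableSet_fiber b))).const_mul _

lemma integrable_norm_simpleFunc_sub_prod (ψ : SimpleFunc E E) :
    Integrable (fun p : E × E => ‖ψ p.1 - ψ p.2‖) (μ.prod ν) := by
  simp_rw [norm_simpleFunc_sub ψ]
  exact integrable_finsetSum _ fun a _ => integrable_finsetSum _ fun b _ =>
    integrable_fiberIndicator_mul_prod ψ a b

lemma integral_norm_simpleFunc_sub_prod (ψ : SimpleFunc E E) :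
    ∫ p : E × E, ‖ψ p.1 - ψ p.2‖ ∂(μ.prod ν) = ∑ a ∈ ψ.range, ∑ b ∈ ψ.range, ‖a - b‖ *
      ((∫ x, fiberIndicator ψ a x ∂μ) * ∫ y, fiberIndicator ψ b y ∂ν) := by
  simp_rw [norm_simpleFunc_sub ψ]
  rw [integral_finsetSum _ fun a _ => integrable_finsetSum _ fun b _ =>
    integrable_fiberIndicator_mul_prod ψ a b]
  refine Finset.sum_congr rfl fun a _ => ?_
  rw [integral_finsetSum _ fun b _ => integrable_fiberIndicator_mul_prod ψ a b]
  refine Finset.sum_congr rfl fun b _ => ?_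
  rw [integral_const_mul, integral_prod_mul]

variable [BorelSpace E] [SecondCountableTopology E]

/-- Bound on the change of `meanDist μ ν` when both measures are discretised by `ψ`. -/
noncomputable def discretizationError (ψ : SimpleFunc E E) (μ ν : Measure E) : ℝ :=
  (∫ x, ‖x - ψ x‖ ∂μ) * ν.real Set.univ + μ.real Set.univ * ∫ x, ‖x - ψ x‖ ∂ν

lemma abs_meanDist_sub_le (ψ : SimpleFunc E E) (hμ : Integrable (fun x => x) μ)
    (hν : Integrable (fun x => x) ν) :
    |meanDist μ ν - ∫ p : E × E, ‖ψ p.1 - ψ p.2‖ ∂(μ.prod ν)| ≤ discretizationError ψ μ ν := by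
  have hg := linearGrowth_norm_sub_simpleFunc ψ
  have hint₁ : Integrable (fun p : E × E => ‖p.1 - ψ p.1‖) (μ.prod ν) :=
    (hg.integrable hμ).comp_fst ν
  have hint₂ : Integrable (fun p : E × E => ‖p.2 - ψ p.2‖) (μ.prod ν) :=
    (hg.integrable hν).comp_snd μ
  have hint := (integrable_norm_sub_prod hμ hν).sub (integrable_norm_simpleFunc_sub_prod ψ)
  rw [meanDist, ← integral_sub (integrable_norm_sub_prod hμ hν)
    (integrable_norm_simpleFunc_sub_prod ψ)]
  calc _ ≤ ∫ p : E × E, |‖p.1 - p.2‖ - ‖ψ p.1 - ψ p.2‖| ∂(μ.prod ν) :=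
        abs_integral_le_integral_abs
    _ ≤ ∫ p : E × E, (‖p.1 - ψ p.1‖ + ‖p.2 - ψ p.2‖) ∂(μ.prod ν) :=
        integral_mono hint.abs (hint₁.add hint₂) fun p => abs_norm_sub_sub_le ψ p.1 p.2
    _ = discretizationError ψ μ ν := by
        rw [integral_add hint₁ hint₂, integral_fun_fst (fun x => ‖x - ψ x‖),
          integral_fun_snd (fun x => ‖x - ψ x‖), discretizationError]
        simp [mul_comm]

lemma exists_discretizationError_lt (hμ : Integrable (fun x => x) μ)
    (hν : Integrable (fun x => x) ν) {η : ℝ} (hη : 0 < η) :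
    ∃ ψ : SimpleFunc E E, discretizationError ψ μ ν < η := by
  set M := μ.real Set.univ + ν.real Set.univ + 1
  have hM : 0 < M := by positivity
  have hε : 0 < η / M := by positivity
  obtain ⟨ψ, hψ, -⟩ := (memLp_one_iff_integrable.2
    (hμ.add_measure hν)).exists_simpleFunc_eLpNorm_sub_lt ENNReal.one_ne_top
    (ε := ENNReal.ofReal (η / M)) (by simpa using hε)
  refine ⟨ψ, ?_⟩
  have hg := linearGrowth_norm_sub_simpleFunc ψ
  have hsmall : ∫ x, ‖x - ψ x‖ ∂μ + ∫ x, ‖x - ψ x‖ ∂ν < η / M := by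
    have hnorm : ∫ x, ‖x - ψ x‖ ∂(μ + ν) = (eLpNorm ((fun x => x) - ⇑ψ) 1 (μ + ν)).toReal := by
      rw [eLpNorm_one_eq_lintegral_enorm]
      exact integral_norm_eq_lintegral_enorm (f := (fun x => x) - ⇑ψ)
        (measurable_id.sub ψ.measurable).aestronglyMeasurable
    rw [← integral_add_measure (hg.integrable hμ) (hg.integrable hν), hnorm]
    exact ENNReal.toReal_lt_of_lt_ofReal hψ
  have hμ0 : 0 ≤ ∫ x, ‖x - ψ x‖ ∂μ := integral_nonneg hg.nonneg
  have hν0 : 0 ≤ ∫ x, ‖x - ψ x‖ ∂ν := integral_nonneg hg.nonneg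
  have hμ1 : 0 ≤ μ.real Set.univ := measureReal_nonneg
  have hν1 : 0 ≤ ν.real Set.univ := measureReal_nonneg
  calc discretizationError ψ μ ν
      ≤ (∫ x, ‖x - ψ x‖ ∂μ + ∫ x, ‖x - ψ x‖ ∂ν) * M := by
        simp only [discretizationError, M]
        nlinarith
    _ < η / M * M := mul_lt_mul_of_pos_right hsmall hM
    _ = η := div_mul_cancel₀ _ hM.ne'

/-- Discretise by a simple function `ψ`: the discretised mean distance is a finite sum of products
of integrals, and the error committed is itself continuous in `μ` and `ν`. -/
theorem TendstoLinearGrowth.meanDist {ι : Type*} {l : Filter ι} {μs νs : ι → Measure E}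
    [∀ k, IsFiniteMeasure (μs k)] [∀ k, IsFiniteMeasure (νs k)]
    (hμs : TendstoLinearGrowth μs l μ) (hνs : TendstoLinearGrowth νs l ν)
    (hμi : ∀ k, Integrable (fun x => x) (μs k)) (hνi : ∀ k, Integrable (fun x => x) (νs k))
    (hμ : Integrable (fun x => x) μ) (hν : Integrable (fun x => x) ν) :
    Tendsto (fun k => meanDist (μs k) (νs k)) l (𝓝 (meanDist μ ν)) := by
  rw [Metric.tendsto_nhds]
  intro η hη
  obtain ⟨ψ, hψ⟩ := exists_discretizationError_lt hμ hν (η := η / 3) (by positivity)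
  have hdiscretized : Tendsto
      (fun k => ∫ p : E × E, ‖ψ p.1 - ψ p.2‖ ∂((μs k).prod (νs k))) l
      (𝓝 (∫ p : E × E, ‖ψ p.1 - ψ p.2‖ ∂(μ.prod ν))) := by
    simp_rw [integral_norm_simpleFunc_sub_prod]
    exact tendsto_finsetSum _ fun a _ => tendsto_finsetSum _ fun b _ =>
      ((hμs _ (linearGrowth_fiberIndicator ψ a)).mul
        (hνs _ (linearGrowth_fiberIndicator ψ b))).const_mul _
  have herror : Tendsto (fun k => discretizationError ψ (μs k) (νs k)) l
      (𝓝 (discretizationError ψ μ ν)) :=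
    ((hμs _ (linearGrowth_norm_sub_simpleFunc ψ)).mul hνs.tendsto_measureReal_univ).add
      (hμs.tendsto_measureReal_univ.mul (hνs _ (linearGrowth_norm_sub_simpleFunc ψ)))
  filter_upwards [herror.eventually (gt_mem_nhds hψ),
    Metric.tendsto_nhds.1 hdiscretized (η / 3) (by positivity)] with k hk₁ hk₂
  have hk := abs_meanDist_sub_le ψ (hμi k) (hνi k)
  have hlim := abs_meanDist_sub_le ψ hμ hν
  rw [Real.dist_eq, abs_lt] at *
  rw [abs_le] at hk hlim
  constructor <;> linarith [hk.1, hk.2, hlim.1, hlim.2, hk₂.1, hk₂.2]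

end MeanDist

section Empirical

variable {E : Type*} [MeasurableSpace E] {n : ℕ}

/-- The observations indexed by `I`, each with mass `1 / n`; the total mass is `#I / n`. -/
noncomputable def empirical (z : Fin n → E) (I : Finset (Fin n)) : Measure E :=
  ENNReal.ofReal (n : ℝ)⁻¹ • ∑ i ∈ I, Measure.dirac (z i)

instance (z : Fin n → E) (I : Finset (Fin n)) : IsFiniteMeasure (empirical z I) :=
  Measure.smul_finite _ ENNReal.ofReal_ne_top

variable [MeasurableSingletonClass E]

lemma integrable_empirical {X : Type*} [NormedAddCommGroup X] (z : Fin n → E)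
    (I : Finset (Fin n)) (f : E → X) : Integrable f (empirical z I) :=
  (integrable_finsetSum_measure.2 fun _ _ => integrable_dirac enorm_lt_top).smul_measure
    ENNReal.ofReal_ne_top

lemma integral_empirical (z : Fin n → E) (I : Finset (Fin n)) (f : E → ℝ) :
    ∫ x, f x ∂(empirical z I) = (n : ℝ)⁻¹ * ∑ i ∈ I, f (z i) := by
  rw [empirical, integral_smul_measure,
    integral_finsetSum_measure fun _ _ => integrable_dirac enorm_lt_top,
    ENNReal.toReal_ofReal (by positivity), smul_eq_mul]
  simp_rw [integral_dirac]

end Empirical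

section MeanDistEmpirical

variable {E : Type*} [NormedAddCommGroup E] [MeasurableSpace E] [BorelSpace E]
  [SecondCountableTopology E] {n : ℕ}

lemma meanDist_empirical (z : Fin n → E) (I J : Finset (Fin n)) :
    meanDist (empirical z I) (empirical z J) =
      (∑ i ∈ I, ∑ j ∈ J, ‖z i - z j‖) / (n : ℝ) ^ 2 := by
  rw [meanDist, integral_prod _ (integrable_norm_sub_prod (integrable_empirical ..)
    (integrable_empirical ..))]
  simp_rw [integral_empirical, ← Finset.mul_sum]
  ring

end MeanDistEmpirical

section Mix

variable {E : Type*} [MeasurableSpace E]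

/-- The linear combination `p F + q G`; negative weights count as `0`. -/
noncomputable def mix (F G : Measure E) (p q : ℝ) : Measure E :=
  ENNReal.ofReal p • F + ENNReal.ofReal q • G

variable {F G : Measure E}

instance [IsFiniteMeasure F] [IsFiniteMeasure G] (p q : ℝ) : IsFiniteMeasure (mix F G p q) :=
  have : IsFiniteMeasure (ENNReal.ofReal p • F) := Measure.smul_finite _ ENNReal.ofReal_ne_top
  have : IsFiniteMeasure (ENNReal.ofReal q • G) := Measure.smul_finite _ ENNReal.ofReal_ne_top
  inferInstanceAs (IsFiniteMeasure (_ + _))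

lemma mix_swap (F G : Measure E) (p q : ℝ) : mix G F q p = mix F G p q :=
  add_comm _ _

lemma integral_mix {f : E → ℝ} (hF : Integrable f F) (hG : Integrable f G) {p q : ℝ}
    (hp : 0 ≤ p) (hq : 0 ≤ q) :
    ∫ x, f x ∂(mix F G p q) = p * ∫ x, f x ∂F + q * ∫ x, f x ∂G := by
  rw [mix, integral_add_measure (hF.smul_measure ENNReal.ofReal_ne_top)
    (hG.smul_measure ENNReal.ofReal_ne_top), integral_smul_measure, integral_smul_measure,
    ENNReal.toReal_ofReal hp, ENNReal.toReal_ofReal hq, smul_eq_mul, smul_eq_mul]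

lemma integrable_mix {X : Type*} [NormedAddCommGroup X] {f : E → X} (hF : Integrable f F)
    (hG : Integrable f G) (p q : ℝ) : Integrable f (mix F G p q) :=
  (hF.smul_measure ENNReal.ofReal_ne_top).add_measure (hG.smul_measure ENNReal.ofReal_ne_top)

end Mix

section MeanDistMix

variable {E : Type*} [NormedAddCommGroup E] [MeasurableSpace E] [SecondCountableTopology E]
  {F G : Measure E} [IsFiniteMeasure F] [IsFiniteMeasure G]

lemma meanDist_mix_right {μ : Measure E} [IsFiniteMeasure μ] (hμ : Integrable (fun x => x) μ)
    (hF : Integrable (fun x => x) F) (hG : Integrable (fun x => x) G) {p q : ℝ} (hp : 0 ≤ p)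
    (hq : 0 ≤ q) : meanDist μ (mix F G p q) = p * meanDist μ F + q * meanDist μ G := by
  have hμF := integrable_norm_sub_prod hμ hF
  have hμG := integrable_norm_sub_prod hμ hG
  have hinner (x : E) : ∫ y, ‖x - y‖ ∂(mix F G p q) =
      p * ∫ y, ‖x - y‖ ∂F + q * ∫ y, ‖x - y‖ ∂G :=
    integral_mix ((integrable_const x).sub hF).norm ((integrable_const x).sub hG).norm hp hq
  rw [meanDist, integral_prod _ (integrable_norm_sub_prod hμ (integrable_mix hF hG p q))]
  simp only [hinner]
  rw [integral_add (hμF.integral_prod_left.const_mul p) (hμG.integral_prod_left.const_mul q),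
    integral_const_mul, integral_const_mul, meanDist, meanDist, integral_prod _ hμF,
    integral_prod _ hμG]

lemma meanDist_mix {p q p' q' : ℝ} (hF : Integrable (fun x => x) F)
    (hG : Integrable (fun x => x) G) (hp : 0 ≤ p) (hq : 0 ≤ q) (hp' : 0 ≤ p') (hq' : 0 ≤ q') :
    meanDist (mix F G p q) (mix F G p' q') =
      p * p' * meanDist F F + (p * q' + q * p') * meanDist F G + q * q' * meanDist G G := by
  rw [meanDist_mix_right (integrable_mix hF hG p q) hF hG hp' hq', meanDist_comm _ F,
    meanDist_comm _ G, meanDist_mix_right hF hF hG hp hq, meanDist_mix_right hG hF hG hp hq,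
    meanDist_comm G F]
  ring

end MeanDistMix

/-! ### The criterion as a function of two empirical measures -/

section WeightedDivergence

/-- The criterion at a split in proportion `γ : 1 - γ`, where `a`, `b` are the sums of the distances
within the parts and `c` is the sum between them, all divided by `n²`. In a sample of size `n` one
has `ε = 1 / n`, because a part does not contain pairs of equal indices; in the limit `ε = 0`. -/
noncomputable def weightedDivergence (γ ε a c b : ℝ) : ℝ :=
  γ * (1 - γ) * ((c / (γ * (1 - γ)) - a / (γ * (γ - ε))) ^ 2 +
    (c / (γ * (1 - γ)) - b / ((1 - γ) * (1 - γ - ε))) ^ 2)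

lemma weightedDivergence_symm (γ ε a c b : ℝ) :
    weightedDivergence (1 - γ) ε b c a = weightedDivergence γ ε a c b := by
  simp only [weightedDivergence, sub_sub_cancel, mul_comm (1 - γ) γ]
  rw [add_comm]

lemma weightedDivergence_nonneg {γ : ℝ} (hγ : γ ∈ Set.Icc (0 : ℝ) 1) (ε a c b : ℝ) :
    0 ≤ weightedDivergence γ ε a c b :=
  mul_nonneg (mul_nonneg hγ.1 (sub_nonneg.2 hγ.2)) (by positivity)

lemma div_mem_Icc_four_mul {γ ε a q : ℝ} (hγ : 0 < γ) (hε : ε ≤ γ / 2) (ha₀ : 0 ≤ a)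
    (ha : a ≤ 2 * γ * q) : a / (γ * (γ - ε)) ∈ Set.Icc 0 (4 * (q / γ)) := by
  have hγε : γ / 2 ≤ γ - ε := by linarith
  have hpos : 0 < γ * (γ - ε) := mul_pos hγ (by linarith)
  refine ⟨div_nonneg ha₀ hpos.le, ?_⟩
  have hq : 0 ≤ q := by
    by_contra! hq
    nlinarith
  rw [div_le_iff₀ hpos]
  calc a ≤ 4 * q * (γ / 2) := by linarith
    _ ≤ 4 * q * (γ - ε) := mul_le_mul_of_nonneg_left hγε (by positivity)
    _ = 4 * (q / γ) * (γ * (γ - ε)) := by field_simp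

lemma weightedDivergence_le {γ ε a c b q r : ℝ} (hγ₀ : 0 < γ) (hγ₁ : γ < 1) (hε₀ : ε ≤ γ / 2)
    (hε₁ : ε ≤ (1 - γ) / 2) (hq : 0 ≤ q) (hr : 0 ≤ r) (ha₀ : 0 ≤ a) (hb₀ : 0 ≤ b) (hc₀ : 0 ≤ c)
    (ha : a ≤ 2 * γ * q) (hb : b ≤ 2 * (1 - γ) * r) (hc : c ≤ (1 - γ) * q + γ * r) :
    weightedDivergence γ ε a c b ≤ 64 * ((1 - γ) * (q ^ 2 / γ) + γ * (r ^ 2 / (1 - γ))) := by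
  have hγ₁' : 0 < 1 - γ := sub_pos.2 hγ₁
  obtain ⟨hA₀, hA⟩ := div_mem_Icc_four_mul hγ₀ hε₀ ha₀ ha
  obtain ⟨hB₀, hB⟩ := div_mem_Icc_four_mul hγ₁' hε₁ hb₀ hb
  have hu : 0 ≤ q / γ := by positivity
  have hv : 0 ≤ r / (1 - γ) := by positivity
  have hC₀ : 0 ≤ c / (γ * (1 - γ)) := by positivity
  have hC : c / (γ * (1 - γ)) ≤ q / γ + r / (1 - γ) := by
    rw [div_le_iff₀ (by positivity)]
    refine hc.trans_eq ?_
    field_simp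
  have hsq {x : ℝ} (hx₀ : 0 ≤ x) (hx : x ≤ 4 * (q / γ + r / (1 - γ))) :
      (c / (γ * (1 - γ)) - x) ^ 2 ≤ (4 * (q / γ + r / (1 - γ))) ^ 2 :=
    sq_le_sq' (by linarith [hu, hv]) (by linarith)
  calc weightedDivergence γ ε a c b
      ≤ γ * (1 - γ) * ((4 * (q / γ + r / (1 - γ))) ^ 2 + (4 * (q / γ + r / (1 - γ))) ^ 2) :=
        mul_le_mul_of_nonneg_left
          (add_le_add (hsq hA₀ (by linarith)) (hsq hB₀ (by linarith))) (by positivity)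
    _ ≤ γ * (1 - γ) * (64 * ((q / γ) ^ 2 + (r / (1 - γ)) ^ 2)) := by
        gcongr
        nlinarith [sq_nonneg (q / γ - r / (1 - γ))]
    _ = 64 * ((1 - γ) * (q ^ 2 / γ) + γ * (r ^ 2 / (1 - γ))) := by field_simp

lemma tendsto_weightedDivergence {ι : Type*} {l : Filter ι} {γs εs as cs bs : ι → ℝ}
    {γ a c b : ℝ} (hγ₀ : γ ≠ 0) (hγ₁ : γ ≠ 1) (hγ : Tendsto γs l (𝓝 γ))
    (hε : Tendsto εs l (𝓝 0)) (ha : Tendsto as l (𝓝 a)) (hc : Tendsto cs l (𝓝 c))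
    (hb : Tendsto bs l (𝓝 b)) :
    Tendsto (fun k => weightedDivergence (γs k) (εs k) (as k) (cs k) (bs k)) l
      (𝓝 (weightedDivergence γ 0 a c b)) := by
  have hγ₁' : 1 - γ ≠ 0 := sub_ne_zero.2 hγ₁.symm
  have hrev := hγ.const_sub 1
  have hmul := hγ.mul hrev
  have hC := hc.div hmul (mul_ne_zero hγ₀ hγ₁')
  have hA := ha.div (hγ.mul (hγ.sub hε)) (by simpa)
  have hB := hb.div (hrev.mul (hrev.sub hε)) (by simpa)
  exact hmul.mul (((hC.sub hA).pow 2).add ((hC.sub hB).pow 2))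

end WeightedDivergence

section Split

variable {n : ℕ}

/-- The indices of the first `t` observations. -/
def firstSet (n t : ℕ) : Finset (Fin n) := {i | (i : ℕ) < t}

/-- The indices of the observations after the first `t`. -/
def lastSet (n t : ℕ) : Finset (Fin n) := {i | t ≤ (i : ℕ)}

lemma mem_firstSet {t : ℕ} {i : Fin n} : i ∈ firstSet n t ↔ (i : ℕ) < t := by simp [firstSet]

lemma mem_lastSet {t : ℕ} {i : Fin n} : i ∈ lastSet n t ↔ t ≤ (i : ℕ) := by simp [lastSet]

lemma card_firstSet {t : ℕ} (ht : t ≤ n) : (firstSet n t).card = t := by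
  rw [firstSet, Fin.card_filter_val_lt, min_eq_right ht]

lemma sum_firstSet_add_sum_lastSet (t : ℕ) (g : Fin n → ℝ) :
    ∑ i ∈ firstSet n t, g i + ∑ i ∈ lastSet n t, g i = ∑ i, g i := by
  rw [← Finset.sum_filter_add_sum_filter_not Finset.univ (fun i : Fin n => (i : ℕ) < t)]
  simp only [firstSet, lastSet, not_lt]

lemma sum_firstSet_mono {s t : ℕ} (h : s ≤ t) {g : Fin n → ℝ} (hg : ∀ i, 0 ≤ g i) :
    ∑ i ∈ firstSet n s, g i ≤ ∑ i ∈ firstSet n t, g i :=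
  Finset.sum_le_sum_of_subset_of_nonneg (fun i => by simpa only [mem_firstSet] using h.trans_lt')
    fun i _ _ => hg i

lemma sum_firstSet_rev {M : Type*} [AddCommMonoid M] {t : ℕ} (ht : t ≤ n) (g : Fin n → M) :
    ∑ i ∈ firstSet n (n - t), g i.rev = ∑ i ∈ lastSet n t, g i := by
  refine Finset.sum_equiv Fin.revPerm (fun i => ?_) fun _ _ => rfl
  simp only [mem_firstSet, mem_lastSet, Fin.revPerm_apply, Fin.val_rev]
  omega

lemma sum_firstSet_eq_add_rev_sub {t r : ℕ} (ht : t ≤ n) (hr : r ≤ n) (g : Fin n → ℝ) :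
    ∑ i ∈ firstSet n t, g i = ∑ i ∈ firstSet n (min t r), g i +
      (∑ i ∈ firstSet n (n - r), g i.rev - ∑ i ∈ firstSet n (n - max t r), g i.rev) := by
  rw [sum_firstSet_rev hr, sum_firstSet_rev (max_le ht hr)]
  have hr := sum_firstSet_add_sum_lastSet r g
  have ht := sum_firstSet_add_sum_lastSet t g
  rcases le_total t r with h | h
  · rw [min_eq_left h, max_eq_right h]
    ring
  · rw [min_eq_right h, max_eq_left h]
    linarith

variable {E : Type*} [MeasurableSpace E]

/-- The first `t` observations, each with mass `1 / n`. -/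
noncomputable def frontLaw (z : Fin n → E) (t : ℕ) : Measure E := empirical z (firstSet n t)

/-- The observations after the first `t`, each with mass `1 / n`. -/
noncomputable def backLaw (z : Fin n → E) (t : ℕ) : Measure E := empirical z (lastSet n t)

instance (z : Fin n → E) (t : ℕ) : IsFiniteMeasure (frontLaw z t) :=
  inferInstanceAs (IsFiniteMeasure (empirical z _))

instance (z : Fin n → E) (t : ℕ) : IsFiniteMeasure (backLaw z t) :=
  inferInstanceAs (IsFiniteMeasure (empirical z _))

lemma frontLaw_rev (z : Fin n → E) {t : ℕ} (ht : t ≤ n) :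
    frontLaw (fun i => z i.rev) (n - t) = backLaw z t := by
  rw [frontLaw, backLaw, empirical, empirical, sum_firstSet_rev ht fun i => Measure.dirac (z i)]

lemma backLaw_rev (z : Fin n → E) {t : ℕ} (ht : t ≤ n) :
    backLaw (fun i => z i.rev) (n - t) = frontLaw z t := by
  simpa [Nat.sub_sub_self ht] using (frontLaw_rev (fun i => z i.rev) (Nat.sub_le n t)).symm

variable [MeasurableSingletonClass E]

lemma measureReal_frontLaw_univ (z : Fin n → E) {t : ℕ} (ht : t ≤ n) :
    (frontLaw z t).real Set.univ = t / n := by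
  have h := integral_empirical z (firstSet n t) fun _ => (1 : ℝ)
  simp only [integral_const, smul_eq_mul, mul_one, Finset.sum_const, card_firstSet ht,
    nsmul_eq_mul] at h
  rw [frontLaw, h, div_eq_inv_mul]

lemma measureReal_backLaw_univ (z : Fin n → E) {t : ℕ} (ht : t ≤ n) (hn : n ≠ 0) :
    (backLaw z t).real Set.univ = 1 - t / n := by
  rw [← frontLaw_rev z ht, measureReal_frontLaw_univ _ (Nat.sub_le n t), Nat.cast_sub ht, sub_div,
    div_self (Nat.cast_ne_zero.2 hn)]

end Split

section MeanDistLe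

variable {E : Type*} [NormedAddCommGroup E] [MeasurableSpace E]

lemma meanDist_nonneg (μ ν : Measure E) : 0 ≤ meanDist μ ν := integral_nonneg fun _ => norm_nonneg _

variable [SecondCountableTopology E] {μ ν : Measure E} [IsFiniteMeasure μ] [IsFiniteMeasure ν]

lemma meanDist_le (hμ : Integrable (fun x => x) μ) (hν : Integrable (fun x => x) ν) :
    meanDist μ ν ≤ ν.real Set.univ * ∫ x, ‖x‖ ∂μ + μ.real Set.univ * ∫ x, ‖x‖ ∂ν := by
  have h₁ : Integrable (fun p : E × E => ‖p.1‖) (μ.prod ν) := hμ.norm.comp_fst ν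
  have h₂ : Integrable (fun p : E × E => ‖p.2‖) (μ.prod ν) := hν.norm.comp_snd μ
  calc meanDist μ ν ≤ ∫ p : E × E, (‖p.1‖ + ‖p.2‖) ∂(μ.prod ν) :=
        integral_mono (integrable_norm_sub_prod hμ hν) (h₁.add h₂) fun p => norm_sub_le p.1 p.2
    _ = _ := by
        rw [integral_add h₁ h₂, integral_fun_fst (fun x => ‖x‖), integral_fun_snd (fun x => ‖x‖),
          smul_eq_mul, smul_eq_mul]

end MeanDistLe

section Criterion

variable {d n : ℕ}

lemma sum_lt_pairs_eq_half {E : Type*} [SeminormedAddCommGroup E] (z : Fin n → E)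
    (S : Finset (Fin n)) :
    ∑ p : Fin n × Fin n with p.1 < p.2 ∧ p.1 ∈ S ∧ p.2 ∈ S, ‖z p.1 - z p.2‖ =
      (∑ i ∈ S, ∑ j ∈ S, ‖z i - z j‖) / 2 := by
  set up := (S ×ˢ S).filter fun p => p.1 < p.2
  set down := (S ×ˢ S).filter fun p => ¬ p.1 < p.2
  have hup : ({p : Fin n × Fin n | p.1 < p.2 ∧ p.1 ∈ S ∧ p.2 ∈ S} : Finset _) = up := by
    ext p
    simp only [up, Finset.mem_filter, Finset.mem_univ, Finset.mem_product]
    tauto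
  have hdown : ∑ p ∈ down, ‖z p.1 - z p.2‖ = ∑ p ∈ up, ‖z p.1 - z p.2‖ := by
    have hsub : up.map (Equiv.prodComm _ _).toEmbedding ⊆ down := by
      intro p hp
      simp only [up, down, Finset.mem_map_equiv, Finset.mem_filter, Finset.mem_product] at hp ⊢
      exact ⟨hp.1.symm, hp.2.asymm⟩
    rw [← Finset.sum_subset hsub, Finset.sum_map]
    · simp [norm_sub_rev]
    · intro p hp hp'
      simp only [up, down, Finset.mem_map_equiv, Finset.mem_filter, Finset.mem_product] at hp hp'
      have heq : p.1 = p.2 :=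
        le_antisymm (not_lt.1 fun h => hp' ⟨hp.1.symm, h⟩) (not_lt.1 hp.2)
      simp [heq]
  rw [hup, ← Finset.sum_product' S S fun i j => ‖z i - z j‖,
    ← Finset.sum_filter_add_sum_filter_not (S ×ˢ S) (fun p => p.1 < p.2), hdown]
  ring

lemma T11_eq (z : Fin n → Vec d) (t : ℕ) :
    T11 z t = (∑ i ∈ firstSet n t, ∑ j ∈ firstSet n t, ‖z i - z j‖) / (t * (t - 1)) := by
  have h (p : Fin n × Fin n) : p.1 < p.2 ∧ (p.2 : ℕ) < t ↔
      p.1 < p.2 ∧ p.1 ∈ firstSet n t ∧ p.2 ∈ firstSet n t := by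
    simp only [mem_firstSet, Fin.lt_def]
    omega
  rw [T11, Finset.filter_congr fun p _ => h p, sum_lt_pairs_eq_half, Nat.cast_choose_two, inv_div,
    div_mul_div_comm, mul_comm (2 : ℝ), mul_div_mul_right _ _ two_ne_zero]

lemma T22_eq (z : Fin n → Vec d) {t : ℕ} (ht : t ≤ n) :
    T22 z t = (∑ i ∈ lastSet n t, ∑ j ∈ lastSet n t, ‖z i - z j‖) /
      (((n : ℝ) - t) * (n - t - 1)) := by
  have h (p : Fin n × Fin n) : p.1 < p.2 ∧ t ≤ (p.1 : ℕ) ↔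
      p.1 < p.2 ∧ p.1 ∈ lastSet n t ∧ p.2 ∈ lastSet n t := by
    simp only [mem_lastSet, Fin.lt_def]
    omega
  rw [T22, Finset.filter_congr fun p _ => h p, sum_lt_pairs_eq_half, Nat.cast_choose_two,
    Nat.cast_sub ht, inv_div, div_mul_div_comm, mul_comm (2 : ℝ), mul_div_mul_right _ _ two_ne_zero]

lemma T12_eq (z : Fin n → Vec d) (t : ℕ) :
    T12 z t = (∑ i ∈ firstSet n t, ∑ j ∈ lastSet n t, ‖z i - z j‖) / (t * ((n : ℝ) - t)) := by
  have h : ({p : Fin n × Fin n | (p.1 : ℕ) < t ∧ t ≤ (p.2 : ℕ)} : Finset _) =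
      firstSet n t ×ˢ lastSet n t := by
    ext p
    simp only [Finset.mem_filter_univ, Finset.mem_product, mem_firstSet, mem_lastSet]
  rw [T12, h, Finset.sum_product, div_eq_inv_mul]

lemma criterion_eq (z : Fin n → Vec d) {t : ℕ} (ht : t ≤ n) :
    criterion z t = weightedDivergence (t / n) (n : ℝ)⁻¹ (meanDist (frontLaw z t) (frontLaw z t))
      (meanDist (frontLaw z t) (backLaw z t)) (meanDist (backLaw z t) (backLaw z t)) := by
  rcases eq_or_ne n 0 with rfl | hn
  · simp [criterion, weightedDivergence]
  have hn' : (n : ℝ) ≠ 0 := Nat.cast_ne_zero.2 hn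
  have hn2 : (n : ℝ) ^ 2 ≠ 0 := pow_ne_zero 2 hn'
  have h₁ : (t : ℝ) / n * (1 - t / n) = t * (n - t) / (n : ℝ) ^ 2 := by field_simp
  have h₂ : (t : ℝ) / n * (t / n - (n : ℝ)⁻¹) = t * (t - 1) / (n : ℝ) ^ 2 := by field_simp
  have h₃ : (1 - (t : ℝ) / n) * (1 - t / n - (n : ℝ)⁻¹) =
      (n - t) * (n - t - 1) / (n : ℝ) ^ 2 := by field_simp
  simp only [weightedDivergence, frontLaw, backLaw, meanDist_empirical]
  rw [h₁, h₂, h₃, div_div_div_cancel_right₀ hn2, div_div_div_cancel_right₀ hn2,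
    div_div_div_cancel_right₀ hn2, criterion, divergence, T11_eq, T12_eq, T22_eq z ht]

lemma div_mem_Icc_zero_one {t : ℕ} (ht : t ≤ n) : (t : ℝ) / n ∈ Set.Icc (0 : ℝ) 1 :=
  ⟨by positivity, div_le_one_of_le₀ (Nat.cast_le.2 ht) (Nat.cast_nonneg n)⟩

lemma criterion_nonneg (z : Fin n → Vec d) {t : ℕ} (ht : t ≤ n) : 0 ≤ criterion z t := by
  rw [criterion_eq z ht]
  exact weightedDivergence_nonneg (div_mem_Icc_zero_one ht) ..

lemma criterion_rev (z : Fin n → Vec d) {t : ℕ} (ht : t ≤ n) :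
    criterion (fun i => z i.rev) (n - t) = criterion z t := by
  rcases eq_or_ne n 0 with rfl | hn
  · simp [criterion]
  rw [criterion_eq _ (Nat.sub_le n t), criterion_eq z ht, frontLaw_rev z ht, backLaw_rev z ht,
    Nat.cast_sub ht, sub_div, div_self (Nat.cast_ne_zero.2 hn), weightedDivergence_symm,
    meanDist_comm (backLaw z t)]

lemma criterion_le (z : Fin n → Vec d) {t : ℕ} (ht : 2 ≤ t) (htn : t + 2 ≤ n) :
    criterion z t ≤ 64 * ((1 - t / n) * ((∫ x, ‖x‖ ∂(frontLaw z t)) ^ 2 / (t / n)) +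
      t / n * ((∫ x, ‖x‖ ∂(backLaw z t)) ^ 2 / (1 - t / n))) := by
  have htn' : t ≤ n := by omega
  have hn : (0 : ℝ) < n := Nat.cast_pos.2 (by omega)
  have ht' : (2 : ℝ) ≤ t := by exact_mod_cast ht
  have htn'' : (t : ℝ) + 2 ≤ n := by exact_mod_cast htn
  have hfront := measureReal_frontLaw_univ z htn'
  have hback := measureReal_backLaw_univ z htn' (by omega)
  have hμ : Integrable (fun x => x) (frontLaw z t) := integrable_empirical ..
  have hν : Integrable (fun x => x) (backLaw z t) := integrable_empirical ..
  have ha := meanDist_le hμ hμ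
  have hb := meanDist_le hν hν
  have hc := meanDist_le hμ hν
  rw [hfront] at ha
  rw [hback] at hb
  rw [hfront, hback] at hc
  rw [criterion_eq z htn']
  refine weightedDivergence_le (by positivity) ((div_lt_one hn).2 (by linarith)) ?_ ?_
    (integral_nonneg fun _ => norm_nonneg _) (integral_nonneg fun _ => norm_nonneg _)
    (meanDist_nonneg _ _) (meanDist_nonneg _ _) (meanDist_nonneg _ _) (by linarith) (by linarith) hc
  · field_simp
    exact ht'
  · field_simp
    linarith

end Criterion

section Profile

variable {E : Type*} [NormedAddCommGroup E] [MeasurableSpace E]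

/-- The limit of `frontLaw` at splits with `t / n → γ`, when the law of the observations changes
from `F` to `G` at `θ`. -/
noncomputable def frontMix (F G : Measure E) (θ γ : ℝ) : Measure E :=
  mix F G (min γ θ) (max γ θ - θ)

instance (F G : Measure E) [IsFiniteMeasure F] [IsFiniteMeasure G] (θ γ : ℝ) :
    IsFiniteMeasure (frontMix F G θ γ) :=
  inferInstanceAs (IsFiniteMeasure (mix F G _ _))

/-- The limit of the criterion at splits with `t / n → γ`, when the law of the observations changes
from `F` to `G` at `θ`. The part behind the split is described by reading the sample backwards. -/
noncomputable def profile (F G : Measure E) (θ γ : ℝ) : ℝ :=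
  let μ := frontMix F G θ γ
  let ν := frontMix G F (1 - θ) (1 - γ)
  weightedDivergence γ 0 (meanDist μ μ) (meanDist μ ν) (meanDist ν ν)

/-- The limit of the divergence between a sample from `F` and a sample from `G`. -/
noncomputable def limitDivergence (F G : Measure E) : ℝ :=
  (meanDist F G - meanDist F F) ^ 2 + (meanDist F G - meanDist G G) ^ 2

lemma limitDivergence_nonneg (F G : Measure E) : 0 ≤ limitDivergence F G := by
  unfold limitDivergence
  positivity

lemma limitDivergence_self (F : Measure E) : limitDivergence F F = 0 := by
  simp [limitDivergence]

variable {F G : Measure E} {θ γ : ℝ}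

lemma integrable_frontMix (hF : Integrable (fun x => x) F) (hG : Integrable (fun x => x) G)
    (θ γ : ℝ) : Integrable (fun x => x) (frontMix F G θ γ) :=
  integrable_mix hF hG _ _

lemma profile_zero (F G : Measure E) (θ : ℝ) : profile F G θ 0 = 0 := by
  simp only [profile, weightedDivergence, zero_mul]

lemma profile_nonneg (F G : Measure E) (θ : ℝ) (hγ : γ ∈ Set.Icc (0 : ℝ) 1) :
    0 ≤ profile F G θ γ :=
  weightedDivergence_nonneg hγ ..

variable [IsFiniteMeasure F] [IsFiniteMeasure G]

lemma limitDivergence_comm (F G : Measure E) [IsFiniteMeasure F] [IsFiniteMeasure G] :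
    limitDivergence G F = limitDivergence F G := by
  rw [limitDivergence, limitDivergence, meanDist_comm G F, add_comm]

lemma profile_symm (F G : Measure E) [IsFiniteMeasure F] [IsFiniteMeasure G] (θ γ : ℝ) :
    profile G F (1 - θ) (1 - γ) = profile F G θ γ := by
  simp only [profile, sub_sub_cancel, weightedDivergence_symm]
  rw [meanDist_comm (frontMix G F (1 - θ) (1 - γ))]

variable [SecondCountableTopology E]

lemma profile_eq_of_le (hF : Integrable (fun x => x) F) (hG : Integrable (fun x => x) G)
    (hγ₀ : 0 ≤ γ) (hγθ : γ ≤ θ) (hθ : θ < 1) :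
    profile F G θ γ = γ * (1 - γ) * ((1 - θ) / (1 - γ)) ^ 2 *
      ((meanDist F G - meanDist F F) ^ 2 +
        ((1 - θ) / (1 - γ) * (meanDist F G - meanDist G G) -
          (1 - (1 - θ) / (1 - γ)) * (meanDist F G - meanDist F F)) ^ 2) := by
  rcases hγ₀.eq_or_lt with rfl | hγ₀
  · simp [profile, weightedDivergence]
  have hγ₁ : 0 < 1 - γ := by linarith
  have hθγ : 0 ≤ θ - γ := by linarith
  have hθ' : 0 ≤ 1 - θ := by linarith
  set w := (1 - θ) / (1 - γ) with hw
  have h₁ : 1 - θ = w * (1 - γ) := by rw [hw, div_mul_cancel₀ _ hγ₁.ne']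
  have h₂ : θ - γ = (1 - w) * (1 - γ) := by linear_combination -h₁
  have hfront : frontMix F G θ γ = mix F G γ 0 := by
    rw [frontMix, min_eq_left hγθ, max_eq_right hγθ, sub_self]
  have hback : frontMix G F (1 - θ) (1 - γ) = mix F G (θ - γ) (1 - θ) := by
    rw [frontMix, min_eq_right (by linarith), max_eq_left (by linarith), sub_sub_sub_cancel_left,
      mix_swap]
  rw [profile, hfront, hback, meanDist_mix hF hG hγ₀.le le_rfl hγ₀.le le_rfl,
    meanDist_mix hF hG hγ₀.le le_rfl hθγ hθ', meanDist_mix hF hG hθγ hθ' hθγ hθ',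
    weightedDivergence, h₁, h₂]
  generalize meanDist F F = a, meanDist F G = c, meanDist G G = b
  simp only [sub_zero, mul_zero, zero_mul, add_zero]
  field_simp
  ring

lemma profile_self_eq (hF : Integrable (fun x => x) F) (hG : Integrable (fun x => x) G)
    (hθ₀ : 0 ≤ θ) (hθ₁ : θ < 1) : profile F G θ θ = θ * (1 - θ) * limitDivergence F G := by
  rw [profile_eq_of_le hF hG hθ₀ le_rfl hθ₁, div_self (by linarith), limitDivergence]
  ring

lemma mul_sq_add_sq_le {w : ℝ} (hw₀ : 0 ≤ w) (hw₁ : w ≤ 1) (u v : ℝ) :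
    w * (u ^ 2 + (w * v - (1 - w) * u) ^ 2) ≤ u ^ 2 + v ^ 2 := by
  have hconvex : (w * v - (1 - w) * u) ^ 2 ≤ w * v ^ 2 + (1 - w) * u ^ 2 := by
    have : 0 ≤ w * (1 - w) * (u + v) ^ 2 :=
      mul_nonneg (mul_nonneg hw₀ (by linarith)) (sq_nonneg _)
    nlinarith
  calc w * (u ^ 2 + (w * v - (1 - w) * u) ^ 2)
      ≤ w * (u ^ 2 + (w * v ^ 2 + (1 - w) * u ^ 2)) := by gcongr
    _ ≤ u ^ 2 + v ^ 2 := by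
        nlinarith [mul_nonneg (sq_nonneg (1 - w)) (sq_nonneg u),
          mul_nonneg (mul_nonneg (sub_nonneg.2 hw₁) (by linarith : 0 ≤ 1 + w)) (sq_nonneg v)]

lemma profile_le_of_le (hF : Integrable (fun x => x) F) (hG : Integrable (fun x => x) G)
    (hγ₀ : 0 ≤ γ) (hγθ : γ ≤ θ) (hθ : θ < 1) :
    profile F G θ γ ≤ γ * (1 - θ) * limitDivergence F G := by
  have hγ₁ : 0 < 1 - γ := by linarith
  have hθ' : 0 ≤ 1 - θ := by linarith
  have hw : (1 - θ) / (1 - γ) ≤ 1 := (div_le_one hγ₁).2 (by linarith)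
  have hbound := mul_sq_add_sq_le (div_nonneg hθ' hγ₁.le) hw (meanDist F G - meanDist F F)
    (meanDist F G - meanDist G G)
  rw [profile_eq_of_le hF hG hγ₀ hγθ hθ, limitDivergence]
  refine le_of_eq_of_le ?_ (mul_le_mul_of_nonneg_left hbound (mul_nonneg hγ₀ hθ'))
  field_simp

lemma profile_same (hF : Integrable (fun x => x) F) (hθ₀ : 0 < θ) (hθ₁ : θ < 1)
    (hγ : γ ∈ Set.Icc (0 : ℝ) 1) : profile F F θ γ = 0 := by
  refine le_antisymm ?_ (profile_nonneg F F θ hγ)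
  rcases le_total γ θ with h | h
  · simpa only [limitDivergence_self, mul_zero] using profile_le_of_le hF hF hγ.1 h hθ₁
  · rw [← profile_symm]
    simpa only [limitDivergence_self, mul_zero] using
      profile_le_of_le hF hF (sub_nonneg.2 hγ.2) (sub_le_sub_left h 1) (sub_lt_self 1 hθ₀)

lemma profile_lt_profile_self (hF : Integrable (fun x => x) F) (hG : Integrable (fun x => x) G)
    (hD : 0 < limitDivergence F G) (hθ₀ : 0 < θ) (hθ₁ : θ < 1) (hγ : γ ∈ Set.Icc (0 : ℝ) 1)
    (hne : γ ≠ θ) : profile F G θ γ < profile F G θ θ := by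
  rw [profile_self_eq hF hG hθ₀.le hθ₁]
  rcases hne.lt_or_gt with h | h
  · refine (profile_le_of_le hF hG hγ.1 h.le hθ₁).trans_lt ?_
    gcongr
  · rw [← profile_symm, ← limitDivergence_comm]
    rw [← limitDivergence_comm] at hD
    have := profile_le_of_le hG hF (sub_nonneg.2 hγ.2) (sub_le_sub_left h.le 1)
      (sub_lt_self 1 hθ₀)
    refine this.trans_lt ?_
    rw [sub_sub_cancel, mul_comm θ]
    gcongr

end Profile

lemma limitDivergence_pos {E : Type*} [NormedAddCommGroup E] [InnerProductSpace ℝ E]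
    [FiniteDimensional ℝ E] [MeasurableSpace E] [BorelSpace E] {F G : Measure E}
    [IsProbabilityMeasure F] [IsProbabilityMeasure G] (hF : Integrable (fun x => x) F)
    (hG : Integrable (fun x => x) G) (hne : F ≠ G) : 0 < limitDivergence F G := by
  have henergy := energyDist_pos hF hG hne
  refine (limitDivergence_nonneg F G).lt_of_ne fun h => ?_
  obtain ⟨hFF, hGG⟩ := (add_eq_zero_iff_of_nonneg (sq_nonneg _) (sq_nonneg _)).1 h.symm
  rw [energyDist] at henergy
  linarith [pow_eq_zero_iff two_ne_zero |>.1 hFF, pow_eq_zero_iff two_ne_zero |>.1 hGG]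

/-! ### Localisation of the maximiser -/

section FrontLimit

variable {ι E : Type*} {l : Filter ι} {N τ : ι → ℕ} {z : (k : ι) → Fin (N k) → E} {f : E → ℝ}
  {c : ℝ}

/-- The law of large numbers for `f` over the initial segments of the samples `z k` of size `N k`,
uniformly over the segments of length at most `τ k`. -/
def FrontLimit (l : Filter ι) (N τ : ι → ℕ) (z : (k : ι) → Fin (N k) → E) (f : E → ℝ) (c : ℝ) :
    Prop :=
  ∀ ε > 0, ∀ᶠ k in l, ∀ t ≤ τ k, |∑ i ∈ firstSet (N k) t, (f (z k i) - c)| ≤ ε * N k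

lemma FrontLimit.tendsto_sub (h : FrontLimit l N τ z f c) {s : ι → ℕ} (hs : ∀ᶠ k in l, s k ≤ τ k) :
    Tendsto (fun k => (N k : ℝ)⁻¹ * ∑ i ∈ firstSet (N k) (s k), (f (z k i) - c)) l (𝓝 0) := by
  rw [Metric.tendsto_nhds]
  intro ε hε
  filter_upwards [h (ε / 2) (half_pos hε), hs] with k hk hsk
  rw [dist_zero_right, Real.norm_eq_abs, abs_mul, abs_of_nonneg (by positivity)]
  calc (N k : ℝ)⁻¹ * |∑ i ∈ firstSet (N k) (s k), (f (z k i) - c)|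
      ≤ (N k : ℝ)⁻¹ * (ε / 2 * N k) := by
        gcongr
        exact hk _ hsk
    _ = ε / 2 * ((N k : ℝ)⁻¹ * N k) := by ring
    _ ≤ ε / 2 * 1 := by
        gcongr
        exact inv_mul_le_one
    _ < ε := by linarith

lemma sum_firstSet_sub_const {n s : ℕ} (hs : s ≤ n) (z : Fin n → E) (f : E → ℝ) (c : ℝ) :
    ∑ i ∈ firstSet n s, (f (z i) - c) = ∑ i ∈ firstSet n s, f (z i) - s * c := by
  rw [Finset.sum_sub_distrib, Finset.sum_const, card_firstSet hs, nsmul_eq_mul]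

lemma FrontLimit.tendsto (h : FrontLimit l N τ z f c) {s : ι → ℕ} {σ : ℝ}
    (hsN : ∀ᶠ k in l, s k ≤ N k) (hs : ∀ᶠ k in l, s k ≤ τ k)
    (hσ : Tendsto (fun k => (s k : ℝ) / N k) l (𝓝 σ)) :
    Tendsto (fun k => (N k : ℝ)⁻¹ * ∑ i ∈ firstSet (N k) (s k), f (z k i)) l (𝓝 (σ * c)) := by
  have hsum := (h.tendsto_sub hs).add (hσ.mul_const c)
  rw [zero_add] at hsum
  refine hsum.congr' ?_
  filter_upwards [hsN] with k hk
  rw [sum_firstSet_sub_const hk]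
  ring

/-- Splits at which sums are compared: between two neighbouring ones there are about `N / K`
observations. -/
def gridPoint (N τ K j : ℕ) : ℕ := min (j * N / K) τ

lemma exists_gridPoint_le {n r K t : ℕ} (hK : 0 < K) (hn : 0 < n) (ht : t ≤ r) (hr : r ≤ n) :
    ∃ j ≤ K, gridPoint n r K j ≤ t ∧ t ≤ gridPoint n r K (j + 1) ∧
      (gridPoint n r K (j + 1) : ℝ) ≤ gridPoint n r K j + (n / K + 1) := by
  refine ⟨t * K / n, Nat.div_le_of_le_mul (by gcongr; omega), (min_le_left _ _).trans ?_,
    le_min ((Nat.le_div_iff_mul_le hK).2 ?_) ht, ?_⟩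
  · exact Nat.div_le_of_le_mul ((Nat.div_mul_le_self _ _).trans_eq (mul_comm _ _))
  · exact (Nat.lt_mul_div_succ _ hn).le.trans_eq (mul_comm _ _)
  · generalize t * K / n = j
    have hstep : (((j + 1) * n / K : ℕ) : ℝ) ≤ (j * n / K : ℕ) + (n / K + 1) := by
      have hupper : (((j + 1) * n / K : ℕ) : ℝ) ≤ (j * n : ℕ) / K + n / K := by
        refine Nat.cast_div_le.trans_eq ?_
        push_cast
        ring
      have hlower := Nat.lt_floor_add_one ((j * n : ℕ) / (K : ℝ))
      rw [Nat.floor_div_eq_div] at hlower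
      linarith
    rw [gridPoint, gridPoint, Nat.cast_min, Nat.cast_min, ← min_add_add_right]
    exact min_le_min hstep (le_add_of_nonneg_right (by positivity))

lemma abs_sum_firstSet_sub_le {n a t b : ℕ} {z : Fin n → E} (hf : ∀ x, 0 ≤ f x) (hat : a ≤ t)
    (htb : t ≤ b) (hb : b ≤ n) {D M : ℝ} (hD : (b : ℝ) ≤ a + D)
    (ha' : |∑ i ∈ firstSet n a, (f (z i) - c)| ≤ M)
    (hb' : |∑ i ∈ firstSet n b, (f (z i) - c)| ≤ M) :
    |∑ i ∈ firstSet n t, (f (z i) - c)| ≤ M + D * |c| := by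
  have hmono {s t : ℕ} (h : s ≤ t) : ∑ i ∈ firstSet n s, f (z i) ≤ ∑ i ∈ firstSet n t, f (z i) :=
    sum_firstSet_mono h fun i => hf (z i)
  have hat' : (a : ℝ) ≤ t := Nat.cast_le.2 hat
  have htb' : (t : ℝ) ≤ b := Nat.cast_le.2 htb
  have hc {s u : ℝ} (hs : s ≤ u) (hu : u ≤ s + D) : |(u - s) * c| ≤ D * |c| := by
    rw [abs_mul, abs_of_nonneg (by linarith)]
    gcongr
    linarith
  have hca := abs_le.1 (hc hat' (by linarith))
  have hcb := abs_le.1 (hc htb' (by linarith))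
  rw [sum_firstSet_sub_const (by omega), abs_le] at *
  constructor <;> linarith [hmono hat, hmono htb]

/-- Monotonicity of the partial sums of a nonnegative function makes the law of large numbers
uniform. -/
lemma frontLimit_of_gridPoint (hf : ∀ x, 0 ≤ f x) (hN : Tendsto N l atTop) (hτ : ∀ k, τ k ≤ N k)
    (h : ∀ K j : ℕ, Tendsto (fun k => (N k : ℝ)⁻¹ *
      ∑ i ∈ firstSet (N k) (gridPoint (N k) (τ k) K j), (f (z k i) - c)) l (𝓝 0)) :
    FrontLimit l N τ z f c := by
  intro ε hε
  obtain ⟨K, hK⟩ := exists_nat_gt (3 * |c| / ε)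
  have hK₀ : (0 : ℝ) < K := lt_of_le_of_lt (by positivity) hK
  have hgrid : ∀ᶠ k in l, ∀ j ∈ Finset.range (K + 2),
      |(N k : ℝ)⁻¹ * ∑ i ∈ firstSet (N k) (gridPoint (N k) (τ k) K j), (f (z k i) - c)| < ε / 3 :=
    (Filter.eventually_all_finset _).2 fun j _ => by
      simpa using Metric.tendsto_nhds.1 (h K j) (ε / 3) (by positivity)
  have hlarge : ∀ᶠ k in l, 3 * |c| / ε ≤ N k :=
    (tendsto_natCast_atTop_atTop.comp hN).eventually_ge_atTop _
  filter_upwards [hgrid, hlarge, hN.eventually_gt_atTop 0] with k hk hlarge hN₀ t ht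
  have hN₀' : (0 : ℝ) < N k := Nat.cast_pos.2 hN₀
  have hgrid' {j : ℕ} (hj : j < K + 2) :
      |∑ i ∈ firstSet (N k) (gridPoint (N k) (τ k) K j), (f (z k i) - c)| ≤ ε / 3 * N k := by
    have := hk j (Finset.mem_range.2 hj)
    rw [abs_mul, abs_of_pos (by positivity), inv_mul_lt_iff₀ hN₀', mul_comm] at this
    exact this.le
  obtain ⟨j, hj, hjt, htj, hstep⟩ := exists_gridPoint_le (Nat.cast_pos.1 hK₀) hN₀ ht (hτ k)
  refine (abs_sum_firstSet_sub_le hf hjt htj ((min_le_right _ _).trans (hτ k)) hstep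
    (hgrid' (by omega)) (hgrid' (by omega))).trans ?_
  have hcK : N k / K * |c| ≤ ε / 3 * N k := by
    rw [div_lt_iff₀ hε] at hK
    rw [div_mul_eq_mul_div, div_le_iff₀ hK₀]
    nlinarith
  have hcN : |c| ≤ ε / 3 * N k := by
    rw [div_le_iff₀ hε] at hlarge
    linarith
  linarith

end FrontLimit

section TwoSidedControl

variable {ι E : Type*} [NormedAddCommGroup E] [MeasurableSpace E] {l : Filter ι} {N τ : ι → ℕ}
  {z : (k : ι) → Fin (N k) → E} {F G : Measure E} {θ : ℝ}

/-- What is used about the beginnings of the samples `z k`, up to the change at `τ k`: the laws of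
large numbers towards `F`, and the smallness of the sums over short segments. -/
structure FrontControl (l : Filter ι) (N τ : ι → ℕ) (z : (k : ι) → Fin (N k) → E)
    (F : Measure E) : Prop where
  limit : ∀ f, LinearGrowth f → FrontLimit l N τ z f (∫ x, f x ∂F)
  small : ∀ ε > 0, ∃ δ > 0, ∀ᶠ k in l, ∀ t ≤ τ k, (t : ℝ) ≤ δ * N k →
    (∑ i ∈ firstSet (N k) t, ‖z k i‖) ^ 2 ≤ ε * (t * N k)

/-- Samples `z k` that behave like samples of independent observations with law `F` before `τ k` and
law `G` after it. The part after the change is read backwards, which makes the two conditions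
symmetric. -/
structure TwoSidedControl (l : Filter ι) (N τ : ι → ℕ) (z : (k : ι) → Fin (N k) → E)
    (F G : Measure E) (θ : ℝ) : Prop where
  size : Tendsto N l atTop
  change_le : ∀ k, τ k ≤ N k
  change : Tendsto (fun k => (τ k : ℝ) / N k) l (𝓝 θ)
  pos : 0 < θ
  lt_one : θ < 1
  integrable_left : Integrable (fun x => x) F
  integrable_right : Integrable (fun x => x) G
  front : FrontControl l N τ z F
  back : FrontControl l N (N - τ) (fun k i => z k i.rev) G

lemma FrontControl.mono {l' : Filter ι} (h : FrontControl l N τ z F) (hl : l' ≤ l) :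
    FrontControl l' N τ z F where
  limit f hf ε hε := hl (h.limit f hf ε hε)
  small ε hε := (h.small ε hε).imp fun _ hδ => ⟨hδ.1, hl hδ.2⟩

lemma tendsto_sub_div {s : ι → ℕ} {σ : ℝ} (hN : Tendsto N l atTop) (hs : ∀ᶠ k in l, s k ≤ N k)
    (hσ : Tendsto (fun k => (s k : ℝ) / N k) l (𝓝 σ)) :
    Tendsto (fun k => ((N k - s k : ℕ) : ℝ) / N k) l (𝓝 (1 - σ)) := by
  refine (hσ.const_sub 1).congr' ?_
  filter_upwards [hs, hN.eventually_gt_atTop 0] with k hk hk₀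
  rw [Nat.cast_sub hk, sub_div, div_self (Nat.cast_ne_zero.2 hk₀.ne')]

lemma tendsto_atTop_of_tendsto_div (hN : Tendsto N l atTop)
    (hθ : Tendsto (fun k => (τ k : ℝ) / N k) l (𝓝 θ)) (hθ₀ : 0 < θ) : Tendsto τ l atTop := by
  have hτ := hθ.pos_mul_atTop hθ₀ (tendsto_natCast_atTop_atTop.comp hN)
  refine tendsto_natCast_atTop_iff.1 (hτ.congr' ?_)
  filter_upwards [hN.eventually_ne_atTop 0] with k hk
  rw [Function.comp_apply, div_mul_cancel₀ _ (Nat.cast_ne_zero.2 hk)]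

namespace TwoSidedControl

lemma mono {l' : Filter ι} (h : TwoSidedControl l N τ z F G θ) (hl : l' ≤ l) :
    TwoSidedControl l' N τ z F G θ where
  size := h.size.mono_left hl
  change_le := h.change_le
  change := h.change.mono_left hl
  pos := h.pos
  lt_one := h.lt_one
  integrable_left := h.integrable_left
  integrable_right := h.integrable_right
  front := h.front.mono hl
  back := h.back.mono hl

lemma rev (h : TwoSidedControl l N τ z F G θ) :
    TwoSidedControl l N (N - τ) (fun k i => z k i.rev) G F (1 - θ) where
  size := h.size
  change_le k := Nat.sub_le (N k) (τ k)
  change := tendsto_sub_div h.size (.of_forall h.change_le) h.change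
  pos := sub_pos.2 h.lt_one
  lt_one := sub_lt_self 1 h.pos
  integrable_left := h.integrable_right
  integrable_right := h.integrable_left
  front := h.back
  back := by
    have hτ : N - (N - τ) = τ := funext fun k => Nat.sub_sub_self (h.change_le k)
    simpa only [hτ, Fin.rev_rev] using h.front

lemma eventually_change (h : TwoSidedControl l N τ z F G θ) :
    ∀ᶠ k in l, 2 ≤ τ k ∧ τ k + 2 ≤ N k := by
  filter_upwards [(tendsto_atTop_of_tendsto_div h.size h.change h.pos).eventually_ge_atTop 2,
    (tendsto_atTop_of_tendsto_div h.size h.rev.change h.rev.pos).eventually_ge_atTop 2]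
    with k hk hk'
  rw [Pi.sub_apply] at hk'
  omega

variable {t : ι → ℕ} {γ : ℝ}

lemma tendsto_frontLaw [MeasurableSingletonClass E] [IsFiniteMeasure F] [IsFiniteMeasure G]
    (h : TwoSidedControl l N τ z F G θ) (ht : ∀ᶠ k in l, t k ≤ N k) (hγ₀ : 0 ≤ γ)
    (hγ : Tendsto (fun k => (t k : ℝ) / N k) l (𝓝 γ)) :
    TendstoLinearGrowth (fun k => frontLaw (z k) (t k)) l (frontMix F G θ γ) := by
  intro f hf
  have hmin : Tendsto (fun k => ((min (t k) (τ k) : ℕ) : ℝ) / N k) l (𝓝 (min γ θ)) := by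
    simpa only [Nat.cast_min, min_div_div_right (Nat.cast_nonneg _)] using hγ.min h.change
  have hmax : Tendsto (fun k => ((max (t k) (τ k) : ℕ) : ℝ) / N k) l (𝓝 (max γ θ)) := by
    simpa only [Nat.cast_max, max_div_div_right (Nat.cast_nonneg _)] using hγ.max h.change
  have hbefore := (h.front.limit f hf).tendsto
    (.of_forall fun k => (min_le_right _ _).trans (h.change_le k))
    (.of_forall fun k => min_le_right _ _) hmin
  have hafter := (h.back.limit f hf).tendsto (.of_forall fun k => Nat.sub_le _ _)
    (.of_forall fun k => le_rfl) h.rev.change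
  have hbehind := (h.back.limit f hf).tendsto (.of_forall fun k => Nat.sub_le _ _)
    (.of_forall fun k => Nat.sub_le_sub_left (le_max_right _ _) _)
    (tendsto_sub_div h.size (ht.mono fun k hk => max_le hk (h.change_le k)) hmax)
  have hintegral : ∫ x, f x ∂(frontMix F G θ γ) = min γ θ * ∫ x, f x ∂F +
      ((1 - θ) * ∫ x, f x ∂G - (1 - max γ θ) * ∫ x, f x ∂G) := by
    rw [frontMix, integral_mix (hf.integrable h.integrable_left) (hf.integrable h.integrable_right)
      (le_min hγ₀ h.pos.le) (sub_nonneg.2 (le_max_right _ _))]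
    ring
  rw [hintegral]
  refine (hbefore.add (hafter.sub hbehind)).congr' ?_
  filter_upwards [ht] with k hk
  rw [frontLaw, integral_empirical, sum_firstSet_eq_add_rev_sub hk (h.change_le k), mul_add,
    mul_sub]

lemma tendsto_backLaw [MeasurableSingletonClass E] [IsFiniteMeasure F] [IsFiniteMeasure G]
    (h : TwoSidedControl l N τ z F G θ) (ht : ∀ᶠ k in l, t k ≤ N k) (hγ₁ : γ ≤ 1)
    (hγ : Tendsto (fun k => (t k : ℝ) / N k) l (𝓝 γ)) :
    TendstoLinearGrowth (fun k => backLaw (z k) (t k)) l (frontMix G F (1 - θ) (1 - γ)) := by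
  intro f hf
  refine (h.rev.tendsto_frontLaw (.of_forall fun k => Nat.sub_le _ (t k)) (sub_nonneg.2 hγ₁)
    (tendsto_sub_div h.size ht hγ) f hf).congr' ?_
  filter_upwards [ht] with k hk
  rw [frontLaw_rev _ hk]

end TwoSidedControl

end TwoSidedControl

section Criterion

variable {ι : Type*} {d : ℕ} {l : Filter ι} {N τ t : ι → ℕ} {z : (k : ι) → Fin (N k) → Vec d}
  {F G : Measure (Vec d)} {θ γ : ℝ}

lemma FrontControl.tendsto_small (h : FrontControl l N τ z F) (htN : ∀ k, τ k ≤ N k)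
    (ht : ∀ᶠ k in l, t k ≤ τ k)
    (hγ : Tendsto (fun k => (t k : ℝ) / N k) l (𝓝 0)) :
    Tendsto (fun k => (∫ x, ‖x‖ ∂(frontLaw (z k) (t k))) ^ 2 / ((t k : ℝ) / N k)) l (𝓝 0) := by
  rw [Metric.tendsto_nhds]
  intro ε hε
  obtain ⟨δ, hδ, hsmall⟩ := h.small (ε / 2) (half_pos hε)
  filter_upwards [hsmall, ht, hγ.eventually_le_const hδ] with k hk htk hγk
  rw [dist_zero_right, Real.norm_of_nonneg (by positivity)]
  refine lt_of_le_of_lt ?_ (half_lt_self hε)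
  rcases (t k).eq_zero_or_pos with h₀ | h₀
  · rw [h₀, Nat.cast_zero, zero_div, div_zero]
    positivity
  have ht₀ : (0 : ℝ) < t k := Nat.cast_pos.2 h₀
  have hN₀ : (0 : ℝ) < N k := Nat.cast_pos.2 (h₀.trans_le (htk.trans (htN k)))
  rw [frontLaw, integral_empirical, div_le_iff₀ (div_pos ht₀ hN₀), mul_pow]
  calc ((N k : ℝ)⁻¹) ^ 2 * (∑ i ∈ firstSet (N k) (t k), ‖z k i‖) ^ 2
      ≤ ((N k : ℝ)⁻¹) ^ 2 * (ε / 2 * (t k * N k)) := by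
        gcongr
        exact hk _ htk ((div_le_iff₀ hN₀).1 hγk)
    _ = ε / 2 * (t k / N k) := by field_simp

namespace TwoSidedControl

variable [IsFiniteMeasure F] [IsFiniteMeasure G]

lemma tendsto_criterion_of_mem_Ioo (h : TwoSidedControl l N τ z F G θ)
    (ht : ∀ᶠ k in l, t k ≤ N k) (hγ₀ : 0 < γ) (hγ₁ : γ < 1)
    (hγ : Tendsto (fun k => (t k : ℝ) / N k) l (𝓝 γ)) :
    Tendsto (fun k => criterion (z k) (t k)) l (𝓝 (profile F G θ γ)) := by
  have hfront := h.tendsto_frontLaw ht hγ₀.le hγ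
  have hback := h.tendsto_backLaw ht hγ₁.le hγ
  have hμ := integrable_frontMix h.integrable_left h.integrable_right θ γ
  have hν := integrable_frontMix h.integrable_right h.integrable_left (1 - θ) (1 - γ)
  have hμs (k : ι) : Integrable (fun x => x) (frontLaw (z k) (t k)) := integrable_empirical ..
  have hνs (k : ι) : Integrable (fun x => x) (backLaw (z k) (t k)) := integrable_empirical ..
  have hε : Tendsto (fun k => (N k : ℝ)⁻¹) l (𝓝 0) := tendsto_inv_atTop_nhds_zero_nat.comp h.size
  refine (tendsto_weightedDivergence hγ₀.ne' hγ₁.ne hγ hε (hfront.meanDist hfront hμs hμs hμ hμ)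
    (hfront.meanDist hback hμs hνs hμ hν) (hback.meanDist hback hνs hνs hν hν)).congr' ?_
  filter_upwards [ht] with k hk
  rw [criterion_eq _ hk]

lemma tendsto_criterion_zero (h : TwoSidedControl l N τ z F G θ)
    (ht : ∀ᶠ k in l, 2 ≤ t k ∧ t k + 2 ≤ N k)
    (hγ : Tendsto (fun k => (t k : ℝ) / N k) l (𝓝 0)) :
    Tendsto (fun k => criterion (z k) (t k)) l (𝓝 0) := by
  have htτ : ∀ᶠ k in l, t k ≤ τ k := by
    filter_upwards [hγ.eventually_lt h.change h.pos] with k hk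
    by_contra! hlt
    exact hk.not_ge (by gcongr)
  have hfront := h.front.tendsto_small h.change_le htτ hγ
  have hback := h.tendsto_backLaw (ht.mono fun k hk => by omega) zero_le_one hγ _ linearGrowth_norm
  have hγ' := hγ.const_sub 1
  have hbound := ((hγ'.mul hfront).add (hγ.mul ((hback.pow 2).div hγ' (by simp)))).const_mul 64
  simp only [mul_zero, zero_mul, add_zero] at hbound
  refine squeeze_zero' ?_ ?_ hbound
  · filter_upwards [ht] with k hk
    exact criterion_nonneg _ (by omega)
  · filter_upwards [ht] with k hk
    exact criterion_le _ hk.1 hk.2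

lemma tendsto_criterion (h : TwoSidedControl l N τ z F G θ)
    (ht : ∀ᶠ k in l, 2 ≤ t k ∧ t k + 2 ≤ N k) (hγ : γ ∈ Set.Icc (0 : ℝ) 1)
    (htγ : Tendsto (fun k => (t k : ℝ) / N k) l (𝓝 γ)) :
    Tendsto (fun k => criterion (z k) (t k)) l (𝓝 (profile F G θ γ)) := by
  have htN : ∀ᶠ k in l, t k ≤ N k := ht.mono fun k hk => by omega
  rcases hγ.1.eq_or_lt with rfl | hγ₀
  · rw [profile_zero]
    exact h.tendsto_criterion_zero ht htγ
  rcases hγ.2.eq_or_lt with rfl | hγ₁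
  · rw [← profile_symm, sub_self, profile_zero]
    refine (h.rev.tendsto_criterion_zero (t := fun k => N k - t k) ?_ ?_).congr' ?_
    · filter_upwards [ht] with k hk
      omega
    · simpa using tendsto_sub_div h.size htN htγ
    · filter_upwards [htN] with k hk
      exact criterion_rev _ hk
  · exact h.tendsto_criterion_of_mem_Ioo htN hγ₀ hγ₁ htγ

/-- Along an ultrafilter the proportions `t k / N k` converge, by compactness of `[0, 1]`. -/
lemma exists_tendsto_criterion {u : Ultrafilter ι} (h : TwoSidedControl u N τ z F G θ)
    (ht : ∀ᶠ k in u, 2 ≤ t k ∧ t k + 2 ≤ N k) :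
    ∃ γ ∈ Set.Icc (0 : ℝ) 1, Tendsto (fun k => (t k : ℝ) / N k) u (𝓝 γ) ∧
      Tendsto (fun k => criterion (z k) (t k)) u (𝓝 (profile F G θ γ)) := by
  have hmem : ∀ᶠ k in u, (t k : ℝ) / N k ∈ Set.Icc (0 : ℝ) 1 :=
    ht.mono fun k hk => div_mem_Icc_zero_one (by omega)
  obtain ⟨γ, hγ, hle⟩ := isCompact_Icc.ultrafilter_le_nhds'
    (u.map fun k => (t k : ℝ) / N k) hmem
  exact ⟨γ, hγ, hle, h.tendsto_criterion ht hγ hle⟩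

lemma tendsto_maximiser (h : TwoSidedControl l N τ z F G θ) (hD : 0 < limitDivergence F G)
    (ht : ∀ᶠ k in l, 2 ≤ t k ∧ t k + 2 ≤ N k)
    (hmax : ∀ᶠ k in l, criterion (z k) (τ k) ≤ criterion (z k) (t k)) :
    Tendsto (fun k => (t k : ℝ) / N k) l (𝓝 θ) := by
  rw [tendsto_iff_ultrafilter]
  intro u hu
  have h' := h.mono hu
  obtain ⟨γ, hγ, htγ, hcriterion⟩ := h'.exists_tendsto_criterion (hu ht)
  have hcriterion_change := h'.tendsto_criterion (hu h.eventually_change)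
    ⟨h.pos.le, h.lt_one.le⟩ h'.change
  have hle := le_of_tendsto_of_tendsto hcriterion_change hcriterion (hu hmax)
  obtain rfl : γ = θ := by
    by_contra hne
    exact hle.not_gt
      (profile_lt_profile_self h.integrable_left h.integrable_right hD h.pos h.lt_one hγ hne)
  exact htγ

lemma tendsto_criterion_of_same (h : TwoSidedControl l N τ z F F θ)
    (ht : ∀ᶠ k in l, 2 ≤ t k ∧ t k + 2 ≤ N k) :
    Tendsto (fun k => criterion (z k) (t k)) l (𝓝 0) := by
  rw [tendsto_iff_ultrafilter]
  intro u hu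
  obtain ⟨γ, hγ, -, hcriterion⟩ := (h.mono hu).exists_tendsto_criterion (hu ht)
  rwa [profile_same h.integrable_left h.pos h.lt_one hγ] at hcriterion

end TwoSidedControl

end Criterion

/-! ### Moments and modes of convergence -/

section Moments

variable {Ω κ : Type*} [MeasurableSpace Ω] {P : Measure Ω} {X : κ → Ω → ℝ} {s : Finset κ}

lemma indepFun_sum_of_notMem (hX : iIndepFun X P) (hm : ∀ i, AEMeasurable (X i) P) {a : κ}
    (ha : a ∉ s) : IndepFun (fun ω => ∑ i ∈ s, X i ω) (X a) P := by
  simpa only [Finset.sum_fn] using hX.indepFun_finsetSum_of_notMem₀ hm ha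

lemma integral_sum_eq_zero (hX : ∀ i ∈ s, Integrable (X i) P) (h₀ : ∀ i ∈ s, ∫ ω, X i ω ∂P = 0) :
    ∫ ω, ∑ i ∈ s, X i ω ∂P = 0 := by
  rw [integral_finsetSum _ hX, Finset.sum_eq_zero h₀]

variable [IsProbabilityMeasure P]

lemma integrable_pow_of_memLp {X : Ω → ℝ} {p k : ℕ} (hX : MemLp X p P) (hk : k ≤ p) :
    Integrable (fun ω => X ω ^ k) P := by
  have hnorm := (hX.mono_exponent (Nat.cast_le.2 hk)).integrable_norm_pow'
  refine hnorm.mono' (hX.aestronglyMeasurable.pow k) (ae_of_all _ fun ω => ?_)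
  rw [norm_pow]

lemma integral_add_pow_of_indepFun {X Y : Ω → ℝ} {p : ℕ} (hXY : IndepFun X Y P)
    (hX : MemLp X p P) (hY : MemLp Y p P) :
    ∫ ω, (X ω + Y ω) ^ p ∂P = ∑ k ∈ Finset.range (p + 1),
      (∫ ω, X ω ^ k ∂P) * (∫ ω, Y ω ^ (p - k) ∂P) * (p.choose k : ℝ) := by
  have hindep (j k : ℕ) : IndepFun (fun ω => X ω ^ j) (fun ω => Y ω ^ k) P :=
    hXY.comp (measurable_id.pow_const j) (measurable_id.pow_const k)
  have hXk {k : ℕ} (hk : k ∈ Finset.range (p + 1)) : Integrable (fun ω => X ω ^ k) P :=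
    integrable_pow_of_memLp hX (Finset.mem_range_succ_iff.1 hk)
  have hYk (k : ℕ) : Integrable (fun ω => Y ω ^ (p - k)) P :=
    integrable_pow_of_memLp hY (Nat.sub_le p k)
  have hXYk : ∀ k ∈ Finset.range (p + 1),
      Integrable (fun ω => X ω ^ k * Y ω ^ (p - k) * (p.choose k : ℝ)) P := fun k hk =>
    ((hindep k (p - k)).integrable_mul (hXk hk) (hYk k)).mul_const _
  simp_rw [add_pow]
  rw [integral_finsetSum _ hXYk]
  refine Finset.sum_congr rfl fun k hk => ?_
  rw [integral_mul_const, (hindep k (p - k)).integral_fun_mul_eq_mul_integral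
    (hXk hk).aestronglyMeasurable (hYk k).aestronglyMeasurable]

lemma integral_sum_sq (hX : iIndepFun X P) (hm : ∀ i, AEMeasurable (X i) P) {σ : ℝ}
    (h2 : ∀ i ∈ s, MemLp (X i) 2 P) (h₀ : ∀ i ∈ s, ∫ ω, X i ω ∂P = 0)
    (hσ : ∀ i ∈ s, ∫ ω, X i ω ^ 2 ∂P = σ) :
    ∫ ω, (∑ i ∈ s, X i ω) ^ 2 ∂P = s.card * σ := by
  have hsum := IndepFun.variance_sum h2 fun i _ j _ hij => hX.indepFun hij
  rw [Finset.sum_fn, variance_of_integral_eq_zero (Finset.aemeasurable_fun_sum s fun i _ => hm i)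
    (integral_sum_eq_zero (fun i hi => (h2 i hi).integrable one_le_two) h₀)] at hsum
  rw [hsum, Finset.sum_congr rfl fun i hi =>
    (variance_of_integral_eq_zero (hm i) (h₀ i hi)).trans (hσ i hi), Finset.sum_const, nsmul_eq_mul]

/-- Only the squares of the second moments contribute to the quadratic growth. -/
lemma integral_sum_pow_four_le (hX : iIndepFun X P) (hm : ∀ i, AEMeasurable (X i) P) {σ K : ℝ}
    (h4 : ∀ i ∈ s, MemLp (X i) 4 P) (h₀ : ∀ i ∈ s, ∫ ω, X i ω ∂P = 0)
    (hσ : ∀ i ∈ s, ∫ ω, X i ω ^ 2 ∂P = σ) (hK : ∀ i ∈ s, ∫ ω, X i ω ^ 4 ∂P = K) :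
    ∫ ω, (∑ i ∈ s, X i ω) ^ 4 ∂P ≤ 3 * σ ^ 2 * s.card ^ 2 + K * s.card := by
  classical
  induction s using Finset.induction_on with
  | empty => simp
  | insert a s ha ih =>
    rw [Finset.forall_mem_insert] at h4 h₀ hσ hK
    have hint : ∀ i ∈ s, Integrable (X i) P := fun i hi => (h4.2 i hi).integrable (by norm_num)
    have hexpand := integral_add_pow_of_indepFun (p := 4) (indepFun_sum_of_notMem hX hm ha)
      (memLp_finsetSum s h4.2) h4.1
    have hsq := integral_sum_sq hX hm (fun i hi => (h4.2 i hi).mono_exponent (by norm_num)) h₀.2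
      hσ.2
    simp only [Finset.sum_range_succ, Finset.sum_range_zero, pow_zero, pow_one, Nat.sub_zero,
      Nat.reduceSub, integral_const, probReal_univ, hK.1, hσ.1, h₀.1, hsq,
      integral_sum_eq_zero hint h₀.2, Nat.choose_self, Nat.choose_zero_right,
      show Nat.choose 4 2 = 6 from rfl] at hexpand
    simp only [Finset.sum_insert ha, Finset.card_insert_of_notMem ha, add_comm (X a _), hexpand]
    have := ih h4.2 h₀.2 hσ.2 hK.2
    push_cast
    norm_num
    nlinarith [sq_nonneg σ]

end Moments

section Filters

lemma tendsto_zero_of_tendsto_pow {ι : Type*} {l : Filter ι} {f : ι → ℝ} {p : ℕ}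
    (h : Tendsto (fun k => f k ^ p) l (𝓝 0)) : Tendsto f l (𝓝 0) := by
  rw [Metric.tendsto_nhds] at h ⊢
  intro ε hε
  filter_upwards [h (ε ^ p) (by positivity)] with k hk
  rw [dist_zero_right] at hk ⊢
  rw [norm_pow] at hk
  exact lt_of_pow_lt_pow_left₀ p hε.le hk

variable {Ω : Type*} [MeasurableSpace Ω]

/-- The filter of sets that almost surely contain `(n, ω)` for all large `n`: convergence along it
is almost sure convergence. -/
def aeFilter (P : Measure Ω) : Filter (ℕ × Ω) := ((ae P).curry atTop).map Prod.swap

/-- The filter of sets that contain `(n, ω)` with probability tending to one: convergence along it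
is convergence in probability. -/
def probFilter (P : Measure Ω) : Filter (ℕ × Ω) where
  sets := {B | Tendsto (fun n => P {ω | (n, ω) ∉ B}) atTop (𝓝 0)}
  univ_sets := by simp
  sets_of_superset {B C} hB hBC :=
    tendsto_of_tendsto_of_tendsto_of_le_of_le tendsto_const_nhds hB (fun _ => zero_le)
      fun n => measure_mono fun ω hω hωB => hω (hBC hωB)
  inter_sets {B C} hB hC := by
    have hsum : Tendsto (fun n => P {ω | (n, ω) ∉ B} + P {ω | (n, ω) ∉ C}) atTop (𝓝 0) := by
      simpa using hB.add hC
    refine tendsto_of_tendsto_of_tendsto_of_le_of_le tendsto_const_nhds hsum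
      (fun _ => zero_le) fun n => (measure_mono fun ω hω => ?_).trans (measure_union_le _ _)
    exact not_and_or.1 hω

variable {P : Measure Ω}

lemma eventually_aeFilter {p : ℕ × Ω → Prop} :
    (∀ᶠ k in aeFilter P, p k) ↔ ∀ᵐ ω ∂P, ∀ᶠ n in atTop, p (n, ω) := by
  rw [aeFilter, eventually_map, eventually_curry_iff]
  rfl

lemma eventually_probFilter {p : ℕ × Ω → Prop} :
    (∀ᶠ k in probFilter P, p k) ↔ Tendsto (fun n => P {ω | ¬ p (n, ω)}) atTop (𝓝 0) := Iff.rfl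

lemma tendsto_aeFilter {f : ℕ × Ω → ℝ} {a : ℝ} :
    Tendsto f (aeFilter P) (𝓝 a) ↔ ∀ᵐ ω ∂P, Tendsto (fun n => f (n, ω)) atTop (𝓝 a) := by
  constructor
  · intro h
    have hball (j : ℕ) : ∀ᵐ ω ∂P, ∀ᶠ n in atTop, dist (f (n, ω)) a < 1 / ((j : ℝ) + 1) :=
      eventually_aeFilter.1 (Metric.tendsto_nhds.1 h _ Nat.one_div_pos_of_nat)
    filter_upwards [ae_all_iff.2 hball] with ω hω
    refine Metric.tendsto_nhds.2 fun ε hε => ?_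
    obtain ⟨j, hj⟩ := exists_nat_one_div_lt hε
    exact (hω j).mono fun n hn => hn.trans hj
  · refine fun h => Metric.tendsto_nhds.2 fun ε hε => eventually_aeFilter.2 ?_
    exact h.mono fun ω hω => Metric.tendsto_nhds.1 hω ε hε

lemma tendsto_fst_aeFilter (P : Measure Ω) : Tendsto Prod.fst (aeFilter P) atTop :=
  fun _ hs => eventually_aeFilter.2 (ae_of_all _ fun _ => hs)

lemma tendsto_fst_probFilter (P : Measure Ω) : Tendsto Prod.fst (probFilter P) atTop := by
  refine fun s hs => eventually_probFilter.2 (tendsto_const_nhds.congr' ?_)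
  filter_upwards [hs] with n hn
  have hempty : {_ω : Ω | ¬ n ∈ s} = ∅ := Set.eq_empty_of_forall_notMem fun _ hω => hω hn
  exact (hempty ▸ measure_empty).symm

/-- A mode of convergence of sequences of random variables, given as a filter on the pairs of a
sample size and a point of the probability space, in which nonnegative variables with summable
expectations vanish. Almost sure convergence and convergence in probability are treated together
through it. -/
structure SummableVanish (P : Measure Ω) (l : Filter (ℕ × Ω)) : Prop where
  fst : Tendsto Prod.fst l atTop
  tendsto_zero : ∀ W : ℕ → Ω → ℝ, (∀ n, Integrable (W n) P) → (∀ n ω, 0 ≤ W n ω) →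
    Summable (fun n => ∫ ω, W n ω ∂P) → Tendsto (fun k : ℕ × Ω => W k.1 k.2) l (𝓝 0)

lemma summableVanish_aeFilter (P : Measure Ω) : SummableVanish P (aeFilter P) := by
  refine ⟨tendsto_fst_aeFilter P, fun W hW hW₀ hsum => tendsto_aeFilter.2 ?_⟩
  have hlintegral (n : ℕ) : ∫⁻ ω, ENNReal.ofReal (W n ω) ∂P = ENNReal.ofReal (∫ ω, W n ω ∂P) :=
    (ofReal_integral_eq_lintegral_ofReal (hW n) (ae_of_all _ (hW₀ n))).symm
  have hfinite : ∫⁻ ω, ∑' n, ENNReal.ofReal (W n ω) ∂P ≠ ∞ := by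
    rw [lintegral_tsum fun n => (hW n).aemeasurable.ennreal_ofReal]
    simp_rw [hlintegral]
    exact hsum.tsum_ofReal_ne_top
  filter_upwards [ae_lt_top' (AEMeasurable.tsum fun n => (hW n).aemeasurable.ennreal_ofReal)
    hfinite] with ω hω
  have hzero := (ENNReal.tendsto_toReal ENNReal.zero_ne_top).comp
    (ENNReal.tendsto_atTop_zero_of_tsum_ne_top hω.ne)
  simpa [Function.comp_def, ENNReal.toReal_ofReal (hW₀ _ ω)] using hzero

lemma tendsto_probFilter_zero [IsFiniteMeasure P] {W : ℕ → Ω → ℝ}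
    (hW : ∀ᶠ n in atTop, Integrable (W n) P) (hW₀ : ∀ n ω, 0 ≤ W n ω)
    (hlim : Tendsto (fun n => ∫ ω, W n ω ∂P) atTop (𝓝 0)) :
    Tendsto (fun k : ℕ × Ω => W k.1 k.2) (probFilter P) (𝓝 0) := by
  refine Metric.tendsto_nhds.2 fun ε hε => eventually_probFilter.2 ?_
  have hbound : Tendsto (fun n => ENNReal.ofReal ((∫ ω, W n ω ∂P) / ε)) atTop (𝓝 0) := by
    simpa using ENNReal.tendsto_ofReal (hlim.div_const ε)
  refine tendsto_of_tendsto_of_tendsto_of_le_of_le' tendsto_const_nhds hbound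
    (.of_forall fun _ => zero_le) ?_
  filter_upwards [hW] with n hn
  have hmarkov := mul_meas_ge_le_integral_of_nonneg (ae_of_all _ (hW₀ n)) hn ε
  have hset : {ω | ¬ dist (W n ω) 0 < ε} = {ω | ε ≤ W n ω} := by
    ext ω
    simp [abs_of_nonneg (hW₀ n ω)]
  rw [hset, ← ofReal_measureReal]
  exact ENNReal.ofReal_le_ofReal ((le_div_iff₀' hε).2 hmarkov)

lemma summableVanish_probFilter (P : Measure Ω) [IsFiniteMeasure P] :
    SummableVanish P (probFilter P) where
  fst := tendsto_fst_probFilter P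
  tendsto_zero _ hW hW₀ hsum :=
    tendsto_probFilter_zero (.of_forall hW) hW₀ hsum.tendsto_atTop_zero

end Filters

/-! ### Observations before the change -/

/-- The splits `(j + 1) ^ 2`, truncated at the change. They are close enough to dominate all the
sums of nonnegative terms, and sparse enough for a union bound over them to be summable. -/
def squarePoint (τ j : ℕ) : ℕ := min ((j + 1) ^ 2) τ

lemma squarePoint_le_sq (τ j : ℕ) : (squarePoint τ j : ℝ) ≤ ((j : ℝ) + 1) ^ 2 := by
  exact_mod_cast min_le_left _ τ

lemma sq_sum_firstSet_le {E : Type*} [NormedAddCommGroup E] {n τ t : ℕ} (htτ : t ≤ τ)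
    (hτ : τ ≤ n) (z : Fin n → E) {c M : ℝ} (hc : 0 ≤ c)
    (hM : ∀ j ≤ Nat.sqrt n,
      (∑ i ∈ firstSet n (squarePoint τ j), (‖z i‖ - c)) ^ 2 ≤ M * ((j : ℝ) + 1) ^ 2) :
    (∑ i ∈ firstSet n t, ‖z i‖) ^ 2 ≤ 8 * M * t + 32 * c ^ 2 * t ^ 2 := by
  rcases t.eq_zero_or_pos with rfl | ht
  · simp [firstSet]
  set j := Nat.sqrt t
  set s := squarePoint τ j
  set D := ∑ i ∈ firstSet n s, (‖z i‖ - c)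
  have hts : t ≤ s := le_min (Nat.sqrt_lt'.1 (Nat.lt_succ_self j)).le htτ
  have hj : 1 ≤ j := Nat.sqrt_pos.2 ht
  have hjt : ((j : ℝ) + 1) ^ 2 ≤ 4 * t := by
    have : (j + 1) ^ 2 ≤ 4 * t := by nlinarith [Nat.sqrt_le' t, hj]
    exact_mod_cast this
  have hs : (s : ℝ) ≤ 4 * t := (squarePoint_le_sq τ j).trans hjt
  have hD : D ^ 2 ≤ M * ((j : ℝ) + 1) ^ 2 := hM j (Nat.sqrt_le_sqrt (htτ.trans hτ))
  have hM₀ : 0 ≤ M := nonneg_of_mul_nonneg_left ((sq_nonneg D).trans hD) (by positivity)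
  have hsum : ∑ i ∈ firstSet n s, ‖z i‖ = D + s * c := by
    rw [← sub_eq_iff_eq_add]
    exact (sum_firstSet_sub_const ((min_le_right _ _).trans hτ) z (fun x => ‖x‖) c).symm
  calc (∑ i ∈ firstSet n t, ‖z i‖) ^ 2
      ≤ (∑ i ∈ firstSet n s, ‖z i‖) ^ 2 :=
        pow_le_pow_left₀ (Finset.sum_nonneg fun i _ => norm_nonneg (z i))
          (sum_firstSet_mono hts fun i => norm_nonneg (z i)) 2
    _ = (D + s * c) ^ 2 := by rw [hsum]
    _ ≤ 2 * (D ^ 2 + (s * c) ^ 2) := add_sq_le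
    _ ≤ 2 * (M * (4 * t) + (4 * t * c) ^ 2) := by
        gcongr
        exact hD.trans (by gcongr)
    _ = 8 * M * t + 32 * c ^ 2 * t ^ 2 := by ring

lemma summable_sqrt_add_one_div_sq :
    Summable fun n : ℕ => ((Nat.sqrt n : ℝ) + 1) / (n : ℝ) ^ 2 := by
  refine .of_nonneg_of_le (fun n => by positivity) (fun n => ?_)
    ((Real.summable_nat_rpow.2 (by norm_num : (-3 / 2 : ℝ) < -1)).mul_left 2)
  rcases n.eq_zero_or_pos with rfl | hn
  · simp
  have hsqrt : (Nat.sqrt n : ℝ) ≤ (n : ℝ) ^ (1 / 2 : ℝ) := by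
    rw [← Real.sqrt_eq_rpow]
    exact Real.nat_sqrt_le_real_sqrt
  have hone : (1 : ℝ) ≤ (n : ℝ) ^ (1 / 2 : ℝ) :=
    Real.one_le_rpow (Nat.one_le_cast.2 hn) (by norm_num)
  have hpow : (n : ℝ) ^ (-3 / 2 : ℝ) = (n : ℝ) ^ (1 / 2 : ℝ) / (n : ℝ) ^ 2 := by
    rw [← Real.rpow_natCast, ← Real.rpow_sub (Nat.cast_pos.2 hn)]
    norm_num
  rw [hpow, ← mul_div_assoc]
  gcongr
  linarith

section FrontModel

variable {Ω E : Type*} [MeasurableSpace Ω] [MeasurableSpace E]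

/-- Rows of independent observations, the first `τ n` of which have law `F`. -/
structure FrontModel (P : Measure Ω) (Z : (n : ℕ) → Fin n → Ω → E) (τ : ℕ → ℕ) (F : Measure E) :
    Prop where
  indep : ∀ n, iIndepFun (Z n) P
  aemeasurable : ∀ n i, AEMeasurable (Z n i) P
  change_le : ∀ n, τ n ≤ n
  law : ∀ (n : ℕ) (i : Fin n), (i : ℕ) < τ n → HasLaw (Z n i) F P

namespace FrontModel

variable {P : Measure Ω} {Z : (n : ℕ) → Fin n → Ω → E} {τ : ℕ → ℕ}
  {F : Measure E} {f : E → ℝ} {l : Filter (ℕ × Ω)}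

lemma hasLaw (h : FrontModel P Z τ F) {n t : ℕ} (ht : t ≤ τ n) {i : Fin n}
    (hi : i ∈ firstSet n t) : HasLaw (Z n i) F P :=
  h.law n i ((mem_firstSet.1 hi).trans_le ht)

lemma memLp_comp (h : FrontModel P Z τ F) {p : ℝ≥0∞} (hf : MemLp f p F) {n t : ℕ} (ht : t ≤ τ n)
    {i : Fin n} (hi : i ∈ firstSet n t) : MemLp (fun ω => f (Z n i ω)) p P := by
  have hlaw := h.hasLaw ht hi
  rw [← hlaw.map_eq] at hf
  exact hf.comp_of_map hlaw.aemeasurable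

lemma integral_comp (h : FrontModel P Z τ F) (hf : Measurable f) {n t : ℕ} (ht : t ≤ τ n)
    {i : Fin n} (hi : i ∈ firstSet n t) : ∫ ω, f (Z n i ω) ∂P = ∫ x, f x ∂F :=
  (h.hasLaw ht hi).integral_comp hf.aestronglyMeasurable

variable [IsProbabilityMeasure P]

lemma exists_integral_pow_four_le [IsProbabilityMeasure F] (h : FrontModel P Z τ F)
    (hf : Measurable f) (hf4 : MemLp f 4 F) : ∃ C, ∀ n, ∀ t ≤ τ n,
      ∫ ω, (∑ i ∈ firstSet n t, (f (Z n i ω) - ∫ x, f x ∂F)) ^ 4 ∂P ≤ C * (t : ℝ) ^ 2 := by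
  set g : E → ℝ := fun x => f x - ∫ x, f x ∂F with hg
  have hgm : Measurable g := hf.sub_const _
  have hg4 : MemLp g 4 F := hf4.sub (memLp_const _)
  have hg₀ : ∫ x, g x ∂F = 0 := by
    rw [hg, integral_sub (hf4.integrable (by norm_num)) (integrable_const _)]
    simp
  have hmoment {n t : ℕ} (ht : t ≤ τ n) (k : ℕ) :
      ∀ i ∈ firstSet n t, ∫ ω, g (Z n i ω) ^ k ∂P = ∫ x, g x ^ k ∂F :=
    fun i hi => h.integral_comp (hgm.pow_const k) ht hi
  refine ⟨3 * (∫ x, g x ^ 2 ∂F) ^ 2 + ∫ x, g x ^ 4 ∂F, fun n t ht => ?_⟩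
  refine (integral_sum_pow_four_le ((h.indep n).comp (fun _ => g) fun _ => hgm)
    (fun i => hgm.comp_aemeasurable (h.aemeasurable n i)) (fun i hi => h.memLp_comp hg4 ht hi)
    (fun i hi => by simpa [hg₀] using hmoment ht 1 i hi) (hmoment ht 2) (hmoment ht 4)).trans ?_
  rw [card_firstSet (ht.trans (h.change_le n)), add_mul]
  gcongr
  exact_mod_cast Nat.le_self_pow two_ne_zero t

lemma integrable_pow_four [IsFiniteMeasure F] (h : FrontModel P Z τ F) (hf4 : MemLp f 4 F) (c : ℝ)
    {n t : ℕ} (ht : t ≤ τ n) :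
    Integrable (fun ω => (∑ i ∈ firstSet n t, (f (Z n i ω) - c)) ^ 4) P :=
  integrable_pow_of_memLp (p := 4) (memLp_finsetSum _ fun _ hi =>
    h.memLp_comp (f := fun x => f x - c) (hf4.sub (memLp_const c)) ht hi) le_rfl

lemma frontLimit_of_memLp [IsProbabilityMeasure F] (h : FrontModel P Z τ F)
    (hl : SummableVanish P l) (hf : Measurable f) (hf₀ : ∀ x, 0 ≤ f x) (hf4 : MemLp f 4 F) :
    FrontLimit l Prod.fst (fun k => τ k.1) (fun k i => Z k.1 i k.2) f (∫ x, f x ∂F) := by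
  obtain ⟨C, hC⟩ := h.exists_integral_pow_four_le hf hf4
  refine frontLimit_of_gridPoint hf₀ hl.fst (fun k => h.change_le k.1) fun K j => ?_
  set S : ℕ → Ω → ℝ := fun n ω =>
    ∑ i ∈ firstSet n (gridPoint n (τ n) K j), (f (Z n i ω) - ∫ x, f x ∂F)
  have ht (n : ℕ) : gridPoint n (τ n) K j ≤ τ n := min_le_right _ _
  have hint (n : ℕ) : ∫ ω, ((n : ℝ)⁻¹ * S n ω) ^ 4 ∂P ≤ |C| * (1 / (n : ℝ) ^ 2) := by
    simp_rw [mul_pow]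
    rw [integral_const_mul]
    calc (n : ℝ)⁻¹ ^ 4 * ∫ ω, S n ω ^ 4 ∂P
        ≤ (n : ℝ)⁻¹ ^ 4 * (|C| * (n : ℝ) ^ 2) := by
          gcongr
          refine (hC n _ (ht n)).trans ?_
          gcongr
          · exact le_abs_self C
          · exact (ht n).trans (h.change_le n)
      _ = |C| * (1 / (n : ℝ) ^ 2) := by
          rcases n.eq_zero_or_pos with rfl | hn
          · simp
          field_simp
  refine tendsto_zero_of_tendsto_pow (hl.tendsto_zero
    (fun n ω => ((n : ℝ)⁻¹ * S n ω) ^ 4) (fun n => ?_) (fun n ω => by positivity)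
    (.of_nonneg_of_le (fun n => integral_nonneg fun ω => by positivity) hint
      ((Real.summable_one_div_nat_pow.2 one_lt_two).mul_left _)))
  simpa only [mul_pow] using (h.integrable_pow_four hf4 _ (ht n)).const_mul _

lemma tendsto_sum_squarePoint [IsProbabilityMeasure F] (h : FrontModel P Z τ F)
    (hl : SummableVanish P l) (hf : Measurable f) (hf4 : MemLp f 4 F) :
    Tendsto (fun k : ℕ × Ω => (∑ j ∈ Finset.range (Nat.sqrt k.1 + 1),
      (∑ i ∈ firstSet k.1 (squarePoint (τ k.1) j), (f (Z k.1 i k.2) - ∫ x, f x ∂F)) ^ 4 /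
        ((j : ℝ) + 1) ^ 4) / (k.1 : ℝ) ^ 2) l (𝓝 0) := by
  obtain ⟨C, hC⟩ := h.exists_integral_pow_four_le hf hf4
  set D : ℕ → ℕ → Ω → ℝ := fun n j ω =>
    ∑ i ∈ firstSet n (squarePoint (τ n) j), (f (Z n i ω) - ∫ x, f x ∂F)
  have hs (n j : ℕ) : squarePoint (τ n) j ≤ τ n := min_le_right _ _
  have hint (n j : ℕ) : Integrable (fun ω => D n j ω ^ 4 / ((j : ℝ) + 1) ^ 4) P :=
    (h.integrable_pow_four hf4 _ (hs n j)).div_const _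
  have hle (n j : ℕ) : ∫ ω, D n j ω ^ 4 / ((j : ℝ) + 1) ^ 4 ∂P ≤ |C| := by
    rw [integral_div, div_le_iff₀ (by positivity)]
    calc ∫ ω, D n j ω ^ 4 ∂P ≤ C * (squarePoint (τ n) j : ℝ) ^ 2 := hC n _ (hs n j)
      _ ≤ |C| * (((j : ℝ) + 1) ^ 2) ^ 2 := by
          gcongr
          · exact le_abs_self C
          · exact squarePoint_le_sq _ _
      _ = |C| * ((j : ℝ) + 1) ^ 4 := by ring
  refine hl.tendsto_zero (fun n ω => (∑ j ∈ Finset.range (Nat.sqrt n + 1),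
    D n j ω ^ 4 / ((j : ℝ) + 1) ^ 4) / (n : ℝ) ^ 2)
    (fun n => (integrable_finsetSum _ fun j _ => hint n j).div_const _)
    (fun n ω => by positivity) (.of_nonneg_of_le (fun n => integral_nonneg fun ω => by positivity)
    (fun n => ?_) (summable_sqrt_add_one_div_sq.mul_left |C|))
  rw [integral_div, integral_finsetSum _ fun j _ => hint n j, ← mul_div_assoc]
  gcongr
  refine (Finset.sum_le_sum fun j _ => hle n j).trans_eq ?_
  rw [Finset.sum_const, Finset.card_range, nsmul_eq_mul, mul_comm]
  push_cast
  ring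

lemma eventually_sq_le_squarePoint [IsProbabilityMeasure F] (h : FrontModel P Z τ F)
    (hl : SummableVanish P l) (hf : Measurable f) (hf4 : MemLp f 4 F) {η : ℝ} (hη : 0 < η) :
    ∀ᶠ k : ℕ × Ω in l, ∀ j ≤ Nat.sqrt k.1,
      (∑ i ∈ firstSet k.1 (squarePoint (τ k.1) j), (f (Z k.1 i k.2) - ∫ x, f x ∂F)) ^ 2 ≤
        η * k.1 * ((j : ℝ) + 1) ^ 2 := by
  filter_upwards [(h.tendsto_sum_squarePoint hl hf hf4).eventually_le_const (sq_pos_of_pos hη),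
    hl.fst.eventually_gt_atTop 0] with k hk hk₀ j hj
  have hk₀' : (0 : ℝ) < k.1 := Nat.cast_pos.2 hk₀
  rw [div_le_iff₀ (by positivity)] at hk
  have hle := (Finset.single_le_sum (fun j _ => by positivity)
    (Finset.mem_range_succ_iff.2 hj)).trans hk
  rw [div_le_iff₀ (by positivity)] at hle
  exact le_of_sq_le_sq (by linarith) (by positivity)

end FrontModel

end FrontModel

namespace FrontModel

variable {Ω E : Type*} [MeasurableSpace Ω] [NormedAddCommGroup E] [MeasurableSpace E]
  [BorelSpace E] {P : Measure Ω} [IsProbabilityMeasure P] {Z : (n : ℕ) → Fin n → Ω → E} {τ : ℕ → ℕ}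
  {F : Measure E} [IsProbabilityMeasure F] {l : Filter (ℕ × Ω)}

theorem frontControl_of_memLp (h : FrontModel P Z τ F) (hl : SummableVanish P l)
    (h4 : MemLp (fun x => x) 4 F) :
    FrontControl l Prod.fst (fun k => τ k.1) (fun k i => Z k.1 i k.2) F where
  limit f hf := h.frontLimit_of_memLp hl hf.measurable hf.nonneg (hf.memLp h4)
  small ε hε := by
    set c := ∫ x, ‖x‖ ∂F
    refine ⟨ε / (64 * (c ^ 2 + 1)), by positivity, ?_⟩
    filter_upwards [h.eventually_sq_le_squarePoint hl measurable_norm h4.norm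
      (by positivity : 0 < ε / 16)] with k hk t ht htδ
    have hshort : 64 * c ^ 2 * t ≤ ε * k.1 := by
      rw [div_mul_eq_mul_div, le_div_iff₀ (by positivity)] at htδ
      nlinarith [Nat.cast_nonneg (α := ℝ) t]
    refine (sq_sum_firstSet_le ht (h.change_le k.1) _ (integral_nonneg fun x => norm_nonneg x)
      hk).trans ?_
    nlinarith [Nat.cast_nonneg (α := ℝ) t]

end FrontModel

section Nested

lemma sum_firstSet_eq_sum_range {n t : ℕ} (ht : t ≤ n) (g : ℕ → ℝ) :
    ∑ i ∈ firstSet n t, g i = ∑ i ∈ Finset.range t, g i :=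
  Finset.sum_bij (fun i _ => (i : ℕ)) (fun _ hi => Finset.mem_range.2 (mem_firstSet.1 hi))
    (fun _ _ _ _ hij => Fin.ext hij) (fun i hi => ⟨⟨i, (Finset.mem_range.1 hi).trans_le ht⟩,
      mem_firstSet.2 (Finset.mem_range.1 hi), rfl⟩) fun _ _ => rfl

lemma exists_abs_sum_range_sub_le {a : ℕ → ℝ} {c : ℝ}
    (h : Tendsto (fun n : ℕ => (∑ i ∈ Finset.range n, a i) / n) atTop (𝓝 c)) {ε : ℝ} (hε : 0 < ε) :
    ∃ C, ∀ t : ℕ, |∑ i ∈ Finset.range t, (a i - c)| ≤ ε * t + C := by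
  set S : ℕ → ℝ := fun t => ∑ i ∈ Finset.range t, (a i - c)
  obtain ⟨T, hT⟩ := eventually_atTop.1
    ((Metric.tendsto_nhds.1 h ε hε).and (eventually_gt_atTop 0))
  refine ⟨∑ t ∈ Finset.range T, |S t|, fun t => ?_⟩
  rcases lt_or_ge t T with htT | hTt
  · refine (Finset.single_le_sum (f := fun t => |S t|) (fun _ _ => abs_nonneg _)
      (Finset.mem_range.2 htT)).trans (le_add_of_nonneg_left (by positivity))
  · obtain ⟨hdist, ht⟩ := hT t hTt
    have ht' : (0 : ℝ) < t := Nat.cast_pos.2 ht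
    have hS : S t = ((∑ i ∈ Finset.range t, a i) / t - c) * t := by
      simp only [S, Finset.sum_sub_distrib, Finset.sum_const, Finset.card_range, nsmul_eq_mul]
      field_simp
    rw [Real.dist_eq] at hdist
    calc |S t| = |(∑ i ∈ Finset.range t, a i) / t - c| * t := by rw [hS, abs_mul, abs_of_pos ht']
      _ ≤ ε * t := by gcongr
      _ ≤ ε * t + ∑ t ∈ Finset.range T, |S t| := le_add_of_nonneg_right (by positivity)

lemma exists_sq_sum_range_le {a : ℕ → ℝ} {c : ℝ}
    (h : Tendsto (fun n : ℕ => (∑ i ∈ Finset.range n, a i) / n) atTop (𝓝 c)) :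
    ∃ C, ∀ t : ℕ, (∑ i ∈ Finset.range t, a i) ^ 2 ≤ (2 * (|c| + 1) ^ 2 * t + C) * t := by
  obtain ⟨C, hC⟩ := exists_abs_sum_range_sub_le h one_pos
  refine ⟨2 * C ^ 2, fun t => ?_⟩
  rcases t.eq_zero_or_pos with rfl | ht
  · simp
  have hsum : ∑ i ∈ Finset.range t, a i = ∑ i ∈ Finset.range t, (a i - c) + t * c := by simp
  have habs : |∑ i ∈ Finset.range t, a i| ≤ (|c| + 1) * t + C := by
    rw [hsum]
    refine (abs_add_le _ _).trans ?_
    rw [abs_mul, Nat.abs_cast]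
    linarith [hC t]
  calc (∑ i ∈ Finset.range t, a i) ^ 2 ≤ ((|c| + 1) * t + C) ^ 2 :=
      sq_le_sq' (neg_le_of_abs_le habs) (le_of_abs_le habs)
    _ ≤ 2 * (((|c| + 1) * t) ^ 2 + C ^ 2) := add_sq_le
    _ ≤ 2 * (((|c| + 1) * t) ^ 2 + C ^ 2 * t) := by
        gcongr
        exact le_mul_of_one_le_right (sq_nonneg C) (Nat.one_le_cast.2 ht)
    _ = (2 * (|c| + 1) ^ 2 * t + 2 * C ^ 2) * t := by ring

lemma strong_law_of_hasLaw {Ω E : Type*} [MeasurableSpace Ω] [MeasurableSpace E] {P : Measure Ω}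
    {F : Measure E} {X : ℕ → Ω → E} (hlaw : ∀ i, HasLaw (X i) F P)
    (hind : Pairwise fun i j => IndepFun (X i) (X j) P) {f : E → ℝ} (hf : Measurable f)
    (hint : Integrable f F) : ∀ᵐ ω ∂P,
      Tendsto (fun n : ℕ => (∑ i ∈ Finset.range n, f (X i ω)) / n) atTop (𝓝 (∫ x, f x ∂F)) := by
  rw [← (hlaw 0).map_eq] at hint
  have hlim := strong_law_ae_real (fun i => f ∘ X i) (hint.comp_aemeasurable (hlaw 0).aemeasurable)
    (fun i j hij => (hind hij).comp hf hf) fun i => ((hlaw i).identDistrib (hlaw 0)).comp hf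
  rwa [(hlaw 0).integral_comp hf.aestronglyMeasurable] at hlim

end Nested

namespace FrontModel

variable {Ω E : Type*} [MeasurableSpace Ω] [MeasurableSpace E]
  {P : Measure Ω} {Z : (n : ℕ) → Fin n → Ω → E} {τ : ℕ → ℕ} {F : Measure E}

lemma exists_sequence (h : FrontModel P Z τ F) (hτ : Tendsto τ atTop atTop)
    (hnest : ∀ (m n : ℕ) (i : Fin m) (j : Fin n), (i : ℕ) < τ m → (j : ℕ) < τ n →
      (i : ℕ) = (j : ℕ) → Z m i = Z n j) :
    ∃ X : ℕ → Ω → E, (∀ (n : ℕ) (i : Fin n), (i : ℕ) < τ n → Z n i = X i) ∧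
      (∀ i, HasLaw (X i) F P) ∧ Pairwise fun i j => IndepFun (X i) (X j) P := by
  have hex (b : ℕ) : ∃ n, b < τ n := (hτ.eventually_gt_atTop b).exists
  choose ν hν using hex
  set X : ℕ → Ω → E := fun i => Z (ν i) ⟨i, (hν i).trans_le (h.change_le _)⟩
  have hXZ (n : ℕ) (i : Fin n) (hi : (i : ℕ) < τ n) : Z n i = X i :=
    hnest n (ν i) i ⟨i, _⟩ hi (hν i) rfl
  refine ⟨X, hXZ, fun i => h.law _ _ (hν i), fun i j hij => ?_⟩
  have hi : i < τ (ν (max i j)) := (le_max_left i j).trans_lt (hν _)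
  have hj : j < τ (ν (max i j)) := (le_max_right i j).trans_lt (hν _)
  have hind := (h.indep _).indepFun (i := ⟨i, hi.trans_le (h.change_le _)⟩)
    (j := ⟨j, hj.trans_le (h.change_le _)⟩) (by simpa using hij)
  rwa [hXZ _ ⟨i, _⟩ hi, hXZ _ ⟨j, _⟩ hj] at hind

variable [NormedAddCommGroup E] [BorelSpace E]

theorem frontControl_of_nested [IsProbabilityMeasure F] (h : FrontModel P Z τ F)
    (hτ : Tendsto τ atTop atTop)
    (hnest : ∀ (m n : ℕ) (i : Fin m) (j : Fin n), (i : ℕ) < τ m → (j : ℕ) < τ n →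
      (i : ℕ) = (j : ℕ) → Z m i = Z n j)
    (hF : Integrable (fun x => x) F) :
    FrontControl (aeFilter P) Prod.fst (fun k => τ k.1) (fun k i => Z k.1 i k.2) F := by
  obtain ⟨X, hXZ, hlaw, hind⟩ := h.exists_sequence hτ hnest
  have hsum {f : E → ℝ} {n t : ℕ} (ω : Ω) (ht : t ≤ τ n) :
      ∑ i ∈ firstSet n t, f (Z n i ω) = ∑ i ∈ Finset.range t, f (X i ω) := by
    rw [← sum_firstSet_eq_sum_range (ht.trans (h.change_le n))]
    exact Finset.sum_congr rfl fun i hi => by rw [hXZ n i ((mem_firstSet.1 hi).trans_le ht)]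
  refine ⟨fun f hf ε hε => eventually_aeFilter.2 ?_, fun ε hε => ?_⟩
  · filter_upwards [strong_law_of_hasLaw hlaw hind hf.measurable (hf.integrable hF)] with ω hω
    obtain ⟨C, hC⟩ := exists_abs_sum_range_sub_le hω (half_pos hε)
    filter_upwards [(tendsto_natCast_atTop_atTop.const_mul_atTop (half_pos hε)).eventually_ge_atTop
      C] with n hn t ht
    have htn : (t : ℝ) ≤ n := Nat.cast_le.2 (ht.trans (h.change_le n))
    rw [hsum (f := fun x => f x - ∫ x, f x ∂F) ω ht]
    refine (hC t).trans ?_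
    nlinarith
  · set c := ∫ x, ‖x‖ ∂F
    refine ⟨ε / (4 * (|c| + 1) ^ 2), by positivity, eventually_aeFilter.2 ?_⟩
    filter_upwards [strong_law_of_hasLaw hlaw hind linearGrowth_norm.measurable
      (linearGrowth_norm.integrable hF)] with ω hω
    obtain ⟨C, hC⟩ := exists_sq_sum_range_le hω
    filter_upwards [(tendsto_natCast_atTop_atTop.const_mul_atTop (half_pos hε)).eventually_ge_atTop
      C] with n hn t ht htδ
    have hshort : 4 * (|c| + 1) ^ 2 * t ≤ ε * n := by
      rwa [div_mul_eq_mul_div, le_div_iff₀ (by positivity), mul_comm] at htδ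
    rw [hsum (f := fun x => ‖x‖) ω ht]
    refine (hC t).trans ?_
    rw [mul_left_comm, mul_comm (t : ℝ)]
    gcongr
    linarith

end FrontModel

/-! ### Random permutations of a sample -/

section SamplingWithoutReplacement

variable {β : Type*} [Fintype β] [DecidableEq β]

/-- By exchangeability the sum does not depend on `j ≠ i`, and together with the diagonal term these
sums add up to zero. -/
lemma sum_perm_mul_nonpos {g : β → ℝ} (hg : ∑ b, g b = 0) {i j : β} (hij : j ≠ i) :
    ∑ π : Equiv.Perm β, g (π i) * g (π j) ≤ 0 := by
  set R : β → ℝ := fun j => ∑ π : Equiv.Perm β, g (π i) * g (π j)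
  have hexchange {j' : β} (hj' : j' ≠ i) : R j' = R j := by
    simp only [R]
    rw [← Equiv.sum_comp (Equiv.mulRight (Equiv.swap j j'))]
    refine Finset.sum_congr rfl fun π _ => ?_
    simp [Equiv.swap_apply_of_ne_of_ne hij.symm hj'.symm]
  have htotal : ∑ j, R j = 0 := by
    simp only [R]
    rw [Finset.sum_comm]
    simp_rw [← Finset.mul_sum, Equiv.sum_comp, hg, mul_zero, Finset.sum_const_zero]
  have hdiag : 0 ≤ R i := Finset.sum_nonneg fun π _ => mul_self_nonneg _
  by_contra! hpos
  have hoff : R j ≤ ∑ j' ∈ Finset.univ.erase i, R j' :=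
    Finset.single_le_sum (f := R)
      (fun j' hj' => (hpos.trans_eq (hexchange (Finset.ne_of_mem_erase hj')).symm).le)
      (by simp [hij])
  rw [← Finset.add_sum_erase _ _ (Finset.mem_univ i)] at htotal
  linarith

lemma sum_perm_sq_sum_le {g : β → ℝ} (hg : ∑ b, g b = 0) (I : Finset β) :
    ∑ π : Equiv.Perm β, (∑ i ∈ I, g (π i)) ^ 2 ≤
      Fintype.card (Equiv.Perm β) * ∑ b, g b ^ 2 := by
  calc ∑ π : Equiv.Perm β, (∑ i ∈ I, g (π i)) ^ 2
      = ∑ i ∈ I, ∑ j ∈ I, ∑ π : Equiv.Perm β, g (π i) * g (π j) := by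
        simp_rw [sq, Finset.sum_mul_sum]
        rw [Finset.sum_comm]
        exact Finset.sum_congr rfl fun i _ => Finset.sum_comm
    _ ≤ ∑ i ∈ I, ∑ π : Equiv.Perm β, g (π i) * g (π i) := by
        refine Finset.sum_le_sum fun i hi => ?_
        rw [← Finset.add_sum_erase _ _ hi]
        exact add_le_of_nonpos_right (Finset.sum_nonpos fun j hj =>
          sum_perm_mul_nonpos hg (Finset.ne_of_mem_erase hj))
    _ ≤ ∑ i, ∑ π : Equiv.Perm β, g (π i) * g (π i) :=
        Finset.sum_le_univ_sum_of_nonneg fun i => Finset.sum_nonneg fun π _ => mul_self_nonneg _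
    _ = ∑ π : Equiv.Perm β, ∑ b, g b ^ 2 := by
        rw [Finset.sum_comm]
        refine Finset.sum_congr rfl fun π _ => ?_
        simp_rw [← sq]
        exact Equiv.sum_comp π fun b => g b ^ 2
    _ = Fintype.card (Equiv.Perm β) * ∑ b, g b ^ 2 := by
        rw [Finset.sum_const, Finset.card_univ, nsmul_eq_mul]

lemma sum_perm_sq_sum_sub_mean_le (g : β → ℝ) (I : Finset β) :
    ∑ π : Equiv.Perm β, (∑ i ∈ I, (g (π i) - (Fintype.card β : ℝ)⁻¹ * ∑ b, g b)) ^ 2 ≤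
      Fintype.card (Equiv.Perm β) * ∑ b, g b ^ 2 := by
  set m := (Fintype.card β : ℝ)⁻¹ * ∑ b, g b
  have hcentred : ∑ b, (g b - m) = 0 := by
    rcases isEmpty_or_nonempty β with _ | _
    · exact Fintype.sum_empty _
    · rw [Finset.sum_sub_distrib, Finset.sum_const, Finset.card_univ, nsmul_eq_mul,
        mul_inv_cancel_left₀ (Nat.cast_ne_zero.2 Fintype.card_ne_zero), sub_self]
  refine (sum_perm_sq_sum_le hcentred I).trans
    (mul_le_mul_of_nonneg_left ?_ (Nat.cast_nonneg _))
  calc ∑ b, (g b - m) ^ 2 = ∑ b, g b ^ 2 - 2 * m * ∑ b, (g b - m) - ∑ _b : β, m ^ 2 := by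
        rw [Finset.mul_sum, ← Finset.sum_sub_distrib, ← Finset.sum_sub_distrib]
        exact Finset.sum_congr rfl fun b _ => by ring
    _ ≤ ∑ b, g b ^ 2 := by
        rw [hcentred, mul_zero, sub_zero]
        exact sub_le_self _ (Finset.sum_nonneg fun _ _ => sq_nonneg m)

end SamplingWithoutReplacement

section Proportion

/-- The probability of `S` under the uniform distribution. -/
noncomputable def proportion {α : Type*} (S : Set α) : ℝ := S.ncard / Nat.card α

variable {α : Type*} {S T : Set α}

lemma proportion_nonneg (S : Set α) : 0 ≤ proportion S := by
  unfold proportion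
  positivity

lemma proportion_empty : proportion (∅ : Set α) = 0 := by
  rw [proportion, Set.ncard_empty, Nat.cast_zero, zero_div]

lemma proportion_union_le (S T : Set α) : proportion (S ∪ T) ≤ proportion S + proportion T := by
  unfold proportion
  rw [← add_div]
  gcongr
  exact_mod_cast Set.ncard_union_le S T

lemma proportion_mono [Finite α] (h : S ⊆ T) : proportion S ≤ proportion T := by
  unfold proportion
  gcongr
  exact Set.toFinite T

lemma proportion_compl [Finite α] [Nonempty α] (S : Set α) :
    proportion Sᶜ = 1 - proportion S := by
  have hcard : (Nat.card α : ℝ) ≠ 0 := Nat.cast_ne_zero.2 Nat.card_pos.ne'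
  rw [eq_sub_iff_add_eq', proportion, proportion, ← add_div, div_eq_one_iff_eq hcard]
  exact_mod_cast Set.ncard_add_ncard_compl S

lemma proportion_le_of_sum_sq_le [Fintype α] [Nonempty α] {A : α → ℝ} {V η : ℝ} (hη : 0 < η)
    (hA : ∑ a, A a ^ 2 ≤ Fintype.card α * V) : proportion {a | η ≤ |A a|} ≤ V / η ^ 2 := by
  classical
  rw [proportion, Nat.card_eq_fintype_card, div_le_div_iff₀ (by positivity) (by positivity),
    mul_comm V, Set.ncard_eq_toFinset_card', Set.toFinset_ofPred, ← nsmul_eq_mul]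
  refine (Finset.card_nsmul_le_sum _ (fun a => A a ^ 2) _ fun a ha => ?_).trans
    ((Finset.sum_le_univ_sum_of_nonneg fun a => sq_nonneg (A a)).trans hA)
  rw [← sq_abs (A a)]
  exact pow_le_pow_left₀ hη.le (by simpa using ha) 2

variable {κ : Type*} {α : κ → Type*} [∀ k, Finite (α k)] {L : Filter κ}

/-- Sets that contain `(k, a)` for a proportion of the points `a` that tends to one along `L`:
convergence along this filter is convergence in probability for a uniformly chosen `a`. -/
def proportionFilter (L : Filter κ) (α : κ → Type*) [∀ k, Finite (α k)] : Filter (Σ k, α k) :=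
  Filter.comk (fun B => Tendsto (fun k => proportion (Sigma.mk k ⁻¹' B)) L (𝓝 0))
    (by simpa only [Set.preimage_empty, proportion_empty] using tendsto_const_nhds)
    (fun B hB C hCB => squeeze_zero (fun _ => proportion_nonneg _)
      (fun _ => proportion_mono (Set.preimage_mono hCB)) hB)
    (fun B hB C hC => squeeze_zero (fun _ => proportion_nonneg _)
      (fun _ => proportion_union_le _ _) (add_zero (0 : ℝ) ▸ hB.add hC))

lemma eventually_proportionFilter {p : (Σ k, α k) → Prop} :
    (∀ᶠ q in proportionFilter L α, p q) ↔
      Tendsto (fun k => proportion {a | ¬ p ⟨k, a⟩}) L (𝓝 0) := Iff.rfl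

lemma tendsto_fst_proportionFilter : Tendsto Sigma.fst (proportionFilter L α) L := by
  refine fun s hs => eventually_proportionFilter.2 (tendsto_const_nhds.congr' ?_)
  filter_upwards [hs] with k hk
  have hempty : {_a : α k | ¬ k ∈ s} = ∅ := Set.eq_empty_of_forall_notMem fun _ ha => ha hk
  rw [hempty, proportion_empty]

lemma tendsto_proportionFilter_zero [∀ k, Fintype (α k)] [∀ k, Nonempty (α k)]
    {A : (Σ k, α k) → ℝ} {V : κ → ℝ} (hV : Tendsto V L (𝓝 0))
    (hA : ∀ k, ∑ a, A ⟨k, a⟩ ^ 2 ≤ Fintype.card (α k) * V k) :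
    Tendsto A (proportionFilter L α) (𝓝 0) := by
  refine Metric.tendsto_nhds.2 fun η hη => eventually_proportionFilter.2 ?_
  simp only [dist_zero_right, Real.norm_eq_abs, not_lt]
  exact squeeze_zero (fun _ => proportion_nonneg _)
    (fun k => proportion_le_of_sum_sq_le hη (hA k)) (by simpa using hV.div_const (η ^ 2))

end Proportion

section PermutedSamples

variable {κ E : Type*} {L : Filter κ} {N : κ → ℕ} {z : (k : κ) → Fin (N k) → E} {f : E → ℝ} {c : ℝ}

/-- The averages of `f` over the samples `z k` tend to `c`, and its sums of squares are negligible
against the square of the sample size. No order of the observations enters. -/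
structure MeanLimit (L : Filter κ) (N : κ → ℕ) (z : (k : κ) → Fin (N k) → E) (f : E → ℝ) (c : ℝ) :
    Prop where
  mean : Tendsto (fun k => (N k : ℝ)⁻¹ * ∑ j, f (z k j)) L (𝓝 c)
  sum_sq : Tendsto (fun k => (N k : ℝ)⁻¹ ^ 2 * ∑ j, f (z k j) ^ 2) L (𝓝 0)

lemma MeanLimit.frontLimit_perm (h : MeanLimit L N z f c) (hf : ∀ x, 0 ≤ f x)
    (hN : Tendsto N L atTop) :
    FrontLimit (proportionFilter L fun k => Equiv.Perm (Fin (N k))) (fun q => N q.1)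
      (fun q => N q.1) (fun q i => z q.1 (q.2 i)) f c := by
  refine frontLimit_of_gridPoint hf (hN.comp tendsto_fst_proportionFilter) (fun _ => le_rfl)
    fun K j => ?_
  set s : κ → ℕ := fun k => gridPoint (N k) (N k) K j
  have hs (k : κ) : s k ≤ N k := min_le_right _ _
  set m : κ → ℝ := fun k => (N k : ℝ)⁻¹ * ∑ j, f (z k j)
  have hsampling : Tendsto (fun q : Σ k, Equiv.Perm (Fin (N k)) =>
      (N q.1 : ℝ)⁻¹ * ∑ i ∈ firstSet (N q.1) (s q.1), (f (z q.1 (q.2 i)) - m q.1))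
      (proportionFilter L fun k => Equiv.Perm (Fin (N k))) (𝓝 0) := by
    refine tendsto_proportionFilter_zero h.sum_sq fun k => ?_
    have hsum := sum_perm_sq_sum_sub_mean_le (fun j => f (z k j)) (firstSet (N k) (s k))
    rw [Fintype.card_fin] at hsum
    simp only [mul_pow, ← Finset.mul_sum]
    rw [mul_left_comm]
    gcongr
  have hmean : Tendsto (fun k => (s k : ℝ) / N k * (m k - c)) L (𝓝 0) := by
    refine squeeze_zero_norm (fun k => ?_)
      (tendsto_zero_iff_norm_tendsto_zero.1 (tendsto_sub_nhds_zero_iff.2 h.mean))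
    rw [norm_mul, Real.norm_of_nonneg (by positivity)]
    exact mul_le_of_le_one_left (norm_nonneg _)
      (div_le_one_of_le₀ (Nat.cast_le.2 (hs k)) (Nat.cast_nonneg _))
  have hsum := hsampling.add (hmean.comp tendsto_fst_proportionFilter)
  rw [zero_add] at hsum
  refine hsum.congr fun q => ?_
  simp only [Function.comp_apply]
  rw [sum_firstSet_sub_const (hs q.1), sum_firstSet_sub_const (hs q.1)]
  ring

end PermutedSamples

section FullSegments

variable {ι E : Type*} {l : Filter ι} {N τ τ' : ι → ℕ} {z : (k : ι) → Fin (N k) → E} {f : E → ℝ}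
  {c : ℝ}

lemma FrontLimit.anti (h : FrontLimit l N τ z f c) (hτ : ∀ k, τ' k ≤ τ k) :
    FrontLimit l N τ' z f c :=
  fun ε hε => (h ε hε).mono fun k hk t ht => hk t (ht.trans (hτ k))

lemma FrontLimit.rev (h : FrontLimit l N N z f c) :
    FrontLimit l N N (fun k i => z k i.rev) f c := by
  intro ε hε
  filter_upwards [h (ε / 2) (half_pos hε)] with k hk t ht
  set g : Fin (N k) → ℝ := fun i => f (z k i) - c
  have hsplit := sum_firstSet_add_sum_lastSet (N k - t) g
  have hall : ∑ i ∈ firstSet (N k) (N k), g i = ∑ i, g i := by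
    simp only [firstSet, Fin.is_lt, Finset.filter_true]
  have hrev : ∑ i ∈ firstSet (N k) t, g i.rev = ∑ i ∈ lastSet (N k) (N k - t), g i := by
    rw [← sum_firstSet_rev (Nat.sub_le _ _), Nat.sub_sub_self ht]
  calc |∑ i ∈ firstSet (N k) t, g i.rev|
      = |∑ i ∈ firstSet (N k) (N k), g i - ∑ i ∈ firstSet (N k) (N k - t), g i| := by
        rw [hrev, hall, ← hsplit, add_sub_cancel_left]
    _ ≤ ε / 2 * N k + ε / 2 * N k :=
        (abs_sub _ _).trans (add_le_add (hk _ le_rfl) (hk _ (Nat.sub_le _ _)))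
    _ = ε * N k := by ring

variable [NormedAddCommGroup E] [MeasurableSpace E] {F : Measure E}

/-- By the Cauchy–Schwarz inequality the squared sum of `t` norms is at most `t` times the sum of
their squares. -/
lemma frontControl_of_frontLimit_sq (hτ : ∀ k, τ k ≤ N k)
    (hlimit : ∀ f, LinearGrowth f → FrontLimit l N τ z f (∫ x, f x ∂F))
    (hsq : FrontLimit l N τ z (fun x => ‖x‖ ^ 2) c) : FrontControl l N τ z F where
  limit := hlimit
  small ε hε := by
    refine ⟨ε / (2 * (|c| + 1)), by positivity, ?_⟩
    filter_upwards [hsq (ε / 2) (half_pos hε)] with k hk t ht htδ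
    have hsum := hk t ht
    rw [sum_firstSet_sub_const (ht.trans (hτ k)) (z k) (fun x => ‖x‖ ^ 2)] at hsum
    have htc : (t : ℝ) * c ≤ ε / 2 * N k := by
      calc (t : ℝ) * c ≤ t * (|c| + 1) := by
            gcongr
            linarith [le_abs_self c]
        _ ≤ ε / (2 * (|c| + 1)) * N k * (|c| + 1) := by gcongr
        _ = ε / 2 * N k := by field_simp
    calc (∑ i ∈ firstSet (N k) t, ‖z k i‖) ^ 2
        ≤ t * ∑ i ∈ firstSet (N k) t, ‖z k i‖ ^ 2 := by
          have hsq := sq_sum_le_card_mul_sum_sq (s := firstSet (N k) t) (f := fun i => ‖z k i‖)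
          rwa [card_firstSet (ht.trans (hτ k))] at hsq
      _ ≤ t * (ε * N k) := by
          gcongr
          linarith [le_of_abs_le hsum]
      _ = ε * (t * N k) := by ring

lemma twoSidedControl_perm {κ : Type*} {L : Filter κ} {N τ : κ → ℕ}
    {z : (k : κ) → Fin (N k) → E} {θ : ℝ} (hN : Tendsto N L atTop) (hτ : ∀ k, τ k ≤ N k)
    (hθ : Tendsto (fun k => (τ k : ℝ) / N k) L (𝓝 θ)) (hθ₀ : 0 < θ) (hθ₁ : θ < 1)
    (hF : Integrable (fun x => x) F)
    (hmean : ∀ f, LinearGrowth f → MeanLimit L N z f (∫ x, f x ∂F))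
    (hsq : MeanLimit L N z (fun x => ‖x‖ ^ 2) c) :
    TwoSidedControl (proportionFilter L fun k => Equiv.Perm (Fin (N k))) (fun q => N q.1)
      (fun q => τ q.1) (fun q i => z q.1 (q.2 i)) F F θ :=
  have hlimit f (hf : LinearGrowth f) := (hmean f hf).frontLimit_perm hf.nonneg hN
  have hlimit_sq := hsq.frontLimit_perm (fun _ => sq_nonneg _) hN
  { size := hN.comp tendsto_fst_proportionFilter
    change_le := fun q => hτ q.1
    change := hθ.comp tendsto_fst_proportionFilter
    pos := hθ₀
    lt_one := hθ₁
    integrable_left := hF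
    integrable_right := hF
    front := frontControl_of_frontLimit_sq (fun q => hτ q.1)
      (fun f hf => (hlimit f hf).anti fun q => hτ q.1) (hlimit_sq.anti fun q => hτ q.1)
    back := frontControl_of_frontLimit_sq (fun _ => Nat.sub_le _ _)
      (fun f hf => (hlimit f hf).rev.anti fun _ => Nat.sub_le _ _)
      (hlimit_sq.rev.anti fun _ => Nat.sub_le _ _) }

end FullSegments

section SampleMean

lemma tendsto_inv_sq_mul {τ : ℕ → ℕ} (hτ : ∀ n, τ n ≤ n) (C : ℝ) :
    Tendsto (fun n : ℕ => (n : ℝ)⁻¹ ^ 2 * (τ n * C)) atTop (𝓝 0) := by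
  have hbound : Tendsto (fun n : ℕ => (n : ℝ)⁻¹ * |C|) atTop (𝓝 0) := by
    simpa using tendsto_inv_atTop_nhds_zero_nat.mul_const |C|
  refine squeeze_zero_norm (fun n => ?_) hbound
  calc ‖(n : ℝ)⁻¹ ^ 2 * (τ n * C)‖ = (n : ℝ)⁻¹ * ((n : ℝ)⁻¹ * τ n) * |C| := by
        simp only [norm_mul, norm_pow, norm_inv, RCLike.norm_natCast, Real.norm_eq_abs]
        ring
    _ ≤ (n : ℝ)⁻¹ * 1 * |C| := by
        gcongr
        exact inv_mul_le_one_of_le₀ (Nat.cast_le.2 (hτ n)) (Nat.cast_nonneg _)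
    _ = (n : ℝ)⁻¹ * |C| := by rw [mul_one]

variable {Ω E : Type*} [MeasurableSpace Ω] [MeasurableSpace E] {P : Measure Ω}
  [IsProbabilityMeasure P] {Z : (n : ℕ) → Fin n → Ω → E} {τ : ℕ → ℕ} {F G : Measure E}
  {f : E → ℝ} {θ : ℝ}

namespace FrontModel

lemma tendsto_sum_sq (h : FrontModel P Z τ F) (hf : Measurable f) (hf2 : MemLp f 2 F) :
    Tendsto (fun k : ℕ × Ω => (k.1 : ℝ)⁻¹ ^ 2 * ∑ i ∈ firstSet k.1 (τ k.1), f (Z k.1 i k.2) ^ 2)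
      (probFilter P) (𝓝 0) := by
  have hint (n : ℕ) (i : Fin n) (hi : i ∈ firstSet n (τ n)) :
      Integrable (fun ω => f (Z n i ω) ^ 2) P := (h.memLp_comp hf2 le_rfl hi).integrable_sq
  refine tendsto_probFilter_zero
    (W := fun n ω => (n : ℝ)⁻¹ ^ 2 * ∑ i ∈ firstSet n (τ n), f (Z n i ω) ^ 2)
    (.of_forall fun n => (integrable_finsetSum _ (hint n)).const_mul _)
    (fun n ω => by positivity)
    ((tendsto_inv_sq_mul h.change_le (∫ x, f x ^ 2 ∂F)).congr fun n => ?_)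
  rw [integral_const_mul, integral_finsetSum _ (hint n),
    Finset.sum_congr rfl fun i hi => h.integral_comp (hf.pow_const 2) le_rfl hi, Finset.sum_const,
    card_firstSet (h.change_le n), nsmul_eq_mul]

variable [IsProbabilityMeasure F]

lemma integral_sq_sum_sub (h : FrontModel P Z τ F) (hf : Measurable f) (hf2 : MemLp f 2 F) (n : ℕ) :
    ∫ ω, (∑ i ∈ firstSet n (τ n), (f (Z n i ω) - ∫ x, f x ∂F)) ^ 2 ∂P =
      τ n * ∫ x, (f x - ∫ y, f y ∂F) ^ 2 ∂F := by
  set g : E → ℝ := fun x => f x - ∫ x, f x ∂F with hg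
  have hgm : Measurable g := hf.sub_const _
  have hg2 : MemLp g 2 F := hf2.sub (memLp_const _)
  have hg₀ : ∫ x, g x ∂F = 0 := by
    rw [hg, integral_sub (hf2.integrable one_le_two) (integrable_const _)]
    simp
  have hvariance := integral_sum_sq (s := firstSet n (τ n))
    ((h.indep n).comp (fun _ => g) fun _ => hgm)
    (fun i => hgm.comp_aemeasurable (h.aemeasurable n i))
    (fun i hi => h.memLp_comp hg2 le_rfl hi)
    (fun i hi => (h.integral_comp hgm le_rfl hi).trans hg₀)
    (fun i hi => h.integral_comp (hgm.pow_const 2) le_rfl hi)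
  rwa [card_firstSet (h.change_le n)] at hvariance

lemma tendsto_mean_sub (h : FrontModel P Z τ F) (hf : Measurable f) (hf2 : MemLp f 2 F) :
    Tendsto (fun k : ℕ × Ω =>
        (k.1 : ℝ)⁻¹ * ∑ i ∈ firstSet k.1 (τ k.1), (f (Z k.1 i k.2) - ∫ x, f x ∂F))
      (probFilter P) (𝓝 0) := by
  have hint (n : ℕ) : MemLp (fun ω => (n : ℝ)⁻¹ *
      ∑ i ∈ firstSet n (τ n), (f (Z n i ω) - ∫ x, f x ∂F)) 2 P :=
    (memLp_finsetSum _ fun i hi => h.memLp_comp (f := fun x => f x - ∫ x, f x ∂F)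
      (hf2.sub (memLp_const _)) le_rfl hi).const_mul _
  refine tendsto_zero_of_tendsto_pow (p := 2) (tendsto_probFilter_zero
    (W := fun n ω => ((n : ℝ)⁻¹ * ∑ i ∈ firstSet n (τ n), (f (Z n i ω) - ∫ x, f x ∂F)) ^ 2)
    (.of_forall fun n => (hint n).integrable_sq) (fun n ω => sq_nonneg _)
    ((tendsto_inv_sq_mul h.change_le (∫ x, (f x - ∫ y, f y ∂F) ^ 2 ∂F)).congr fun n => ?_))
  simp_rw [mul_pow]
  rw [integral_const_mul, h.integral_sq_sum_sub hf hf2]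

end FrontModel

variable [IsProbabilityMeasure F] [IsProbabilityMeasure G]

lemma meanLimit_probFilter (hF : FrontModel P Z τ F)
    (hG : FrontModel P (fun n i => Z n i.rev) (fun n => n - τ n) G)
    (hτ : Tendsto (fun n => (τ n : ℝ) / n) atTop (𝓝 θ)) (hθ₀ : 0 ≤ θ) (hθ₁ : θ ≤ 1)
    (hf : Measurable f) (hfF : MemLp f 2 F) (hfG : MemLp f 2 G) :
    MeanLimit (probFilter P) Prod.fst (fun k i => Z k.1 i k.2) f
      (∫ x, f x ∂mix F G θ (1 - θ)) := by
  have hsplit (n : ℕ) (g : Fin n → ℝ) : ∑ i, g i =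
      ∑ i ∈ firstSet n (τ n), g i + ∑ i ∈ firstSet n (n - τ n), g i.rev := by
    rw [sum_firstSet_rev (hF.change_le n), sum_firstSet_add_sum_lastSet]
  have hsize := tendsto_fst_probFilter P
  have hfront := (hτ.comp hsize).mul_const (∫ x, f x ∂F)
  have hback := ((tendsto_sub_div tendsto_id (.of_forall hF.change_le) hτ).comp hsize).mul_const
    (∫ x, f x ∂G)
  refine ⟨?_, ?_⟩
  · rw [integral_mix (hfF.integrable one_le_two) (hfG.integrable one_le_two) hθ₀
      (sub_nonneg.2 hθ₁)]
    have hsum := ((hF.tendsto_mean_sub hf hfF).add hfront).add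
      ((hG.tendsto_mean_sub hf hfG).add hback)
    rw [zero_add, zero_add] at hsum
    refine hsum.congr fun k => ?_
    rw [hsplit, sum_firstSet_sub_const (hF.change_le k.1) (fun i => Z k.1 i k.2),
      sum_firstSet_sub_const (hG.change_le k.1) (fun i => Z k.1 i.rev k.2)]
    simp only [Function.comp_apply, id_eq]
    ring
  · have hsum := (hF.tendsto_sum_sq hf hfF).add (hG.tendsto_sum_sq hf hfG)
    rw [zero_add] at hsum
    refine hsum.congr fun k => ?_
    rw [hsplit, mul_add]

end SampleMean

/-! ### The test statistic and its permutation cut-off -/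

section SearchRange

variable {d n t : ℕ} {δ : ℝ} {z : Fin n → Vec d}

lemma two_le_of_mem_searchRange (hδ : 2 ≤ n * δ) (ht : t ∈ searchRange n δ) :
    2 ≤ t ∧ t + 2 ≤ n := by
  obtain ⟨hlower, hupper⟩ := Finset.mem_Icc.1 ht
  have ht₂ : 2 ≤ t := (Nat.le_floor (by exact_mod_cast hδ)).trans hlower
  have hlt : ((t - 1 : ℕ) : ℝ) < n * (1 - δ) := Nat.lt_ceil.1 (by omega)
  refine ⟨ht₂, ?_⟩
  rw [Nat.cast_sub (by omega)] at hlt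
  have hlt' : (t : ℝ) + 1 < n := by push_cast at hlt; linarith
  exact_mod_cast hlt'

lemma eventually_mem_searchRange {τ : ℕ → ℕ} {δ : ℕ → ℝ} {θ : ℝ}
    (hτ : Tendsto (fun n => (τ n : ℝ) / n) atTop (𝓝 θ)) (hθ₀ : 0 < θ) (hθ₁ : θ < 1)
    (hδ : Tendsto δ atTop (𝓝 0)) : ∀ᶠ n in atTop, τ n ∈ searchRange n (δ n) := by
  filter_upwards [hδ.eventually_lt hτ hθ₀,
    hτ.eventually_lt (hδ.const_sub 1) (by rwa [sub_zero]), eventually_gt_atTop 0]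
    with n hlower hupper hn
  have hn' : (0 : ℝ) < n := Nat.cast_pos.2 hn
  rw [lt_div_iff₀' hn'] at hlower
  rw [div_lt_iff₀' hn'] at hupper
  exact Finset.mem_Icc.2 ⟨Nat.floor_le_of_le hlower.le,
    Nat.cast_le.1 (hupper.le.trans (Nat.le_ceil _))⟩

lemma criterion_le_testStatistic (z : Fin n → Vec d) (ht : t ∈ searchRange n δ) :
    criterion z t ≤ testStatistic δ z :=
  le_ciSup (f := fun t : {t : ℕ // t ∈ searchRange n δ} => criterion z t)
    (Set.finite_range _).bddAbove ⟨t, ht⟩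

lemma exists_testStatistic_le (z : Fin n → Vec d) (h : (searchRange n δ).Nonempty) :
    ∃ t ∈ searchRange n δ, testStatistic δ z ≤ criterion z t := by
  obtain ⟨t, ht, hmax⟩ := Finset.exists_max_image _ (criterion z) h
  have : Nonempty {t : ℕ // t ∈ searchRange n δ} := ⟨⟨t, ht⟩⟩
  exact ⟨t, ht, ciSup_le fun s => hmax s s.2⟩

lemma permutationCutoff_le {α x : ℝ} (hx : 0 ≤ x)
    (h : proportion {π : Equiv.Perm (Fin n) | ¬ testStatistic δ (fun i => z (π i)) ≤ x} ≤ α) :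
    permutationCutoff δ α z ≤ x := by
  classical
  refine csInf_le ⟨0, fun y hy => hy.1⟩ ⟨hx, ?_⟩
  set S : Set (Equiv.Perm (Fin n)) := {π | testStatistic δ (fun i => z (π i)) ≤ x}
  have hS : 1 - α ≤ proportion S := by
    have hcompl : proportion Sᶜ ≤ α := h
    rw [proportion_compl] at hcompl
    linarith
  rwa [proportion, Set.ncard_eq_toFinset_card', Set.toFinset_ofPred, Nat.card_eq_fintype_card,
    Fintype.card_perm, Fintype.card_fin] at hS

end SearchRange

namespace TwoSidedControl

variable {ι : Type*} {l : Filter ι} {d : ℕ} {N τ : ι → ℕ} {z : (k : ι) → Fin (N k) → Vec d}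
  {F G : Measure (Vec d)} [IsFiniteMeasure F] {δ : ι → ℝ} {θ x : ℝ}

lemma eventually_testStatistic_le_of_same (h : TwoSidedControl l N τ z F F θ)
    (hδ : ∀ᶠ k in l, 2 ≤ N k * δ k) (hne : ∀ᶠ k in l, (searchRange (N k) (δ k)).Nonempty)
    (hx : 0 < x) : ∀ᶠ k in l, testStatistic (δ k) (z k) ≤ x := by
  obtain ⟨t, ht⟩ := Filter.skolem.1 (hne.mono fun k hk => exists_testStatistic_le (z k) hk)
  have hmargin : ∀ᶠ k in l, 2 ≤ t k ∧ t k + 2 ≤ N k := by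
    filter_upwards [hδ, ht] with k hδ ht using two_le_of_mem_searchRange hδ ht.1
  filter_upwards [(h.tendsto_criterion_of_same hmargin).eventually_le_const hx, ht]
    with k hcriterion ht using ht.2.trans hcriterion

lemma eventually_lt_testStatistic [IsProbabilityMeasure G] (h : TwoSidedControl l N τ z F G θ)
    (hτ : ∀ᶠ k in l, τ k ∈ searchRange (N k) (δ k))
    (hx : x < θ * (1 - θ) * limitDivergence F G) :
    ∀ᶠ k in l, x < testStatistic (δ k) (z k) := by
  have hlim := h.tendsto_criterion h.eventually_change ⟨h.pos.le, h.lt_one.le⟩ h.change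
  rw [profile_self_eq h.integrable_left h.integrable_right h.pos.le h.lt_one] at hlim
  filter_upwards [hlim.eventually_const_lt hx, hτ] with k hk hτ
  exact hk.trans_le (criterion_le_testStatistic (z k) hτ)

lemma eventually_permutationCutoff_le {α : ℝ}
    (h : TwoSidedControl (proportionFilter l fun k => Equiv.Perm (Fin (N k))) (fun q => N q.1)
      (fun q => τ q.1) (fun q i => z q.1 (q.2 i)) F F θ)
    (hδ : ∀ᶠ k in l, 2 ≤ N k * δ k) (hne : ∀ᶠ k in l, (searchRange (N k) (δ k)).Nonempty)
    (hα : 0 < α) (hx : 0 < x) : ∀ᶠ k in l, permutationCutoff (δ k) α (z k) ≤ x := by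
  have hfst : Tendsto Sigma.fst (proportionFilter l fun k => Equiv.Perm (Fin (N k))) l :=
    tendsto_fst_proportionFilter
  have hδ' := hfst.eventually hδ
  have hne' := hfst.eventually hne
  have hsmall := eventually_testStatistic_le_of_same (δ := fun q => δ q.1)
    (N := fun q : Σ k, Equiv.Perm (Fin (N k)) => N q.1) h hδ' hne' hx
  filter_upwards [(eventually_proportionFilter.1 hsmall).eventually_le_const hα] with k hk
  exact permutationCutoff_le hx.le hk

end TwoSidedControl

/-! ### Consistency -/

lemma IsSubExponential.memLp {d : ℕ} {F : Measure (Vec d)} [IsFiniteMeasure F]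
    (h : IsSubExponential F) (p : NNReal) : MemLp (fun x => x) p F := by
  obtain ⟨K, hK, hexp⟩ := h
  refine memLp_piLp_iff.2 fun i => memLp_of_mem_interior_integrableExpSet ?_ p
  have hint : Integrable (fun x : Vec d => Real.exp (|x i| / K)) F := by
    refine ⟨by fun_prop, ?_⟩
    rw [hasFiniteIntegral_iff_ofReal (ae_of_all _ fun x => (Real.exp_pos _).le)]
    have hi := hexp (EuclideanSpace.single i 1) (by simp)
    simp only [EuclideanSpace.inner_single_left, map_one, one_mul] at hi
    exact hi.trans_lt ENNReal.ofNat_lt_top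
  refine mem_interior_iff_mem_nhds.2 (Filter.mem_of_superset
    (Icc_mem_nhds (neg_lt_zero.2 (inv_pos.2 hK)) (inv_pos.2 hK)) fun s hs => ?_)
  refine hint.mono' (by fun_prop) (ae_of_all _ fun x => ?_)
  rw [Real.norm_of_nonneg (Real.exp_pos _).le, Real.exp_le_exp, div_eq_inv_mul]
  calc s * x i ≤ |s| * |x i| := (le_abs_self _).trans_eq (abs_mul _ _)
    _ ≤ K⁻¹ * |x i| := by gcongr; exact abs_le.2 hs

lemma tendsto_measure_one_of_eventually {Ω : Type*} [MeasurableSpace Ω] {P : Measure Ω}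
    [IsProbabilityMeasure P] {p : ℕ × Ω → Prop} (h : ∀ᶠ k in probFilter P, p k) :
    Tendsto (fun n => P {ω | p (n, ω)}) atTop (𝓝 1) := by
  have hlower : Tendsto (fun n => 1 - P {ω | ¬ p (n, ω)}) atTop (𝓝 1) := by
    simpa using ENNReal.Tendsto.sub tendsto_const_nhds (eventually_probFilter.1 h)
      (.inl ENNReal.one_ne_top)
  refine tendsto_of_tendsto_of_tendsto_of_le_of_le hlower tendsto_const_nhds (fun n => ?_)
    fun n => prob_le_one
  rw [tsub_le_iff_right, ← measure_univ (μ := P)]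
  exact (measure_mono fun ω _ => em _).trans (measure_union_le _ _)

namespace IsSingleChangeModel

variable {Ω : Type*} [MeasurableSpace Ω] {P : Measure Ω} {d : ℕ} {F₁ F₂ : Measure (Vec d)}
  {τ : ℕ → ℕ} {Z : (n : ℕ) → Fin n → Ω → Vec d} {θ : ℝ}

lemma aemeasurable (h : IsSingleChangeModel P Z τ F₁ F₂) (n : ℕ) (i : Fin n) :
    AEMeasurable (Z n i) P := by
  rcases lt_or_ge (i : ℕ) (τ n) with hi | hi
  · exact (h.law_before n i hi).aemeasurable
  · exact (h.law_after n i hi).aemeasurable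

lemma frontModel (h : IsSingleChangeModel P Z τ F₁ F₂) (hτ : ∀ n, τ n ≤ n) :
    FrontModel P Z τ F₁ :=
  ⟨h.indep, h.aemeasurable, hτ, h.law_before⟩

lemma backModel (h : IsSingleChangeModel P Z τ F₁ F₂) :
    FrontModel P (fun n i => Z n i.rev) (fun n => n - τ n) F₂ :=
  ⟨fun n => (h.indep n).precomp Fin.rev_injective, fun n i => h.aemeasurable n i.rev,
    fun n => Nat.sub_le n (τ n), fun n i hi => h.law_after n i.rev (by rw [Fin.val_rev]; omega)⟩

variable [IsProbabilityMeasure F₁] [IsProbabilityMeasure F₂]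

lemma twoSidedControl_of_nested (h : IsSingleChangeModel P Z τ F₁ F₂) (hnest : IsNested Z τ)
    (hτ : ∀ n, τ n ≤ n) (hθ : Tendsto (fun n => (τ n : ℝ) / n) atTop (𝓝 θ)) (hθ₀ : 0 < θ)
    (hθ₁ : θ < 1) (h₁ : Integrable (fun x => x) F₁) (h₂ : Integrable (fun x => x) F₂) :
    TwoSidedControl (aeFilter P) Prod.fst (fun k => τ k.1) (fun k i => Z k.1 i k.2) F₁ F₂ θ where
  size := tendsto_fst_aeFilter P
  change_le k := hτ k.1
  change := hθ.comp (tendsto_fst_aeFilter P)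
  pos := hθ₀
  lt_one := hθ₁
  integrable_left := h₁
  integrable_right := h₂
  front := (h.frontModel hτ).frontControl_of_nested
    (tendsto_atTop_of_tendsto_div tendsto_id hθ hθ₀) hnest.1 h₁
  back := h.backModel.frontControl_of_nested
    (tendsto_atTop_of_tendsto_div tendsto_id (tendsto_sub_div tendsto_id (.of_forall hτ) hθ)
      (sub_pos.2 hθ₁))
    (fun m n i j hi hj hij => hnest.2 m n i.rev j.rev (by rw [Fin.val_rev]; omega)
      (by rw [Fin.val_rev]; omega) (by rwa [Fin.rev_rev, Fin.rev_rev])) h₂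

variable [IsProbabilityMeasure P]

lemma twoSidedControl_of_memLp (h : IsSingleChangeModel P Z τ F₁ F₂) {l : Filter (ℕ × Ω)}
    (hl : SummableVanish P l) (hτ : ∀ n, τ n ≤ n)
    (hθ : Tendsto (fun n => (τ n : ℝ) / n) atTop (𝓝 θ)) (hθ₀ : 0 < θ) (hθ₁ : θ < 1)
    (h₁ : MemLp (fun x => x) 4 F₁) (h₂ : MemLp (fun x => x) 4 F₂) :
    TwoSidedControl l Prod.fst (fun k => τ k.1) (fun k i => Z k.1 i k.2) F₁ F₂ θ where
  size := hl.fst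
  change_le k := hτ k.1
  change := hθ.comp hl.fst
  pos := hθ₀
  lt_one := hθ₁
  integrable_left := h₁.integrable (by norm_num)
  integrable_right := h₂.integrable (by norm_num)
  front := (h.frontModel hτ).frontControl_of_memLp hl h₁
  back := h.backModel.frontControl_of_memLp hl h₂

/-- A random permutation destroys the change: the permuted sample looks homogeneous, with the
mixture of the two laws on both sides. -/
lemma twoSidedControl_perm (h : IsSingleChangeModel P Z τ F₁ F₂) (hτ : ∀ n, τ n ≤ n)
    (hθ : Tendsto (fun n => (τ n : ℝ) / n) atTop (𝓝 θ)) (hθ₀ : 0 < θ) (hθ₁ : θ < 1)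
    (h₁ : MemLp (fun x => x) 4 F₁) (h₂ : MemLp (fun x => x) 4 F₂) :
    TwoSidedControl (proportionFilter (probFilter P) fun k => Equiv.Perm (Fin k.1))
      (fun q => q.1.1) (fun q => τ q.1.1) (fun q i => Z q.1.1 (q.2 i) q.1.2)
      (mix F₁ F₂ θ (1 - θ)) (mix F₁ F₂ θ (1 - θ)) θ := by
  have hsize := tendsto_fst_probFilter P
  have hmean {f : Vec d → ℝ} (hf : Measurable f) (hf₁ : MemLp f 2 F₁) (hf₂ : MemLp f 2 F₂) :=
    meanLimit_probFilter (h.frontModel hτ) h.backModel hθ hθ₀.le hθ₁.le hf hf₁ hf₂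
  have hsq {F : Measure (Vec d)} (hF : MemLp (fun x => x) 4 F) :
      MemLp (fun x : Vec d => ‖x‖ ^ 2) 2 F := by
    rw [memLp_two_iff_integrable_sq (by fun_prop)]
    simpa only [← pow_mul] using hF.integrable_norm_pow (p := 4) (by norm_num)
  exact ChangePoint.twoSidedControl_perm (L := probFilter P) (N := Prod.fst)
    (z := fun k i => Z k.1 i k.2) (τ := fun k => τ k.1) hsize (fun k => hτ k.1) (hθ.comp hsize)
    hθ₀ hθ₁
    (integrable_mix (h₁.integrable (by norm_num)) (h₂.integrable (by norm_num)) _ _)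
    (fun f hf => hmean hf.measurable (hf.memLp (h₁.mono_exponent (by norm_num)))
      (hf.memLp (h₂.mono_exponent (by norm_num))))
    (hmean (by fun_prop) (hsq h₁) (hsq h₂))

end IsSingleChangeModel

section Consistency

variable {Ω : Type*} [MeasurableSpace Ω] {P : Measure Ω} {d : ℕ} {F₁ F₂ : Measure (Vec d)}
  [IsProbabilityMeasure F₁] [IsProbabilityMeasure F₂] {τ : ℕ → ℕ} {δ : ℕ → ℝ}
  {Z : (n : ℕ) → Fin n → Ω → Vec d} {T : ℕ → Ω → ℕ} {θ : ℝ}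

lemma ae_tendsto_changePoint (hF : F₁ ≠ F₂)
    (h : TwoSidedControl (aeFilter P) Prod.fst (fun k => τ k.1) (fun k i => Z k.1 i k.2) F₁ F₂ θ)
    (hτδ : ∀ᶠ n in atTop, τ n ∈ searchRange n (δ n)) (hδ : ∀ᶠ n : ℕ in atTop, 2 ≤ n * δ n)
    (hT : ∀ (n : ℕ) (ω : Ω), (searchRange n (δ n)).Nonempty →
      IsPotentialChangePoint (δ n) (fun i => Z n i ω) (T n ω)) :
    ∀ᵐ ω ∂P, Tendsto (fun n : ℕ => (T n ω : ℝ) / n) atTop (𝓝 θ) := by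
  have hD : 0 < limitDivergence F₁ F₂ :=
    limitDivergence_pos h.integrable_left h.integrable_right hF
  have hmargin : ∀ᶠ k in aeFilter P, 2 ≤ T k.1 k.2 ∧ T k.1 k.2 + 2 ≤ k.1 := by
    filter_upwards [h.size.eventually hτδ, h.size.eventually hδ] with k hk hδ
    exact two_le_of_mem_searchRange hδ (hT k.1 k.2 ⟨_, hk⟩).1
  have hmax : ∀ᶠ k in aeFilter P, criterion (fun i => Z k.1 i k.2) (τ k.1) ≤
      criterion (fun i => Z k.1 i k.2) (T k.1 k.2) := by
    filter_upwards [h.size.eventually hτδ] with k hk using (hT k.1 k.2 ⟨_, hk⟩).2 _ hk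
  exact tendsto_aeFilter.1 (h.tendsto_maximiser hD hmargin hmax)

lemma tendsto_measure_detected [IsProbabilityMeasure P] (hF : F₁ ≠ F₂)
    (hZ : IsSingleChangeModel P Z τ F₁ F₂) (hτ : ∀ n, τ n ≤ n)
    (hθ : Tendsto (fun n => (τ n : ℝ) / n) atTop (𝓝 θ)) (hθ₀ : 0 < θ) (hθ₁ : θ < 1)
    (h₁ : MemLp (fun x => x) 4 F₁) (h₂ : MemLp (fun x => x) 4 F₂)
    (hτδ : ∀ᶠ n in atTop, τ n ∈ searchRange n (δ n)) (hδ : ∀ᶠ n : ℕ in atTop, 2 ≤ n * δ n)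
    (hT : ∀ (n : ℕ) (ω : Ω), (searchRange n (δ n)).Nonempty →
      IsPotentialChangePoint (δ n) (fun i => Z n i ω) (T n ω)) {α : ℝ} (hα : 0 < α) :
    Tendsto (fun n : ℕ => P {ω | IsDetectedChangePoint (δ n) α (fun i => Z n i ω) (T n ω)})
      atTop (𝓝 1) := by
  have hsample := hZ.twoSidedControl_of_memLp (summableVanish_probFilter P) hτ hθ hθ₀ hθ₁ h₁ h₂
  have hperm := hZ.twoSidedControl_perm hτ hθ hθ₀ hθ₁ h₁ h₂
  have hchange := hsample.size.eventually hτδ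
  set S := θ * (1 - θ) * limitDivergence F₁ F₂
  have hS : 0 < S := mul_pos (mul_pos hθ₀ (sub_pos.2 hθ₁))
    (limitDivergence_pos hsample.integrable_left hsample.integrable_right hF)
  refine tendsto_measure_one_of_eventually
    (p := fun k => IsDetectedChangePoint (δ k.1) α (fun i => Z k.1 i k.2) (T k.1 k.2)) ?_
  filter_upwards [hchange, hsample.eventually_lt_testStatistic hchange (half_lt_self hS),
    TwoSidedControl.eventually_permutationCutoff_le (N := Prod.fst) (τ := fun k => τ k.1)
      (z := fun k i => Z k.1 i k.2) (δ := fun k => δ k.1) hperm (hsample.size.eventually hδ)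
      (hchange.mono fun _ hk => ⟨_, hk⟩) hα (half_pos hS)] with k hk hstatistic hcutoff
  exact ⟨hT k.1 k.2 ⟨_, hk⟩, hcutoff.trans_lt hstatistic⟩

end Consistency

end ChangePoint

theorem theorem1_general {Ω : Type*} [MeasurableSpace Ω] (P : Measure Ω) [IsProbabilityMeasure P]
    (d : ℕ) (F₁ F₂ : Measure (ChangePoint.Vec d))
    [IsProbabilityMeasure F₁] [IsProbabilityMeasure F₂] (hF : F₁ ≠ F₂)
    (τ : ℕ → ℕ) (hτ : ∀ n, τ n ≤ n) (θ : ℝ) (hθ₀ : 0 < θ) (hθ₁ : θ < 1)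
    (hθ : Tendsto (fun n => (τ n : ℝ) / n) atTop (𝓝 θ))
    (Z : (n : ℕ) → Fin n → Ω → ChangePoint.Vec d)
    (hZ : ChangePoint.IsSingleChangeModel P Z τ F₁ F₂)
    (δ : ℕ → ℝ) (hτδ : ∀ᶠ n in atTop, τ n ∈ ChangePoint.searchRange n (δ n))
    (hδ : ∀ᶠ n : ℕ in atTop, 2 ≤ n * δ n)
    (T : ℕ → Ω → ℕ)
    (hT : ∀ (n : ℕ) (ω : Ω), (ChangePoint.searchRange n (δ n)).Nonempty →
      ChangePoint.IsPotentialChangePoint (δ n) (fun i => Z n i ω) (T n ω)) :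
    (ChangePoint.IsNested Z τ → Integrable (fun x => x) F₁ → Integrable (fun x => x) F₂ →
      ∀ᵐ ω ∂P, Tendsto (fun n : ℕ => (T n ω : ℝ) / n) atTop (𝓝 θ)) ∧
    (MemLp (fun x => x) 4 F₁ → MemLp (fun x => x) 4 F₂ →
      (∀ᵐ ω ∂P, Tendsto (fun n : ℕ => (T n ω : ℝ) / n) atTop (𝓝 θ)) ∧
      ∀ α : ℝ, 0 < α →
        Tendsto (fun n : ℕ => P {ω | ChangePoint.IsDetectedChangePoint (δ n) α
          (fun i => Z n i ω) (T n ω)}) atTop (𝓝 1)) := by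
  refine ⟨fun hnest h₁ h₂ => ?_, fun h₁ h₂ => ⟨?_, fun α hα => ?_⟩⟩
  · exact ChangePoint.ae_tendsto_changePoint hF
      (hZ.twoSidedControl_of_nested hnest hτ hθ hθ₀ hθ₁ h₁ h₂) hτδ hδ hT
  · exact ChangePoint.ae_tendsto_changePoint hF
      (hZ.twoSidedControl_of_memLp (ChangePoint.summableVanish_aeFilter P) hτ hθ hθ₀ hθ₁ h₁ h₂)
      hτδ hδ hT
  · exact ChangePoint.tendsto_measure_detected hF hZ hτ hθ hθ₀ hθ₁ h₁ h₂ hτδ hδ hT hα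

theorem theorem1 {Ω : Type*} [MeasurableSpace Ω] (P : Measure Ω) [IsProbabilityMeasure P]
    (d : ℕ) (F₁ F₂ : Measure (ChangePoint.Vec d))
    [IsProbabilityMeasure F₁] [IsProbabilityMeasure F₂] (hF : F₁ ≠ F₂)
    (h₁ : Integrable (fun x => x) F₁) (h₂ : Integrable (fun x => x) F₂)
    (θ : ℝ) (hθ₀ : 0 < θ) (hθ₁ : θ < 1)
    (Z : (n : ℕ) → Fin n → Ω → ChangePoint.Vec d)
    (hZ : ChangePoint.IsSingleChangeModel P Z (fun n => ⌊(n : ℝ) * θ⌋₊) F₁ F₂)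
    (δ : ℕ → ℝ) (hδ : Tendsto δ atTop (𝓝 0))
    (hnδ : Tendsto (fun n : ℕ => (n : ℝ) * δ n) atTop atTop)
    (T : ℕ → Ω → ℕ)
    (hT : ∀ (n : ℕ) (ω : Ω), (ChangePoint.searchRange n (δ n)).Nonempty →
      ChangePoint.IsPotentialChangePoint (δ n) (fun i => Z n i ω) (T n ω)) :
    (ChangePoint.IsNested Z (fun n => ⌊(n : ℝ) * θ⌋₊) →
      ∀ᵐ ω ∂P, Tendsto (fun n : ℕ => (T n ω : ℝ) / n) atTop (𝓝 θ)) ∧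
    (MemLp (fun x => x) 4 F₁ → MemLp (fun x => x) 4 F₂ →
      ∀ᵐ ω ∂P, Tendsto (fun n : ℕ => (T n ω : ℝ) / n) atTop (𝓝 θ)) ∧
    (ChangePoint.IsSubExponential F₁ → ChangePoint.IsSubExponential F₂ →
      ∀ α : ℝ, 0 < α → α < 1 →
        Tendsto (fun n : ℕ => P {ω | ChangePoint.IsDetectedChangePoint (δ n) α
          (fun i => Z n i ω) (T n ω)}) atTop (𝓝 1)) := by
  have hθ : Tendsto (fun n : ℕ => (⌊(n : ℝ) * θ⌋₊ : ℝ) / n) atTop (𝓝 θ) := by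
    simpa only [mul_comm, Function.comp_def] using
      (tendsto_nat_floor_mul_div_atTop hθ₀.le).comp tendsto_natCast_atTop_atTop
  obtain ⟨hnested, hmoment⟩ := theorem1_general P d F₁ F₂ hF _
    (fun n => Nat.floor_le_of_le (mul_le_of_le_one_right n.cast_nonneg hθ₁.le)) θ hθ₀ hθ₁ hθ Z hZ δ
    (ChangePoint.eventually_mem_searchRange hθ hθ₀ hθ₁ hδ) (hnδ.eventually_ge_atTop 2) T hT
  exact ⟨fun h => hnested h h₁ h₂, fun h₁ h₂ => (hmoment h₁ h₂).1,
    fun h₁ h₂ α hα _ => (hmoment (h₁.memLp 4) (h₂.memLp 4)).2 α hα⟩
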